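/- Let $\mathrm{Im}\,\tau>0$, $\mathrm{Im}\,\eta>0$, $e(x)=e^{2\pi \mathrm i x}$, $p=e(\tau)$, $q=e(2\eta)$, $\sqrt{pq}=e(\tau/2+\eta)$. Let $\theta_3(z|\tau)=\sum_{n\in\mathbb Z}e^{\pi \mathrm i n^2\tau+2\pi \mathrm i nz}$, $\theta_4(z)=\theta_3(z+\tfrac12)$, $\theta_2(z)=\sum_{n\in\mathbb Z}e^{\pi \mathrm i(n+1/2)^2\tau+2\pi \mathrm i(n+1/2)z}$, $\theta_1(z)=-\theta_2(z+\tfrac12)$, and assume $\theta_a(\eta)\ne0$ for $a=1,2,3,4$. Let $\Gamma(x;p,q)=\prod_{j,k\ge0}\frac{1-x^{-1}p^{j+1}q^{k+1}}{1-xp^jq^k}$ and $(x;p)_\infty=\prod_{j\ge0}(1-xp^j)$; $\Gamma(t_1,\dots,t_n;p,q)$ is the product of the $\Gamma(t_i;p,q)$, and a sign $\pm$ in an argument means the product over both signs. Let $\mathrm L(u)=\sum_{a=0}^3\frac{\theta_{a+1}(u+\eta)}{\theta_{a+1}(\eta)}\,\sigma_a\otimes\mathbf S^a$, where $\sigma_0=1$,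 $\sigma_1,\sigma_2,\sigma_3$ are the Pauli matrices and $$[\mathbf S^af](z)=\frac{\mathrm i^{\delta_{a,2}}\theta_{a+1}(\eta)}{\theta_1(2z)}\bigl[\theta_{a+1}(2z-2\eta\ell)f(z+\eta)-\theta_{a+1}(-2z-2\eta\ell)f(z-\eta)\bigr].$$ Write $\mathrm L(u_1,u_2)$ for this operator when $u_1=\frac u2+\eta(\ell+\frac12)$, $u_2=\frac u2-\eta(\ell+\frac12)$, and $\mathrm L_j$ for the operator acting in the variable $z_j$ of functions $\Phi(z_1,z_2)$, $j=1,2$. For $\mathbf u=(u_1,u_2,v_1,v_2)\in\mathbb C^4$ put $s_1\mathbf u=(u_2,u_1,v_1,v_2)$, $s_2\mathbf u=(u_1,v_1,u_2,v_2)$, $s_3\mathbf u=(u_1,u_2,v_2,v_1)$. Consider the relations $$\mathrm S_1(\mathbf u)\mathrm L_1(u_1,u_2)=\mathrm L_1(u_2,u_1)\mathrm S_1(\mathbf u),\qquad \mathrm S_3(\mathbf u)\mathrm L_2(v_1,v_2)=\mathrm L_2(v_2,v_1)\mathrm S_3(\mathbf u),$$ $$\mathrm S_2(\mathbf u)\mathrm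 L_1(u_1,u_2)\sigma_3\mathrm L_2(v_1,v_2)=\mathrm L_1(u_1,v_1)\sigma_3\mathrm L_2(u_2,v_2)\mathrm S_2(\mathbf u),\tag{I}$$ and, for $$\mathrm R_{12}(\mathbf u)=\mathrm S_2(s_1s_3s_2\mathbf u)\,\mathrm S_1(s_3s_2\mathbf u)\,\mathrm S_3(s_2\mathbf u)\,\mathrm S_2(\mathbf u),$$ the relation $$\mathrm R_{12}(\mathbf u)\,\mathrm L_1(u_1,u_2)\,\sigma_3\,\mathrm L_2(v_1,v_2)=\mathrm L_1(v_1,v_2)\,\sigma_3\,\mathrm L_2(u_1,u_2)\,\mathrm R_{12}(\mathbf u).\tag{II}$$ (1) Let $W$ be a linear space of functions $\Phi(z_1,z_2)$, and let $\mathrm S_1,\mathrm S_2,\mathrm S_3$ be any families of linear operators, depending on $\mathbf u$, such that $\mathrm S_1$ acts in the variable $z_1$ only and $\mathrm S_3$ in $z_2$ only, such that the $\mathrm S_j(\mathbf u)$ and all entries of $\mathrm L_1(a,b)$, $\mathrm L_2(a,b)$ preserve $W$, and such that (I) holds on $W$ for all $\mathbf u$. Then $\mathrm R_{12}(\mathbf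 u)$ satisfies (II) on $W$ for all $\mathbf u$. (2) The relations (I) and (II) hold for the explicit operators $$[\mathrm S_2(\mathbf u)\Phi](z_1,z_2)=D(e(v_1-u_2);e(z_1),e(z_2))\,\Phi(z_1,z_2),\qquad D(s;x,y)=\Gamma(\sqrt{pq}\,s^{-1}x^{\pm1}y^{\pm1};p,q),$$ $$[\mathrm S_1(\mathbf u)\Phi](z_1,z_2)=e^{-\pi \mathrm i z_1^2/\eta}\,M(e(u_2-u_1))_{e(z_1),e(z)}\,e^{\pi \mathrm i z^2/\eta}\,\Phi(z,z_2),$$ $$M(t)_{wz}\alpha(z)=\frac{(p;p)_\infty(q;q)_\infty}{4\pi \mathrm i}\int_{\mathbb T}\frac{\Gamma(tw^{\pm1}z^{\pm1};p,q)}{\Gamma(t^2,z^{\pm2};p,q)}\,\alpha(z)\,\frac{dz}{z},$$ with $\mathbb T$ the positively oriented unit circle, and $\mathrm S_3(\mathbf u)$ the same operator as $\mathrm S_1(\mathbf u)$ with $z_2$ in the place of $z_1$ and $e(v_2-v_1)$ in the place of $e(u_2-u_1)$. Here (I) for $\mathrm S_2$ is claimed on all functions $\Phi$; (I) for $\mathrm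 S_1$ (for $\mathrm S_3$) on those for which $e^{\pi \mathrm i z_j^2/\eta}\Phi$ is, with the other variable fixed, $1$-periodic in $z_j$ and holomorphic near $|\mathrm{Im}\,z_j|\le\mathrm{Im}\,\eta$, with $j=1$ ($j=2$); and (II) on those for which $e^{\pi \mathrm i(z_1^2+z_2^2)/\eta}\Phi$ is $1$-periodic in each variable and holomorphic near $\{|\mathrm{Im}\,z_1|\le\mathrm{Im}\,\eta,\ |\mathrm{Im}\,z_2|\le\mathrm{Im}\,\eta\}$. Each relation holds at every $(\mathbf u,z_1,z_2)$, with $\theta_1(2z_j)\neq0$ for the variables $z_j$ in which its L-operators act, such that the operator $\mathrm S_j$ (respectively $\mathrm R_{12}$) is given by the above formulas at $(\mathbf u,z_1,z_2)$ and at the points obtained from it by the shifts of the variables by $\pm\eta$ in the relation. This means: no gamma function in the factor $D(e(v_1-u_2);e(z_1),e(z_2))$ of $\mathrm S_2(\mathbf u)$ has a pole; $|tw^{\pm1}|<1$ and $\Gamma(t^2;p,q)\ne0$ for $M(t)_{wz}$; and for $\mathrm R_{12}(\mathbf u)$, all these conditions for the three left factors $\mathrm S_3(s_2\mathbf u)$,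 $\mathrm S_1(s_3s_2\mathbf u)$, $\mathrm S_2(s_1s_3s_2\mathbf u)$ at $(z_1,z_2)$, and $|\sqrt{pq}\,e(u_2-v_1)|<1$. Moreover each relation remains valid for analytic continuations: if the entries of its left-hand side, and the function $\mathrm S_j(\mathbf u)\Phi$ (respectively $\mathrm R_{12}(\mathbf u)\Phi$) on its right-hand side, are continued analytically in $(\mathbf u,z_1,z_2)$ to connected open sets $\Omega$ and $\Omega'$ such that the above $\theta_1(2z_j)$ do not vanish on $\Omega$, all shifts of $\Omega$ are contained in $\Omega'$, and $\Omega$ contains a point at which the formulas apply together with its shifts, then the relation holds on $\Omega$. -/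

import Mathlib

open Complex

namespace EllipticRLL

noncomputable section

/-! ### Special functions -/

/-- The function `e(x) = exp(2πi x)`. -/
def ex (x : ℂ) : ℂ := Complex.exp (2 * Real.pi * I * x)

/-- The Jacobi theta functions: `theta a z τ` is `θ_{a+1}(z|τ)`, for `a = 0, 1, 2, 3`, where
`θ₃(z|τ) = ∑ₙ exp(πi n² τ + 2πi n z)`, `θ₄(z|τ) = θ₃(z + 1/2|τ)`,
`θ₂(z|τ) = ∑ₙ exp(πi (n+1/2)² τ + 2πi (n+1/2) z)` and `θ₁(z|τ) = -θ₂(z + 1/2|τ)`. -/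
def theta : Fin 4 → ℂ → ℂ → ℂ
  | 0, z, τ => -(Complex.exp (Real.pi * I * τ / 4 + Real.pi * I * (z + 1 / 2))
      * jacobiTheta₂ (z + 1 / 2 + τ / 2) τ)
  | 1, z, τ => Complex.exp (Real.pi * I * τ / 4 + Real.pi * I * z) * jacobiTheta₂ (z + τ / 2) τ
  | 2, z, τ => jacobiTheta₂ z τ
  | 3, z, τ => jacobiTheta₂ (z + 1 / 2) τ

/-- `(x; p)_∞ = ∏_{j ≥ 0} (1 - x p^j)`. -/
def qPoch (x p : ℂ) : ℂ := ∏' j : ℕ, (1 - x * p ^ j)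

/-- `∏_{j, k ≥ 0} (1 - x p^j q^k)`. -/
def qPoch₂ (x p q : ℂ) : ℂ := ∏' m : ℕ × ℕ, (1 - x * p ^ m.1 * q ^ m.2)

/-- The elliptic gamma function
`Γ(x; p, q) = ∏_{j, k ≥ 0} (1 - x⁻¹ p^{j+1} q^{k+1}) / (1 - x p^j q^k)`. -/
def ellGamma (p q x : ℂ) : ℂ := qPoch₂ (p * q * x⁻¹) p q / qPoch₂ x p q

/-- `x` is not a pole of `Γ(x; p, q)`. -/
def NotPole (p q x : ℂ) : Prop := ∀ j k : ℕ, x * p ^ j * q ^ k ≠ 1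

/-- `x` is not a zero of `Γ(x; p, q)`. -/
def NotZero (p q x : ℂ) : Prop := ∀ j k : ℕ, x ≠ p ^ (j + 1) * q ^ (k + 1)

/-- `Γ(c x^{±1} y^{±1}; p, q)`, the product of four elliptic gamma functions. -/
def gammaPM (p q c x y : ℂ) : ℂ :=
  ellGamma p q (c * x * y) * ellGamma p q (c * x * y⁻¹) *
    (ellGamma p q (c * x⁻¹ * y) * ellGamma p q (c * x⁻¹ * y⁻¹))

/-! ### The Sklyanin L-operator -/

/-- The Sklyanin algebra generator `S^a` of spin `ℓ`, as a finite-difference operator. -/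
def sklyaninGen (η τ ℓ : ℂ) (a : Fin 4) : Module.End ℂ (ℂ → ℂ) where
  toFun f := fun z =>
    (if a = 2 then I else 1) * theta a η τ / theta 0 (2 * z) τ *
      (theta a (2 * z - 2 * η * ℓ) τ * f (z + η) - theta a (-2 * z - 2 * η * ℓ) τ * f (z - η))
  map_add' f g := by
    funext z; simp only [Pi.add_apply]; ring
  map_smul' c f := by
    funext z; simp only [Pi.smul_apply, smul_eq_mul, RingHom.id_apply]; ring

/-- The matrices `σ₀ = 1` and the Pauli matrices `σ₁, σ₂, σ₃`. -/
def pauli : Fin 4 → Matrix (Fin 2) (Fin 2) ℂ :=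
  ![1, !![0, 1; 1, 0], !![0, -I; I, 0], !![1, 0; 0, -1]]

/-- `w_a(u) = θ_{a+1}(u + η|τ) / θ_{a+1}(η|τ)`. -/
def weight (η τ : ℂ) (a : Fin 4) (u : ℂ) : ℂ := theta a (u + η) τ / theta a η τ

/-- The L-operator `L(u) = ∑_a w_a(u) σ_a ⊗ S^a` with spin `ℓ`. -/
def lOpSpin (η τ ℓ u : ℂ) : Matrix (Fin 2) (Fin 2) (Module.End ℂ (ℂ → ℂ)) :=
  Matrix.of fun i k => ∑ a : Fin 4, (weight η τ a u * pauli a i k) • sklyaninGen η τ ℓ a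

/-- The L-operator `L(u₁, u₂)`: the operator `L(u)` of spin `ℓ`, where `u` and `ℓ` are determined by
`u₁ = u/2 + η(ℓ + 1/2)`, `u₂ = u/2 - η(ℓ + 1/2)`. -/
def lOp (η τ u₁ u₂ : ℂ) : Matrix (Fin 2) (Fin 2) (Module.End ℂ (ℂ → ℂ)) :=
  lOpSpin η τ ((u₁ - u₂) / (2 * η) - 1 / 2) (u₁ + u₂)

theorem lOp_eq_lOpSpin (η τ ℓ u : ℂ) (hη : η ≠ 0) :
    lOp η τ (u / 2 + η * (ℓ + 1 / 2)) (u / 2 - η * (ℓ + 1 / 2)) = lOpSpin η τ ℓ u := by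
  have h₁ : (u / 2 + η * (ℓ + 1 / 2) - (u / 2 - η * (ℓ + 1 / 2))) / (2 * η) - 1 / 2 = ℓ := by
    field_simp; ring
  have h₂ : u / 2 + η * (ℓ + 1 / 2) + (u / 2 - η * (ℓ + 1 / 2)) = u := by ring
  rw [lOp, h₁, h₂]

/-! ### Operators on functions of two variables -/

/-- The operator `A` applied in the first variable. -/
def onFst (A : (ℂ → ℂ) → ℂ → ℂ) (Φ : ℂ × ℂ → ℂ) : ℂ × ℂ → ℂ :=
  fun z => A (fun x => Φ (x, z.2)) z.1

/-- The operator `A` applied in the second variable. -/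
def onSnd (A : (ℂ → ℂ) → ℂ → ℂ) (Φ : ℂ × ℂ → ℂ) : ℂ × ℂ → ℂ :=
  fun z => A (fun y => Φ (z.1, y)) z.2

/-- `onFst` for linear operators. -/
def onFstLin (A : Module.End ℂ (ℂ → ℂ)) : Module.End ℂ (ℂ × ℂ → ℂ) where
  toFun := onFst A
  map_add' Φ Ψ := by
    funext z
    exact congrFun (A.map_add (fun x => Φ (x, z.2)) (fun x => Ψ (x, z.2))) z.1
  map_smul' c Φ := by
    funext z
    exact congrFun (A.map_smul c (fun x => Φ (x, z.2))) z.1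

/-- `onSnd` for linear operators. -/
def onSndLin (A : Module.End ℂ (ℂ → ℂ)) : Module.End ℂ (ℂ × ℂ → ℂ) where
  toFun := onSnd A
  map_add' Φ Ψ := by
    funext z
    exact congrFun (A.map_add (fun y => Φ (z.1, y)) (fun y => Ψ (z.1, y))) z.2
  map_smul' c Φ := by
    funext z
    exact congrFun (A.map_smul c (fun y => Φ (z.1, y))) z.2

/-- Two by two matrices of operators on functions of two variables. -/
abbrev OpMatrix : Type := Matrix (Fin 2) (Fin 2) (Module.End ℂ (ℂ × ℂ → ℂ))

/-- `L₁(a, b)`: the L-operator acting in the variable `z₁`. -/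
def lFst (η τ a b : ℂ) : OpMatrix := (lOp η τ a b).map onFstLin

/-- `L₂(a, b)`: the L-operator acting in the variable `z₂`. -/
def lSnd (η τ a b : ℂ) : OpMatrix := (lOp η τ a b).map onSndLin

/-- The matrix `σ₃` with scalar operators as entries. -/
def sigma₃ : OpMatrix := (pauli 3).map (algebraMap ℂ (Module.End ℂ (ℂ × ℂ → ℂ)))

/-! ### Parameters and their permutations -/

/-- The parameters `𝐮 = (u₁, u₂, v₁, v₂)`. -/
abbrev Params : Type := Fin 4 → ℂ

/-- `s₁𝐮 = (u₂, u₁, v₁, v₂)`. -/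
def s₁ (u : Params) : Params := ![u 1, u 0, u 2, u 3]

/-- `s₂𝐮 = (u₁, v₁, u₂, v₂)`. -/
def s₂ (u : Params) : Params := ![u 0, u 2, u 1, u 3]

/-- `s₃𝐮 = (u₁, u₂, v₂, v₁)`. -/
def s₃ (u : Params) : Params := ![u 0, u 1, u 3, u 2]

/-- `R₁₂(𝐮) = S₂(s₁s₃s₂𝐮) S₁(s₃s₂𝐮) S₃(s₂𝐮) S₂(𝐮)`, for operators `S₁, S₂, S₃` depending on the
parameters. -/
def rOp (S₁ S₂ S₃ : Params → (ℂ × ℂ → ℂ) → ℂ × ℂ → ℂ) (u : Params) (Φ : ℂ × ℂ → ℂ) : ℂ × ℂ → ℂ :=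
  S₂ (s₁ (s₃ (s₂ u))) (S₁ (s₃ (s₂ u)) (S₃ (s₂ u) (S₂ u Φ)))

/-! ### The elliptic Fourier transformation and the explicit operators -/

/-- The kernel `Γ(t w^{±1} z^{±1}; p, q) / Γ(t², z^{±2}; p, q)`. -/
def mKernel (p q t w z : ℂ) : ℂ :=
  gammaPM p q t w z / (ellGamma p q (t ^ 2) * (ellGamma p q (z ^ 2) * ellGamma p q ((z ^ 2)⁻¹)))

/-- The elliptic Fourier transformation
`M(t)_{wz} α = (p;p)_∞ (q;q)_∞ / (4πi) ∫_𝕋 Γ(t w^{±1} z^{±1}) / Γ(t², z^{±2}) α(z) dz/z`.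
The unit circle is parametrized by `z = e(x)`, `x ∈ [0, 1]`, so that `dz/z = 2πi dx`, and `α` is
given as a function of `x`. -/
def mOp (p q t : ℂ) (α : ℂ → ℂ) (w : ℂ) : ℂ :=
  qPoch p p * qPoch q q / (4 * Real.pi * I) *
    ∫ x in (0 : ℝ)..1, mKernel p q t w (ex x) * α x * (2 * Real.pi * I)

/-- `D(s; x, y) = Γ(√(pq) s⁻¹ x^{±1} y^{±1}; p, q)` with `p = e(τ)`, `q = e(2η)` and
`√(pq) = e(τ/2 + η)`. -/
def dFun (η τ s x y : ℂ) : ℂ := gammaPM (ex τ) (ex (2 * η)) (ex (τ / 2 + η) * s⁻¹) x y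

/-- The one-variable operator
`f ↦ e^{-πi z²/η} M(e(c))_{e(z), e(x)} e^{πi x²/η} f(x)`, with `p = e(τ)`, `q = e(2η)`. -/
def fourierOp (η τ c : ℂ) (f : ℂ → ℂ) (z : ℂ) : ℂ :=
  Complex.exp (-(Real.pi * I * z ^ 2 / η)) *
    mOp (ex τ) (ex (2 * η)) (ex c) (fun x => Complex.exp (Real.pi * I * x ^ 2 / η) * f x) (ex z)

/-- The operator `S₁(𝐮)`. -/
def opS₁ (η τ : ℂ) (u : Params) : (ℂ × ℂ → ℂ) → ℂ × ℂ → ℂ := onFst (fourierOp η τ (u 1 - u 0))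

/-- The operator `S₃(𝐮)`. -/
def opS₃ (η τ : ℂ) (u : Params) : (ℂ × ℂ → ℂ) → ℂ × ℂ → ℂ := onSnd (fourierOp η τ (u 3 - u 2))

/-- The operator `S₂(𝐮)` of multiplication by `D(e(v₁ - u₂); e(z₁), e(z₂))`. -/
def opS₂ (η τ : ℂ) (u : Params) (Φ : ℂ × ℂ → ℂ) : ℂ × ℂ → ℂ :=
  fun z => dFun η τ (ex (u 2 - u 1)) (ex z.1) (ex z.2) * Φ z

/-! ### Where the formulas are meaningful -/

/-- Values of the parameters and of the variables `(z₁, z₂)`. -/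
abbrev Point : Type := Params × (ℂ × ℂ)

/-- The points at which none of the gamma functions in the factor `S₂(𝐮)` has a pole. -/
def domS₂ (η τ : ℂ) : Set Point :=
  {x | ∀ ε δ : ℤˣ, NotPole (ex τ) (ex (2 * η))
    (ex (τ / 2 + η + x.1 1 - x.1 2 + (ε : ℤ) * x.2.1 + (δ : ℤ) * x.2.2))}

/-- The points at which `S₁(𝐮)` is given by the integral over the unit circle: `|t w^{±1}| < 1` for
`t = e(u₂ - u₁)`, `w = e(z₁)`, and the factor `1/Γ(t²)` is finite. -/
def domS₁ (η τ : ℂ) : Set Point :=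
  {x | ‖ex (x.1 1 - x.1 0) * ex x.2.1‖ < 1 ∧ ‖ex (x.1 1 - x.1 0) * (ex x.2.1)⁻¹‖ < 1 ∧
    NotZero (ex τ) (ex (2 * η)) (ex (x.1 1 - x.1 0) ^ 2)}

/-- The points at which `S₃(𝐮)` is given by the integral over the unit circle. -/
def domS₃ (η τ : ℂ) : Set Point :=
  {x | ‖ex (x.1 3 - x.1 2) * ex x.2.2‖ < 1 ∧ ‖ex (x.1 3 - x.1 2) * (ex x.2.2)⁻¹‖ < 1 ∧
    NotZero (ex τ) (ex (2 * η)) (ex (x.1 3 - x.1 2) ^ 2)}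

/-- The points at which all factors of `R₁₂(𝐮)` are given by integrals over the unit circle. The
condition `|√(pq) e(u₂ - v₁)| < 1` says that the unit circle separates the poles, as functions of
the integration variables, of the factor `S₂(𝐮)`. -/
def domR (η τ : ℂ) : Set Point :=
  {x | ‖ex (τ / 2 + η) * ex (x.1 1 - x.1 2)‖ < 1 ∧ (s₂ x.1, x.2) ∈ domS₃ η τ ∧
    (s₃ (s₂ x.1), x.2) ∈ domS₁ η τ ∧ (s₁ (s₃ (s₂ x.1)), x.2) ∈ domS₂ η τ}

/-- The functions on which `S₁`, `S₃` act (in one variable): `g(z) = e^{πi z²/η} f(z)` is a function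
of `e(z)`, and it is holomorphic near the strip `|Im z| ≤ Im η`, that is, near the annulus
`|q|^{1/2} ≤ |e(z)| ≤ |q|^{-1/2}`. -/
def Admissible (η : ℂ) (f : ℂ → ℂ) : Prop :=
  (∀ z, Complex.exp (Real.pi * I * (z + 1) ^ 2 / η) * f (z + 1)
      = Complex.exp (Real.pi * I * z ^ 2 / η) * f z) ∧
  AnalyticOnNhd ℂ (fun z => Complex.exp (Real.pi * I * z ^ 2 / η) * f z) {z | |z.im| ≤ η.im}

/-- The functions on which `R₁₂` acts: `g(z₁, z₂) = e^{πi (z₁² + z₂²)/η} Φ(z₁, z₂)` is a function of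
`e(z₁)` and `e(z₂)`, and it is holomorphic near `|Im z₁| ≤ Im η`, `|Im z₂| ≤ Im η`. -/
def Admissible₂ (η : ℂ) (Φ : ℂ × ℂ → ℂ) : Prop :=
  let g : ℂ × ℂ → ℂ := fun z => Complex.exp (Real.pi * I * (z.1 ^ 2 + z.2 ^ 2) / η) * Φ z
  (∀ z₁ z₂, g (z₁ + 1, z₂) = g (z₁, z₂)) ∧ (∀ z₁ z₂, g (z₁, z₂ + 1) = g (z₁, z₂)) ∧
  AnalyticOnNhd ℂ g {z | |z.1.im| ≤ η.im ∧ |z.2.im| ≤ η.im}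

/-! ### Intertwining relations -/

/-- `G` is an analytic continuation, to the connected open set `Ω`, of the function `F` that is
given on `dom`. -/
def IsContinuation (F : Point → ℂ) (dom Ω : Set Point) (G : Point → ℂ) : Prop :=
  IsOpen Ω ∧ IsPreconnected Ω ∧ (Ω ∩ dom).Nonempty ∧ AnalyticOnNhd ℂ G Ω ∧
    ∀ x ∈ Ω ∩ dom, G x = F x

/-- The relation `S(𝐮) A(𝐮) Φ = B(𝐮) S(𝐮) Φ` between operators `S(𝐮)` given by explicit formulas at
the points of `dom`, and matrices `A(𝐮)`, `B(𝐮)` of difference operators whose shifts are in `steps`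
and whose coefficients are regular on `reg`. The relation is required where the explicit formulas
apply, and also for analytic continuations of the two sides in the parameters and variables. -/
structure Intertwines (S : Params → (ℂ × ℂ → ℂ) → ℂ × ℂ → ℂ) (A B : Params → OpMatrix)
    (dom : Set Point) (steps reg : Set (ℂ × ℂ)) (Φ : ℂ × ℂ → ℂ) : Prop where
  direct : ∀ (u : Params) (z : ℂ × ℂ), z ∈ reg → (u, z) ∈ dom → (∀ d ∈ steps, (u, z + d) ∈ dom) →
    ∀ i k, S u (A u i k Φ) z = B u i k (S u Φ) z
  continued : ∀ (Ω Ω' : Set Point) (H : Fin 2 → Fin 2 → Point → ℂ) (G : Point → ℂ),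
    (∀ i k, IsContinuation (fun x => S x.1 (A x.1 i k Φ) x.2) dom Ω (H i k)) →
    IsContinuation (fun x => S x.1 Φ x.2) dom Ω' G →
    (∀ x ∈ Ω, x.2 ∈ reg ∧ ∀ d ∈ steps, (x.1, x.2 + d) ∈ Ω') →
    (∃ x ∈ Ω, x ∈ dom ∧ ∀ d ∈ steps, (x.1, x.2 + d) ∈ dom) →
    ∀ x ∈ Ω, ∀ i k, H i k x = B x.1 i k (fun z => G (x.1, z)) x.2

/-- The points with `θ₁(2z₁) ≠ 0`. -/
def regFst (τ : ℂ) : Set (ℂ × ℂ) := {z | theta 0 (2 * z.1) τ ≠ 0}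

/-- The points with `θ₁(2z₂) ≠ 0`. -/
def regSnd (τ : ℂ) : Set (ℂ × ℂ) := {z | theta 0 (2 * z.2) τ ≠ 0}

/-- The shifts in `L₁`. -/
def stepsFst (η : ℂ) : Set (ℂ × ℂ) := {(η, 0), (-η, 0)}

/-- The shifts in `L₂`. -/
def stepsSnd (η : ℂ) : Set (ℂ × ℂ) := {(0, η), (0, -η)}

/-- The shifts in products of entries of `L₁` and `L₂`. -/
def stepsBoth (η : ℂ) : Set (ℂ × ℂ) := {(η, η), (η, -η), (-η, η), (-η, -η)}

end

end EllipticRLL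

open EllipticRLL

namespace EllipticRLL

/-! ### Infinite products -/

section Products

variable {ι : Type*} {a : ι → ℂ}

/-! By `lOp_apply`, every entry of L(a, b) is a difference operator with two terms f(z ± η), whose
coefficients `lCoeff` depend on a + b + η and on ±2z + (b − a + η). Everything rests on two facts
about these coefficients.

For S₁ and S₃: swapping a and b only reverses b − a in the second argument. The shifts of the
argument of Φ are transferred to the integral kernel by moving the contour. The factor θ(e(2x); p)
of the kernel cancels the denominator θ₁(2x) of L. What remains is an identity between kernels
shifted in x and kernels shifted in z (`kernel_exchange`). The difference equation Γ(qx) = θ(x; p)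
Γ(x) reduces it to the four-term relation `theta_exchange`, which is the linear relation between the
values of a quadratic form on ℂ² at four vectors.

For S₂: in terms of theta functions of modulus τ/2 the coefficient matrix has rank one, with a in
the left factor and b in the right one (`lCoeff_eq_leftFactor_mul`). In L₁(a, b) σ₃ L₂(c, d) the
inner factors contract to a product of two values of θ₄. One is symmetric in b and c; the change of
the other is compensated by D (`gammaFour_mul_theta`).

Part (1) is then formal: the factors of R₁₂ rearrange the parameters as (u₁,u₂|v₁,v₂) →
(u₁,v₁|u₂,v₂) → (u₁,v₁|v₂,u₂) → (v₁,u₁|v₂,u₂) → (v₁,v₂|u₁,u₂), and operators in different variables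
commute.

This argument does not cover the explicit R₁₂, because D Φ need not be holomorphic where the
contours of S₁ and S₃ would be moved one at a time. Instead `fourier_rll` treats S₁ S₃ S₂ in one
step: in the term with Φ(z₁ + εη, z₂ + δη) both contours move simultaneously, by −εη and −δη. Along
this path the product of D and the coefficient stays holomorphic (`jointCoeff`); it contains the
coefficient of L₁(a, b) σ₃ L₂(c, d) at the start and that of L₁(a, c) σ₃ L₂(b, d) at the end. The
outer S₂ is a multiplication, so the pointwise relation `opS₂_rll` suffices for it.

The statements on continuations follow from the identity theorem (`Intertwines.of_direct`). -/

lemma multipliable_one_sub_mul (ha : Summable (‖a ·‖)) (x : ℂ) :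
    Multipliable fun i => 1 - x * a i := by
  have h : Summable fun i => ‖-(x * a i)‖ := by
    simpa using ha.mul_left ‖x‖
  simpa [sub_eq_add_neg] using multipliable_one_add_of_summable h

/-- The convergence is locally uniform: on the ball of radius ‖x‖ + 1 the terms are dominated by
(‖x‖ + 1) ‖aᵢ‖. -/
lemma differentiable_tprod_one_sub_mul (ha : Summable (‖a ·‖)) :
    Differentiable ℂ fun x => ∏' i, (1 - x * a i) := by
  intro x
  have hP : HasProdLocallyUniformlyOn (fun i x => 1 + -(x * a i)) (fun x => ∏' i, (1 + -(x * a i)))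
      (Metric.ball (0 : ℂ) (‖x‖ + 1)) := by
    refine Summable.hasProdLocallyUniformlyOn_one_add (u := fun i => (‖x‖ + 1) * ‖a i‖)
      Metric.isOpen_ball (ha.mul_left _) (.of_forall fun i y hy => ?_) fun i => by fun_prop
    rw [norm_neg, norm_mul]
    gcongr
    simpa using (mem_ball_zero_iff.1 hy).le
  have hD := hP.differentiableOn (.of_forall fun s => by
    simpa [Finset.prod_fn] using DifferentiableOn.finsetProd (fun _ _ => by fun_prop))
    Metric.isOpen_ball
  simpa [sub_eq_add_neg] using hD.differentiableAt (Metric.isOpen_ball.mem_nhds (by simp))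

lemma tprod_one_sub_mul_ne_zero_iff (ha : Summable (‖a ·‖)) (x : ℂ) :
    ∏' i, (1 - x * a i) ≠ 0 ↔ ∀ i, x * a i ≠ 1 := by
  constructor
  · intro h i hi
    exact h (tprod_of_exists_eq_zero ⟨i, by simp [hi]⟩)
  · intro h
    have := tprod_one_add_ne_zero_of_summable (f := fun i => -(x * a i))
      (fun i => by
        rw [← sub_eq_add_neg]
        exact sub_ne_zero.2 (h i).symm) (by simpa using ha.mul_left ‖x‖)
    simpa [sub_eq_add_neg] using this

end Products

/-! ### Single and double q-Pochhammer products -/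

section QPoch

variable {p q x : ℂ}

lemma summable_norm_pow (hp : ‖p‖ < 1) : Summable fun j : ℕ => ‖p ^ j‖ := by
  simpa using summable_geometric_of_lt_one (norm_nonneg p) hp

lemma summable_norm_pow_mul_pow (hp : ‖p‖ < 1) (hq : ‖q‖ < 1) :
    Summable fun m : ℕ × ℕ => ‖p ^ m.1 * q ^ m.2‖ :=
  (summable_norm_pow hp).mul_norm (summable_norm_pow hq)

lemma qPoch₂_eq (x p q : ℂ) : qPoch₂ x p q = ∏' m : ℕ × ℕ, (1 - x * (p ^ m.1 * q ^ m.2)) := by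
  simp [qPoch₂, mul_assoc]

lemma differentiable_qPoch (hp : ‖p‖ < 1) : Differentiable ℂ fun x => qPoch x p :=
  differentiable_tprod_one_sub_mul (summable_norm_pow hp)

lemma differentiable_qPoch₂ (hp : ‖p‖ < 1) (hq : ‖q‖ < 1) :
    Differentiable ℂ fun x => qPoch₂ x p q := by
  simp_rw [qPoch₂_eq]
  exact differentiable_tprod_one_sub_mul (summable_norm_pow_mul_pow hp hq)

lemma qPoch_ne_zero_iff (hp : ‖p‖ < 1) : qPoch x p ≠ 0 ↔ ∀ j : ℕ, x * p ^ j ≠ 1 :=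
  tprod_one_sub_mul_ne_zero_iff (summable_norm_pow hp) x

lemma qPoch₂_ne_zero_iff (hp : ‖p‖ < 1) (hq : ‖q‖ < 1) : qPoch₂ x p q ≠ 0 ↔ NotPole p q x := by
  rw [qPoch₂_eq, tprod_one_sub_mul_ne_zero_iff (summable_norm_pow_mul_pow hp hq)]
  simp [NotPole, mul_assoc]

lemma mul_pow_ne_one (hp : ‖p‖ < 1) (hx : ‖x‖ < 1) (j : ℕ) : x * p ^ j ≠ 1 := by
  intro h
  have h' := congrArg norm h
  rw [norm_mul, norm_pow, norm_one] at h'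
  have := mul_le_of_le_one_right (norm_nonneg x) (pow_le_one₀ (n := j) (norm_nonneg p) hp.le)
  linarith

lemma qPoch_ne_zero (hp : ‖p‖ < 1) (hx : ‖x‖ < 1) : qPoch x p ≠ 0 :=
  (qPoch_ne_zero_iff hp).2 (mul_pow_ne_one hp hx)

lemma notPole_of_norm_lt_one (hp : ‖p‖ < 1) (hq : ‖q‖ < 1) (hx : ‖x‖ < 1) : NotPole p q x := by
  intro j k
  refine mul_pow_ne_one hq ?_ k
  rw [norm_mul, norm_pow]
  exact (mul_le_of_le_one_right (norm_nonneg x) (pow_le_one₀ (norm_nonneg p) hp.le)).trans_lt hx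

lemma qPoch_eq_mul (hp : ‖p‖ < 1) (x : ℂ) : qPoch x p = (1 - x) * qPoch (p * x) p := by
  have h := tprod_eq_zero_mul' (f := fun j : ℕ => 1 - x * p ^ j) (by
      simpa [pow_succ, mul_assoc, mul_comm, mul_left_comm] using
        multipliable_one_sub_mul (summable_norm_pow hp) (p * x))
  rw [qPoch, h, qPoch]
  simp [pow_succ, mul_assoc, mul_comm, mul_left_comm]

lemma qPoch₂_comm (x p q : ℂ) : qPoch₂ x p q = qPoch₂ x q p := by
  rw [qPoch₂, qPoch₂, ← (Equiv.prodComm ℕ ℕ).tprod_eq]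
  simp [mul_assoc, mul_comm, mul_left_comm]

/-- `ℕ × ℕ` as the disjoint union of `{(j, 0)}` and `{(j, k + 1)}`. -/
def natSumEquivProd : ℕ ⊕ ℕ × ℕ ≃ ℕ × ℕ where
  toFun := Sum.elim (fun j => (j, 0)) (fun m => (m.1, m.2 + 1))
  invFun m := match m with
    | (j, 0) => Sum.inl j
    | (j, k + 1) => Sum.inr (j, k)
  left_inv := by rintro (j | ⟨j, k⟩) <;> rfl
  right_inv := by rintro ⟨j, _ | k⟩ <;> rfl

/-- The factors with k = 0 form (x; p)_∞, and those with k ≥ 1 form the double product at q x. -/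
lemma qPoch₂_eq_qPoch_mul (hp : ‖p‖ < 1) (hq : ‖q‖ < 1) (x : ℂ) :
    qPoch₂ x p q = qPoch x p * qPoch₂ (q * x) p q := by
  rw [qPoch₂_eq, ← natSumEquivProd.tprod_eq, Multipliable.tprod_sum, qPoch, qPoch₂_eq]
  · simp [natSumEquivProd, pow_succ, mul_assoc, mul_comm, mul_left_comm]
  · simpa [natSumEquivProd, Function.comp_def] using
      multipliable_one_sub_mul (summable_norm_pow hp) x
  · simpa [natSumEquivProd, Function.comp_def, pow_succ, mul_assoc, mul_comm, mul_left_comm] using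
      multipliable_one_sub_mul (summable_norm_pow_mul_pow hp hq) (q * x)

lemma qPoch₂_eq_qPoch_mul' (hp : ‖p‖ < 1) (hq : ‖q‖ < 1) (x : ℂ) :
    qPoch₂ x p q = qPoch x q * qPoch₂ (p * x) p q := by
  rw [qPoch₂_comm x, qPoch₂_comm _ p, qPoch₂_eq_qPoch_mul hq hp]

end QPoch

/-! ### Additive notation -/

lemma ex_add (x y : ℂ) : ex (x + y) = ex x * ex y := by
  rw [ex, ex, ex, ← Complex.exp_add]; ring_nf

lemma ex_neg (x : ℂ) : ex (-x) = (ex x)⁻¹ := by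
  rw [ex, ex, ← Complex.exp_neg]; ring_nf

lemma ex_sub (x y : ℂ) : ex (x - y) = ex x * (ex y)⁻¹ := by
  rw [sub_eq_add_neg, ex_add, ex_neg]

lemma ex_ne_zero (x : ℂ) : ex x ≠ 0 := Complex.exp_ne_zero _

lemma ex_zero : ex 0 = 1 := by simp [ex]

lemma ex_one : ex 1 = 1 := by simp [ex]

lemma ex_add_one (x : ℂ) : ex (x + 1) = ex x := by rw [ex_add, ex_one, mul_one]

lemma ex_two_mul (x : ℂ) : ex (2 * x) = ex x ^ 2 := by rw [two_mul, ex_add, sq]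

lemma differentiable_ex : Differentiable ℂ ex := by
  unfold ex; fun_prop

lemma norm_ex (x : ℂ) : ‖ex x‖ = Real.exp (-(2 * Real.pi * x.im)) := by
  rw [ex, Complex.norm_exp]; simp

lemma norm_ex_lt_one_iff {x : ℂ} : ‖ex x‖ < 1 ↔ 0 < x.im := by
  rw [norm_ex, Real.exp_lt_one_iff]
  have := Real.pi_pos
  constructor
  · intro h; by_contra! h'; nlinarith
  · intro h; nlinarith

/-- `(e(ζ); p)_∞ (p e(-ζ); p)_∞` with `p = e(τ)`. -/
noncomputable def modTheta (ζ τ : ℂ) : ℂ := qPoch (ex ζ) (ex τ) * qPoch (ex (τ - ζ)) (ex τ)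

/-- The elliptic gamma function of an additive argument. -/
noncomputable def expGamma (η τ ζ : ℂ) : ℂ := ellGamma (ex τ) (ex (2 * η)) (ex ζ)

/-! ### The multiplicative theta function -/

section ModTheta

variable {τ : ℂ}

/-- The first product loses the factor 1 − e(ζ), the second gains 1 − e(−ζ), and their quotient is
−e(−ζ). -/
lemma modTheta_add_tau (hτ : 0 < τ.im) (ζ : ℂ) :
    modTheta (ζ + τ) τ = -ex (-ζ) * modTheta ζ τ := by
  have hp := norm_ex_lt_one_iff.2 hτ
  have h0 := ex_ne_zero ζ
  rw [modTheta, modTheta, qPoch_eq_mul hp (ex ζ), show τ - (ζ + τ) = -ζ by ring,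
    qPoch_eq_mul hp (ex (-ζ)), ex_add ζ τ, ex_sub τ ζ, ex_neg, mul_comm (ex τ) (ex ζ)]
  field_simp
  ring

lemma modTheta_add_one (ζ : ℂ) : modTheta (ζ + 1) τ = modTheta ζ τ := by
  rw [modTheta, modTheta, ex_add_one, ← ex_add_one (τ - (ζ + 1))]
  ring_nf

lemma differentiable_modTheta (hτ : 0 < τ.im) : Differentiable ℂ fun ζ => modTheta ζ τ := by
  have h := differentiable_qPoch (norm_ex_lt_one_iff.2 hτ)
  exact (h.comp differentiable_ex).mul (h.comp (differentiable_ex.comp (by fun_prop)))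

lemma modTheta_ne_zero (hτ : 0 < τ.im) {ζ : ℂ} (h1 : 0 < ζ.im) (h2 : ζ.im < τ.im) :
    modTheta ζ τ ≠ 0 :=
  mul_ne_zero (qPoch_ne_zero (norm_ex_lt_one_iff.2 hτ) (norm_ex_lt_one_iff.2 h1))
    (qPoch_ne_zero (norm_ex_lt_one_iff.2 hτ) (norm_ex_lt_one_iff.2 (by simpa using h2)))

end ModTheta

/-! ### Difference equation and reflection of the elliptic gamma function -/

section ExpGamma

variable {η τ : ℂ}

lemma norm_ex_two_mul_lt_one (hη : 0 < η.im) : ‖ex (2 * η)‖ < 1 :=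
  norm_ex_lt_one_iff.2 (by simpa using hη)

/-- This is Γ(qx) = θ(x; p) Γ(x). At a pole of Γ(x) division by zero would make the right-hand side
0, hence the hypothesis. -/
lemma expGamma_add (hτ : 0 < τ.im) (hη : 0 < η.im) {ζ : ℂ}
    (hζ : NotPole (ex τ) (ex (2 * η)) (ex ζ)) :
    expGamma η τ (ζ + 2 * η) = modTheta ζ τ * expGamma η τ ζ := by
  have hp := norm_ex_lt_one_iff.2 hτ
  have hq := norm_ex_two_mul_lt_one hη
  have h := (qPoch₂_ne_zero_iff hp hq).2 hζ
  have hx := ex_ne_zero ζ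
  have hq0 := ex_ne_zero (2 * η)
  rw [qPoch₂_eq_qPoch_mul hp hq] at h
  rw [expGamma, expGamma, ellGamma, ellGamma, modTheta, ex_add, qPoch₂_eq_qPoch_mul hp hq (ex ζ),
    show ex τ * ex (2 * η) * (ex ζ * ex (2 * η))⁻¹ = ex τ * (ex ζ)⁻¹ by field_simp,
    qPoch₂_eq_qPoch_mul hp hq (ex τ * _), ex_sub, mul_comm (ex ζ) (ex (2 * η)),
    show ex (2 * η) * (ex τ * (ex ζ)⁻¹) = ex τ * ex (2 * η) * (ex ζ)⁻¹ by ring]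
  obtain ⟨h1, h2⟩ := mul_ne_zero_iff.1 h
  field_simp

lemma notPole_ex (hτ : 0 < τ.im) (hη : 0 < η.im) {ζ : ℂ} (hζ : 0 < ζ.im) :
    NotPole (ex τ) (ex (2 * η)) (ex ζ) :=
  notPole_of_norm_lt_one (norm_ex_lt_one_iff.2 hτ) (norm_ex_two_mul_lt_one hη)
    (norm_ex_lt_one_iff.2 hζ)

lemma differentiableAt_expGamma (hτ : 0 < τ.im) (hη : 0 < η.im) {ζ : ℂ} (hζ : 0 < ζ.im) :
    DifferentiableAt ℂ (expGamma η τ) ζ := by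
  have hp := norm_ex_lt_one_iff.2 hτ
  have hq := norm_ex_two_mul_lt_one hη
  have h := differentiable_qPoch₂ hp hq
  unfold expGamma ellGamma
  refine DifferentiableAt.div ?_ ?_ ((qPoch₂_ne_zero_iff hp hq).2 (notPole_ex hτ hη hζ))
  · simp_rw [← ex_neg]
    exact (h _).comp _ ((differentiable_ex.comp differentiable_neg ζ).const_mul _)
  · exact (h _).comp _ (differentiable_ex ζ)

lemma expGamma_add_one (ζ : ℂ) : expGamma η τ (ζ + 1) = expGamma η τ ζ := by
  rw [expGamma, expGamma, ex_add_one]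

/-- For |x| = 1 the numerators of Γ(x) and Γ(1/x) do not vanish, so the inverse is a regular
function. At the pole x = 1 the conventions for division by zero give 0 on the left, which is the
correct value. -/
lemma inv_ellGamma_mul (hτ : 0 < τ.im) (hη : 0 < η.im) {ζ : ℂ} (hζ : ζ.im = 0) :
    (ellGamma (ex τ) (ex (2 * η)) (ex ζ) * ellGamma (ex τ) (ex (2 * η)) (ex ζ)⁻¹)⁻¹
      = modTheta ζ τ * modTheta (-ζ) (2 * η) := by
  have hp := norm_ex_lt_one_iff.2 hτ
  have hq := norm_ex_two_mul_lt_one hη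
  have key : ∀ x : ℂ, ‖ex x‖ = 1 → qPoch₂ (ex τ * ex (2 * η) * ex x) (ex τ) (ex (2 * η)) ≠ 0 := by
    intro x hx
    refine (qPoch₂_ne_zero_iff hp hq).2 (notPole_of_norm_lt_one hp hq ?_)
    rw [norm_mul, norm_mul, hx, mul_one]
    exact mul_lt_one_of_nonneg_of_lt_one_left (norm_nonneg _) hp hq.le
  have h1 := key ζ (by simp [norm_ex, hζ])
  have h2 := key (-ζ) (by simp [norm_ex, hζ])
  have e : ∀ x, qPoch₂ (ex x) (ex τ) (ex (2 * η)) = (1 - ex x) * qPoch (ex τ * ex x) (ex τ) *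
      (qPoch (ex (2 * η) * ex x) (ex (2 * η)) *
        qPoch₂ (ex τ * ex (2 * η) * ex x) (ex τ) (ex (2 * η))) := by
    intro x
    rw [qPoch₂_eq_qPoch_mul hp hq, qPoch_eq_mul hp, qPoch₂_eq_qPoch_mul' hp hq (ex (2 * η) * ex x),
      mul_assoc (ex τ)]
  rw [mul_inv, ellGamma, ellGamma, inv_div, inv_div, inv_inv, ← ex_neg, e, e, modTheta, modTheta,
    qPoch_eq_mul hp (ex ζ), qPoch_eq_mul hq (ex (-ζ)), sub_neg_eq_add, ex_add, ex_sub,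
    ← ex_neg ζ]
  revert h1 h2
  generalize qPoch₂ (ex τ * ex (2 * η) * ex ζ) (ex τ) (ex (2 * η)) = a
  generalize qPoch₂ (ex τ * ex (2 * η) * ex (-ζ)) (ex τ) (ex (2 * η)) = b
  intro h1 h2
  field_simp

end ExpGamma

/-! ### Shifting the contour of integration of periodic functions -/

/-- Cauchy's theorem for the rectangle with corners 0 and 1 + i Im c: the vertical sides cancel by
periodicity, and Re c only translates a full period. -/
lemma integral_add_of_periodic_of_im_nonneg {F : ℂ → ℂ} {c : ℂ} (hc : 0 ≤ c.im)
    (hper : ∀ z, F (z + 1) = F z)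
    (hF : ∀ z : ℂ, 0 ≤ z.im → z.im ≤ c.im → DifferentiableAt ℂ F z) :
    ∫ x in (0 : ℝ)..1, F (x + c) = ∫ x in (0 : ℝ)..1, F x := by
  have hrect := Complex.integral_boundary_rect_eq_zero_of_differentiableOn F 0 (1 + c.im * I)
    (fun z hz => by
      have h := hz.2
      simp only [Set.mem_preimage, zero_im, add_im, one_im, mul_im, ofReal_re, I_im, mul_one,
        ofReal_im, I_re, mul_zero, add_zero, zero_add, Set.uIcc_of_le hc, Set.mem_Icc] at h
      exact (hF z h.1 h.2).differentiableWithinAt)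
  have hside : (∫ y in (0 : ℝ)..c.im, F (1 + y * I)) = ∫ y in (0 : ℝ)..c.im, F (y * I) :=
    intervalIntegral.integral_congr fun y _ => by
      rw [add_comm, hper]
  have h2 : (∫ x in (0 : ℝ)..1, F (x + c.im * I)) = ∫ x in (0 : ℝ)..1, F x := by
    simp at hrect
    rw [hside] at hrect
    linear_combination -hrect
  rw [← h2]
  have hP : Function.Periodic (fun x : ℝ => F (x + c.im * I)) 1 := fun x => by
    change F ((x + 1 : ℝ) + c.im * I) = F (x + c.im * I)
    rw [← hper (x + c.im * I)]
    push_cast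
    ring_nf
  have h3 := hP.intervalIntegral_add_eq 0 c.re
  rw [zero_add] at h3
  rw [h3, add_comm c.re 1]
  have h4 := intervalIntegral.integral_comp_add_right (a := 0) (b := 1)
    (fun x : ℝ => F (x + c.im * I)) c.re
  rw [zero_add] at h4
  rw [← h4]
  refine intervalIntegral.integral_congr fun x _ => ?_
  congr 1
  push_cast
  conv_lhs => rw [← Complex.re_add_im c]
  ring

/-- A periodic function that is holomorphic between the real line and its translate by `c` has the
same integral over both. -/
lemma integral_add_of_periodic {F : ℂ → ℂ} (c : ℂ) (hper : ∀ z, F (z + 1) = F z)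
    (hF : ∀ z : ℂ, |z.im| ≤ |c.im| → 0 ≤ z.im * c.im → DifferentiableAt ℂ F z) :
    ∫ x in (0 : ℝ)..1, F (x + c) = ∫ x in (0 : ℝ)..1, F x := by
  rcases le_total 0 c.im with hc | hc
  · refine integral_add_of_periodic_of_im_nonneg hc hper fun z h1 h2 => hF z ?_ (by positivity)
    rwa [abs_of_nonneg h1, abs_of_nonneg hc]
  -- For Im c ≤ 0 the two lines change roles: `F (z + c)` is moved by −c.
  · have h := integral_add_of_periodic_of_im_nonneg (F := fun z => F (z + c)) (c := -c)
      (by simpa using hc) (fun z => by rw [add_right_comm, hper]) (fun z h1 h2 => by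
        have h2 : z.im ≤ -c.im := by simpa using h2
        have : DifferentiableAt ℂ F (z + c) := by
          refine hF _ ?_ ?_
          · rw [add_im, abs_of_nonpos hc, abs_of_nonpos (by linarith)]; linarith
          · rw [add_im]; exact mul_nonneg_of_nonpos_of_nonpos (by linarith) hc
        exact DifferentiableAt.comp (f := fun z => z + c) z this (by fun_prop))
    simpa using h.symm

/-! ### Theta functions as infinite products -/

section Uniqueness

variable {f g : ℂ → ℂ} {τ : ℂ}

lemma ex_intCast_mul_add_one (n : ℤ) (z : ℂ) : ex (-n * (z + 1)) = ex (-n * z) := by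
  rw [mul_add, ex_add, mul_one, ← Int.cast_neg, show ex ((-n : ℤ) : ℂ) = 1 from
    Complex.exp_eq_one_iff.2 ⟨-n, by ring⟩, mul_one]

/-- With all coefficients zero the Fourier series is trivially summable, and its sum is the
function; so f vanishes on ℝ. The zeros 1/(n + 1) accumulate at 0, and the identity theorem gives f
= 0. -/
lemma eq_zero_of_fourier_eq_zero (hf : Differentiable ℂ f) (h1 : ∀ z, f (z + 1) = f z)
    (hc : ∀ n : ℤ, ∫ x in (0 : ℝ)..1, f x * ex (-n * x) = 0) : f = 0 := by
  have : Fact ((0 : ℝ) < 1) := ⟨zero_lt_one⟩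
  have hper : Function.Periodic (fun x : ℝ => f x) 1 := fun x => by
    change f ((x + 1 : ℝ) : ℂ) = f x
    rw [← h1 x]; push_cast; rfl
  let F : C(AddCircle (1 : ℝ), ℂ) := ⟨hper.lift, continuous_coinduced_dom.2
    (hf.continuous.comp Complex.continuous_ofReal)⟩
  have hF : fourierCoeff F = 0 := by
    funext n
    rw [fourierCoeff_eq_intervalIntegral F n 0, zero_add, Pi.zero_apply]
    refine smul_eq_zero_of_right _ (Eq.trans (intervalIntegral.integral_congr fun x _ => ?_) (hc n))
    change fourier (-n) (x : AddCircle (1 : ℝ)) * f x = _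
    rw [fourier_coe_apply, mul_comm, ex]
    congr 2
    push_cast
    ring
  have h0 : F = 0 := by
    have h := hasSum_fourier_series_of_summable (f := F) (by rw [hF]; exact summable_zero)
    simp only [hF, Pi.zero_apply, zero_smul] at h
    exact h.unique hasSum_zero
  have hreal : ∀ x : ℝ, f x = 0 := fun x => DFunLike.congr_fun h0 (x : AddCircle (1 : ℝ))
  refine (hf.differentiableOn.analyticOnNhd isOpen_univ).eq_of_frequently_eq (z₀ := 0)
    analyticOnNhd_const ?_
  have h : Filter.Tendsto (fun n : ℕ => ((1 / ((n : ℝ) + 1) : ℝ) : ℂ)) Filter.atTop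
      (nhdsWithin 0 {0}ᶜ) := by
    refine tendsto_nhdsWithin_iff.2 ⟨?_, .of_forall fun n => ?_⟩
    · have := (Complex.continuous_ofReal.tendsto 0).comp
        (tendsto_one_div_add_atTop_nhds_zero_nat (𝕜 := ℝ))
      simpa [Function.comp_def] using this
    · simp only [Set.mem_compl_iff, Set.mem_singleton_iff, ofReal_eq_zero]
      positivity
  exact h.frequently (Filter.Frequently.of_forall fun n => hreal _)

/-- An entire function with the multipliers of the Jacobi theta function is determined by its mean
value. -/
lemma eq_zero_of_theta_multiplier (hf : Differentiable ℂ f) (h1 : ∀ z, f (z + 1) = f z)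
    (hτ : ∀ z, f (z + τ) = ex (-z - τ / 2) * f z) (h0 : ∫ x in (0 : ℝ)..1, f x = 0) : f = 0 := by
  refine eq_zero_of_fourier_eq_zero hf h1 ?_
  -- Moving the contour by τ makes the coefficient of index n a nonzero multiple of the one of index
  -- n + 1, so all vanish together with the mean value.
  have step : ∀ n : ℤ, ∫ x in (0 : ℝ)..1, f x * ex (-n * x)
      = ex (-τ / 2 - n * τ) * ∫ x in (0 : ℝ)..1, f x * ex (-(n + 1 : ℤ) * x) := by
    intro n
    rw [← integral_add_of_periodic (F := fun z => f z * ex (-n * z)) τ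
      (fun z => by rw [h1, ex_intCast_mul_add_one]) (fun z _ _ => by
        exact (hf z).mul ((differentiable_ex _).comp _ (by fun_prop))),
      ← intervalIntegral.integral_const_mul]
    refine intervalIntegral.integral_congr fun x _ => ?_
    simp only [hτ]
    rw [mul_right_comm, mul_left_comm, ← ex_add, ← ex_add, mul_comm]
    push_cast
    ring_nf
  intro n
  induction n using Int.induction_on with
  | zero => simpa [ex_zero] using h0
  | succ k ih =>
    rw [step] at ih
    exact (mul_eq_zero.1 ih).resolve_left (ex_ne_zero _)
  | pred k ih =>
    rw [step]
    simp only [sub_add_cancel, ih, mul_zero]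

end Uniqueness

/-! ### The Jacobi triple product and values of theta functions at zero -/

section TripleProduct

variable {τ : ℂ}

lemma jacobiTheta₂_add_tau (z τ : ℂ) :
    jacobiTheta₂ (z + τ) τ = ex (-z - τ / 2) * jacobiTheta₂ z τ := by
  rw [jacobiTheta₂_add_left', ex]
  congr 2
  ring

lemma differentiable_jacobiTheta₂ (hτ : 0 < τ.im) : Differentiable ℂ fun z => jacobiTheta₂ z τ :=
  fun _ => differentiableAt_jacobiTheta₂_fst _ hτ

lemma integral_jacobiTheta₂ (hτ : 0 < τ.im) : ∫ x in (0 : ℝ)..1, jacobiTheta₂ x τ = 1 := by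
  have hs : HasSum (fun n : ℤ => ∫ x in (0 : ℝ)..1, jacobiTheta₂_term n x τ)
      (∫ x in (0 : ℝ)..1, jacobiTheta₂ x τ) := by
    refine intervalIntegral.hasSum_integral_of_dominated_convergence
      (fun n _ => ‖jacobiTheta₂_term n 0 τ‖) (fun n => ?_) (fun n => .of_forall fun x _ => ?_)
      (.of_forall fun x _ => ?_) ?_ (.of_forall fun x _ => hasSum_jacobiTheta₂_term x hτ)
    · exact Continuous.aestronglyMeasurable (by unfold jacobiTheta₂_term; fun_prop)
    · simp [norm_jacobiTheta₂_term]
    · exact ((summable_jacobiTheta₂_term_iff 0 τ).2 hτ).norm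
    · exact intervalIntegrable_const
  have h0 : ∀ n : ℤ, n ≠ 0 → ∫ x in (0 : ℝ)..1, jacobiTheta₂_term n x τ = 0 := by
    intro n hn
    have hn' : (2 * Real.pi * I * n : ℂ) ≠ 0 := by
      simp [Real.pi_ne_zero, hn]
    simp_rw [jacobiTheta₂_term, Complex.exp_add]
    rw [intervalIntegral.integral_mul_const, integral_exp_mul_complex hn']
    have : Complex.exp (2 * Real.pi * I * n) = 1 := Complex.exp_eq_one_iff.2 ⟨n, by ring⟩
    simp [this]
  have := hs.unique (hasSum_single 0 h0)
  rw [this]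
  simp [jacobiTheta₂_term]

/-- The constant in the Jacobi triple product. -/
noncomputable def tripleConst (τ : ℂ) : ℂ :=
  ∫ x in (0 : ℝ)..1, modTheta (x + (1 / 2 + τ / 2)) τ

/-- The Jacobi triple product, up to the value of the constant. -/
lemma modTheta_eq_const_mul (hτ : 0 < τ.im) (z : ℂ) :
    modTheta (z + (1 / 2 + τ / 2)) τ = tripleConst τ * jacobiTheta₂ z τ := by
  have hd := differentiable_modTheta hτ
  have hj := differentiable_jacobiTheta₂ hτ
  -- The two sides have the same multipliers under 1 and τ, and `tripleConst` is the mean value that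
  -- makes them agree. Its value is never needed, only that it is not 0.
  have h := eq_zero_of_theta_multiplier (τ := τ)
    (f := fun z => modTheta (z + (1 / 2 + τ / 2)) τ - tripleConst τ * jacobiTheta₂ z τ)
    ((hd.comp (differentiable_id.add_const _)).sub (hj.const_mul _))
    (fun z => by rw [jacobiTheta₂_add_left, add_right_comm, modTheta_add_one])
    (fun z => by
      have e : -ex (-(z + (1 / 2 + τ / 2))) = ex (-z - τ / 2) := by
        rw [show -(z + (1 / 2 + τ / 2)) = (-z - τ / 2) + -(1 / 2) by ring, ex_add, ex,
          show ex (-(1 / 2)) = -1 by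
            rw [ex_neg, ex, show (2 * Real.pi * I * (1 / 2) : ℂ) = Real.pi * I by ring,
              Complex.exp_pi_mul_I]
            norm_num]
        ring
      rw [jacobiTheta₂_add_tau, add_right_comm, modTheta_add_tau hτ, e]
      ring)
    (by
      rw [intervalIntegral.integral_sub, intervalIntegral.integral_const_mul,
        integral_jacobiTheta₂ hτ, mul_one, tripleConst, sub_self]
      · exact Continuous.intervalIntegrable (hd.continuous.comp (by fun_prop)) _ _
      · exact Continuous.intervalIntegrable
          ((hj.continuous.comp Complex.continuous_ofReal).const_mul _) _ _)
  exact sub_eq_zero.1 (congrFun h z)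

lemma tripleConst_ne_zero (hτ : 0 < τ.im) : tripleConst τ ≠ 0 := by
  intro h
  have h0 := modTheta_eq_const_mul hτ 0
  rw [h, zero_mul] at h0
  exact modTheta_ne_zero hτ (by simpa using hτ) (by simpa using hτ) h0

/-- The factor √(pq) puts τ/2 into the arguments of the gamma functions in D, so their difference
equation produces θ₄. -/
lemma modTheta_add_half_tau (hτ : 0 < τ.im) (z : ℂ) :
    modTheta (z + τ / 2) τ = tripleConst τ * theta 3 z τ := by
  rw [theta, ← modTheta_eq_const_mul hτ, ← modTheta_add_one (z + τ / 2)]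
  ring_nf

/-- The ratio of `(e(ζ); p)_∞ (p e(-ζ); p)_∞` and `e(ζ/2) θ₁(ζ)`. -/
noncomputable def thetaConst (τ : ℂ) : ℂ := -(tripleConst τ * ex (-τ / 8 - 3 / 4))

lemma modTheta_eq (hτ : 0 < τ.im) (z : ℂ) :
    modTheta z τ = thetaConst τ * ex (z / 2) * theta 0 z τ := by
  have h := modTheta_eq_const_mul hτ (z - (1 / 2 + τ / 2))
  rw [sub_add_cancel] at h
  have e : ∀ w : ℂ, Complex.exp w = ex (w / (2 * Real.pi * I)) := fun w => by
    rw [ex, mul_div_cancel₀ _ Complex.two_pi_I_ne_zero]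
  have e' : (Real.pi * I * τ / 4 + Real.pi * I * (z + 1 / 2)) / (2 * Real.pi * I)
      = τ / 8 + z / 2 + 1 / 4 := by
    have := Real.pi_ne_zero
    field_simp
    ring
  rw [h, theta, thetaConst, show z + 1 / 2 + τ / 2 = z - (1 / 2 + τ / 2) + τ + 1 by ring,
    jacobiTheta₂_add_left, jacobiTheta₂_add_tau, e, e', neg_mul, neg_mul, mul_neg, neg_neg]
  have : ex (-τ / 8 - 3 / 4) * ex (z / 2) * (ex (τ / 8 + z / 2 + 1 / 4) *
      ex (-(z - (1 / 2 + τ / 2)) - τ / 2)) = 1 := by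
    rw [← ex_add, ← ex_add, ← ex_add]
    exact (congrArg ex (by ring)).trans ex_zero
  linear_combination (-tripleConst τ * jacobiTheta₂ (z - (1 / 2 + τ / 2)) τ) * this

lemma theta_three_zero_ne_zero (hτ : 0 < τ.im) : theta 3 0 τ ≠ 0 := by
  intro h
  have h0 := modTheta_add_half_tau hτ 0
  rw [h, mul_zero] at h0
  exact modTheta_ne_zero hτ (by simpa using hτ) (by simpa using hτ) h0

lemma theta_two_zero_ne_zero (hτ : 0 < τ.im) : theta 2 0 τ ≠ 0 := by
  intro h
  have h0 := modTheta_eq_const_mul hτ 0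
  rw [theta] at h
  rw [h, mul_zero] at h0
  exact modTheta_ne_zero hτ (by simpa using hτ) (by simpa using hτ) h0

lemma theta_zero_add_half (z τ : ℂ) : theta 0 (z + 1 / 2) τ = theta 1 z τ := by
  rw [theta, theta, show z + 1 / 2 + 1 / 2 + τ / 2 = z + τ / 2 + 1 by ring, jacobiTheta₂_add_left,
    show (Real.pi * I * τ / 4 + Real.pi * I * (z + 1 / 2 + 1 / 2) : ℂ)
      = Real.pi * I * τ / 4 + Real.pi * I * z + Real.pi * I by ring, Complex.exp_add _ (_ * I),
    Complex.exp_pi_mul_I]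
  ring

/-- The relevant point 1/2 is real, outside the open strip of `modTheta_ne_zero`. The factors there
are 1 + p^j, equal to 2 for j = 0 and with |p^j| < 1 for j ≥ 1. -/
lemma theta_one_zero_ne_zero (hτ : 0 < τ.im) : theta 1 0 τ ≠ 0 := by
  intro h
  have h0 := modTheta_eq hτ (1 / 2)
  rw [← zero_add (1 / 2 : ℂ), theta_zero_add_half, h, mul_zero, zero_add] at h0
  refine mul_ne_zero ((qPoch_ne_zero_iff (norm_ex_lt_one_iff.2 hτ)).2 fun j hj => ?_)
    (qPoch_ne_zero (norm_ex_lt_one_iff.2 hτ) (norm_ex_lt_one_iff.2 (by simpa using hτ))) h0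
  have h2 : ex (1 / 2) = -1 := by
    rw [ex, show (2 * Real.pi * I * (1 / 2) : ℂ) = Real.pi * I by ring, Complex.exp_pi_mul_I]
  rw [h2] at hj
  rcases Nat.eq_zero_or_pos j with rfl | hj0
  · norm_num at hj
  · have := congrArg norm hj
    rw [norm_mul, norm_neg, norm_one, one_mul, norm_pow] at this
    exact (pow_lt_one₀ (norm_nonneg _) (norm_ex_lt_one_iff.2 hτ) hj0.ne').ne this

end TripleProduct

/-! ### Bilinear theta relations -/

section Bilinear

variable {τ : ℂ}

/-- Pairs of integers, split by the parity of their sum. -/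
noncomputable def paritySplit : (ℤ × ℤ) ⊕ (ℤ × ℤ) ≃ ℤ × ℤ :=
  Equiv.ofBijective
    (Sum.elim (fun m => (m.1 + m.2, m.1 - m.2)) (fun m => (m.1 + m.2 + 1, m.1 - m.2))) (by
    constructor
    · rintro (⟨a, b⟩ | ⟨a, b⟩) (⟨c, d⟩ | ⟨c, d⟩) h <;>
        simp only [Sum.elim_inl, Sum.elim_inr, Prod.mk.injEq] at h
      · simp only [Sum.inl.injEq, Prod.mk.injEq]; omega
      · omega
      · omega
      · simp only [Sum.inr.injEq, Prod.mk.injEq]; omega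
    · rintro ⟨m, n⟩
      rcases Int.even_or_odd (m + n) with h | h
      · obtain ⟨k, hk⟩ := h
        exact ⟨Sum.inl (k, m - k), by
          simp only [Sum.elim_inl, Prod.mk.injEq]; omega⟩
      · obtain ⟨k, hk⟩ := h
        exact ⟨Sum.inr (k, m - 1 - k), by
          simp only [Sum.elim_inr, Prod.mk.injEq]; omega⟩)

/-- Put m = k + l, n = k − l: then m² + n² = 2(k² + l²) and mx + ny = k(x + y) + l(x − y), which
separates the pairs with m + n even. For m + n odd both k and l become half-integers, which gives θ₂
in place of θ₃. -/
lemma jacobiTheta₂_mul (hτ : 0 < τ.im) (x y : ℂ) :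
    jacobiTheta₂ x τ * jacobiTheta₂ y τ
      = jacobiTheta₂ (x + y) (2 * τ) * jacobiTheta₂ (x - y) (2 * τ)
        + theta 1 (x + y) (2 * τ) * theta 1 (x - y) (2 * τ) := by
  have h2 : 0 < (2 * τ).im := by simpa using hτ
  have hs : ∀ {σ : ℂ}, 0 < σ.im → ∀ z, Summable fun n => ‖jacobiTheta₂_term n z σ‖ :=
    fun hσ z => ((summable_jacobiTheta₂_term_iff z _).2 hσ).norm
  have e1 : ∀ m : ℤ × ℤ, jacobiTheta₂_term (m.1 + m.2) x τ * jacobiTheta₂_term (m.1 - m.2) y τ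
      = jacobiTheta₂_term m.1 (x + y) (2 * τ) * jacobiTheta₂_term m.2 (x - y) (2 * τ) := by
    intro m
    simp only [jacobiTheta₂_term, ← Complex.exp_add]
    congr 1
    push_cast
    ring
  have e2 : ∀ m : ℤ × ℤ,
      jacobiTheta₂_term (m.1 + m.2 + 1) x τ * jacobiTheta₂_term (m.1 - m.2) y τ
      = Complex.exp (Real.pi * I * (2 * τ) / 4 + Real.pi * I * (x + y)) *
          Complex.exp (Real.pi * I * (2 * τ) / 4 + Real.pi * I * (x - y)) *
        (jacobiTheta₂_term m.1 (x + y + 2 * τ / 2) (2 * τ) *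
          jacobiTheta₂_term m.2 (x - y + 2 * τ / 2) (2 * τ)) := by
    intro m
    simp only [jacobiTheta₂_term, ← Complex.exp_add]
    congr 1
    push_cast
    ring
  have s1 := summable_mul_of_summable_norm (hs h2 (x + y)) (hs h2 (x - y))
  have s2 := summable_mul_of_summable_norm (hs h2 (x + y + 2 * τ / 2)) (hs h2 (x - y + 2 * τ / 2))
  have t1 := tsum_mul_tsum_of_summable_norm (hs h2 (x + y)) (hs h2 (x - y))
  have t2 := tsum_mul_tsum_of_summable_norm (hs h2 (x + y + 2 * τ / 2))
    (hs h2 (x - y + 2 * τ / 2))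
  rw [theta, theta, mul_mul_mul_comm (Complex.exp _), jacobiTheta₂, jacobiTheta₂, jacobiTheta₂,
    jacobiTheta₂, jacobiTheta₂, jacobiTheta₂, t1, t2,
    tsum_mul_tsum_of_summable_norm (hs hτ x) (hs hτ y), ← paritySplit.tsum_eq, Summable.tsum_sum]
  · congr 1
    · exact tsum_congr e1
    · rw [← tsum_mul_left]
      exact tsum_congr e2
  · exact s1.congr fun m => (e1 m).symm
  · exact (s2.mul_left _).congr fun m => (e2 m).symm

lemma theta_one_add_one (z τ : ℂ) : theta 1 (z + 1) τ = -theta 1 z τ := by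
  rw [theta, theta, add_right_comm, jacobiTheta₂_add_left, mul_add _ z 1, ← add_assoc,
    Complex.exp_add _ (_ * 1), mul_one, Complex.exp_pi_mul_I]
  ring

lemma theta_zero_eq (z τ : ℂ) : theta 0 z τ = -theta 1 (z + 1 / 2) τ := rfl

lemma theta_two_eq (z τ : ℂ) : theta 2 z τ = jacobiTheta₂ z τ := rfl

lemma theta_three_eq (z τ : ℂ) : theta 3 z τ = theta 2 (z + 1 / 2) τ := rfl

lemma theta_one_neg (z τ : ℂ) : theta 1 (-z) τ = theta 1 z τ := by
  rw [theta, theta, ← jacobiTheta₂_neg_left (-z + τ / 2),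
    show z + τ / 2 = -(-z + τ / 2) + τ by ring, jacobiTheta₂_add_tau, ex, ← mul_assoc,
    ← Complex.exp_add]
  congr 2
  ring

lemma theta_zero_neg (z τ : ℂ) : theta 0 (-z) τ = -theta 0 z τ := by
  have h := theta_one_add_one (z - 1 / 2) τ
  rw [← theta_one_neg (z - 1 / 2), show z - 1 / 2 + 1 = z + 1 / 2 by ring,
    show -(z - 1 / 2) = -z + 1 / 2 by ring] at h
  rw [theta_zero_eq, theta_zero_eq, h, neg_neg]

lemma theta_two_neg (z τ : ℂ) : theta 2 (-z) τ = theta 2 z τ := jacobiTheta₂_neg_left z τ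

/-- Moving x by 1/2 or τ/2 gives the analogues for θ₄ and θ₂. At x = y they show that θ₂, θ₃, θ₄ at
2x are quadratic forms in the vector (θ₃, θ₂)(2x | 2τ). -/
lemma theta_two_mul (hτ : 0 < τ.im) (x y : ℂ) : theta 2 (x + y) τ * theta 2 (x - y) τ
    = theta 2 (2 * x) (2 * τ) * theta 2 (2 * y) (2 * τ)
      + theta 1 (2 * x) (2 * τ) * theta 1 (2 * y) (2 * τ) := by
  have h := jacobiTheta₂_mul hτ (x + y) (x - y)
  rw [show x + y + (x - y) = 2 * x by ring, show x + y - (x - y) = 2 * y by ring] at h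
  exact h

lemma theta_three_mul (hτ : 0 < τ.im) (x y : ℂ) : theta 3 (x + y) τ * theta 3 (x - y) τ
    = theta 2 (2 * x) (2 * τ) * theta 2 (2 * y) (2 * τ)
      - theta 1 (2 * x) (2 * τ) * theta 1 (2 * y) (2 * τ) := by
  have h := theta_two_mul hτ (x + 1 / 2) y
  rw [show x + 1 / 2 + y = x + y + 1 / 2 by ring, show x + 1 / 2 - y = x - y + 1 / 2 by ring,
    ← theta_three_eq, ← theta_three_eq, show 2 * (x + 1 / 2) = 2 * x + 1 by ring, theta_two_eq,
    theta_two_eq, jacobiTheta₂_add_left, theta_one_add_one] at h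
  rw [h, theta_two_eq, theta_two_eq]
  ring

lemma theta_one_mul (hτ : 0 < τ.im) (x y : ℂ) : theta 1 (x + y) τ * theta 1 (x - y) τ
    = theta 1 (2 * x) (2 * τ) * theta 2 (2 * y) (2 * τ)
      + theta 2 (2 * x) (2 * τ) * theta 1 (2 * y) (2 * τ) := by
  have h := theta_two_mul hτ (x + τ / 2) y
  have e : ∀ z σ, theta 1 z σ
      = Complex.exp (Real.pi * I * σ / 4 + Real.pi * I * z) * theta 2 (z + σ / 2) σ :=
    fun _ _ => rfl
  have e2 : theta 1 (2 * x + τ) (2 * τ) = ex (-x - τ / 4) * theta 2 (2 * x) (2 * τ) := by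
    rw [e, theta_two_eq, theta_two_eq, show 2 * x + τ + 2 * τ / 2 = 2 * x + 2 * τ by ring,
      jacobiTheta₂_add_tau, ← mul_assoc, ex, ← Complex.exp_add, ex]
    congr 2
    ring
  rw [show x + τ / 2 + y = x + y + τ / 2 by ring, show x + τ / 2 - y = x - y + τ / 2 by ring,
    show 2 * (x + τ / 2) = 2 * x + τ by ring, e2] at h
  have e3 : theta 1 (2 * x) (2 * τ) = ex (x + τ / 4) * theta 2 (2 * x + τ) (2 * τ) := by
    rw [e, mul_div_cancel_left₀ τ two_ne_zero, ex]
    congr 2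
    ring
  have e4 : Complex.exp (Real.pi * I * τ / 4 + Real.pi * I * (x + y)) *
      Complex.exp (Real.pi * I * τ / 4 + Real.pi * I * (x - y)) = ex (x + τ / 4) := by
    rw [← Complex.exp_add, ex]
    congr 1
    ring
  have e5 : ex (x + τ / 4) * ex (-x - τ / 4) = 1 := by
    rw [← ex_add]
    exact (congrArg ex (by ring)).trans ex_zero
  rw [e (x + y), e (x - y), mul_mul_mul_comm, h, e4, e3]
  linear_combination (theta 2 (2 * x) (2 * τ) * theta 1 (2 * y) (2 * τ)) * e5

/-- The right-hand side is a 2 × 2 determinant of the vectors (θ₃, θ₂)( · | 2τ) at 2x and 2y, up to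
the order of the vectors. -/
lemma theta_zero_mul (hτ : 0 < τ.im) (x y : ℂ) : theta 0 (x + y) τ * theta 0 (x - y) τ
    = theta 2 (2 * x) (2 * τ) * theta 1 (2 * y) (2 * τ)
      - theta 1 (2 * x) (2 * τ) * theta 2 (2 * y) (2 * τ) := by
  have h := theta_one_mul hτ (x + 1 / 2) y
  rw [show x + 1 / 2 + y = x + y + 1 / 2 by ring, show x + 1 / 2 - y = x - y + 1 / 2 by ring,
    show 2 * (x + 1 / 2) = 2 * x + 1 by ring, theta_two_eq (2 * x + 1),
    jacobiTheta₂_add_left, theta_one_add_one, ← theta_two_eq] at h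
  rw [theta_zero_eq, theta_zero_eq, neg_mul_neg, h]
  ring

end Bilinear

/-! ### The exchange relation of theta functions -/

section Exchange

variable {τ : ℂ}

lemma differentiable_theta (hτ : 0 < τ.im) (a : Fin 4) : Differentiable ℂ fun z => theta a z τ := by
  have hj := differentiable_jacobiTheta₂ hτ
  fin_cases a
  · exact (Differentiable.mul (by fun_prop) (hj.comp (by fun_prop))).neg
  · exact Differentiable.mul (by fun_prop) (hj.comp (by fun_prop))
  · exact hj
  · exact hj.comp (by fun_prop)

lemma theta_zero_add_one (z τ : ℂ) : theta 0 (z + 1) τ = -theta 0 z τ := by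
  rw [theta_zero_eq, theta_zero_eq, add_right_comm, theta_one_add_one]

lemma theta_three_neg (z τ : ℂ) : theta 3 (-z) τ = theta 3 z τ := by
  rw [theta_three_eq, theta_three_eq, ← theta_two_neg, theta_two_eq, theta_two_eq,
    ← jacobiTheta₂_add_left]
  ring_nf

lemma eventually_theta_zero_ne_zero (hτ : 0 < τ.im) (a : ℂ) {k : ℂ} (hk : k ≠ 0) :
    ∀ᶠ s in nhdsWithin (0 : ℂ) {0}ᶜ, theta 0 (a + k * s) τ ≠ 0 := by
  by_contra h
  rw [Filter.not_eventually] at h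
  simp only [not_not] at h
  have hd : Differentiable ℂ fun s => theta 0 (a + k * s) τ :=
    (differentiable_theta hτ 0).comp (by fun_prop)
  have h0 := (hd.differentiableOn.analyticOnNhd isOpen_univ).eq_of_frequently_eq
    analyticOnNhd_const h
  have h1 := congrFun h0 ((1 / 2 - a) / k)
  simp only [mul_div_cancel₀ _ hk, add_sub_cancel] at h1
  rw [← zero_add (1 / 2 : ℂ), theta_zero_add_half] at h1
  exact theta_one_zero_ne_zero hτ h1

/-- Let vᵢ = (θ₃, θ₂)(2xᵢ | 2τ) at the four points c/2 ± y + σ, −c/2 ± z + σ. A quadratic form Q on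
ℂ² satisfies ∑ ±Q(vᵢ) ∏ det(vⱼ, vₖ) = 0, with the product over the pairs that avoid i: this is a
vanishing 4 × 4 determinant, whose columns are Q and the monomials of degree 2, expanded along Q.
Each determinant is θ₁(xⱼ + xₖ) θ₁(xⱼ − xₖ) up to sign. By `hs` complementary pairs have the same
θ₁(xⱼ + xₖ) up to ε, so the four products share the factor θ₁(c + 2σ) θ₁(y + z + 2σ) θ₁(y − z + 2σ),
which is cancelled. -/
lemma exchange_of_quadratic (hτ : 0 < τ.im) {h : ℂ → ℂ} {k A B C σ ε : ℂ} (hk : k ≠ 0)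
    (hh : ∀ x, k * h (2 * x) = A * theta 2 (2 * (x + σ)) (2 * τ) ^ 2
      + B * (theta 2 (2 * (x + σ)) (2 * τ) * theta 1 (2 * (x + σ)) (2 * τ))
      + C * theta 1 (2 * (x + σ)) (2 * τ) ^ 2)
    (hε : ε ^ 2 = 1) (hs : ∀ w, theta 0 (4 * σ - w) τ = ε * theta 0 w τ) (c z y : ℂ)
    (h1 : theta 0 (c + 2 * σ) τ ≠ 0) (h2 : theta 0 (y + z + 2 * σ) τ ≠ 0)
    (h3 : theta 0 (y - z + 2 * σ) τ ≠ 0) :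
    theta 0 (2 * z) τ * (theta 0 (c + z - y) τ * theta 0 (c - z - y) τ * h (c + 2 * y)
        - theta 0 (c + z + y) τ * theta 0 (c - z + y) τ * h (c - 2 * y))
      + theta 0 (2 * y) τ * (theta 0 (c + z + y) τ * theta 0 (c + z - y) τ * h (2 * z - c)
        - theta 0 (c - z + y) τ * theta 0 (c - z - y) τ * h (-2 * z - c)) = 0 := by
  have m := fun x y => theta_zero_mul hτ x y
  have m12 := m (c / 2 + y + σ) (c / 2 - y + σ)
  have m13 := m (c / 2 + y + σ) (-c / 2 + z + σ)
  have m14 := m (c / 2 + y + σ) (-c / 2 - z + σ)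
  have m23 := m (c / 2 - y + σ) (-c / 2 + z + σ)
  have m24 := m (c / 2 - y + σ) (-c / 2 - z + σ)
  have m34 := m (-c / 2 + z + σ) (-c / 2 - z + σ)
  have q1 := hh (c / 2 + y)
  have q2 := hh (c / 2 - y)
  have q3 := hh (-c / 2 + z)
  have q4 := hh (-c / 2 - z)
  rw [show c / 2 + y + σ + (c / 2 - y + σ) = c + 2 * σ by ring,
    show c / 2 + y + σ - (c / 2 - y + σ) = 2 * y by ring] at m12
  rw [show c / 2 + y + σ + (-c / 2 + z + σ) = y + z + 2 * σ by ring,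
    show c / 2 + y + σ - (-c / 2 + z + σ) = c - z + y by ring] at m13
  rw [show c / 2 + y + σ + (-c / 2 - z + σ) = y - z + 2 * σ by ring,
    show c / 2 + y + σ - (-c / 2 - z + σ) = c + z + y by ring] at m14
  rw [show c / 2 - y + σ + (-c / 2 + z + σ) = 4 * σ - (y - z + 2 * σ) by ring, hs,
    show c / 2 - y + σ - (-c / 2 + z + σ) = c - z - y by ring] at m23
  rw [show c / 2 - y + σ + (-c / 2 - z + σ) = 4 * σ - (y + z + 2 * σ) by ring, hs,
    show c / 2 - y + σ - (-c / 2 - z + σ) = c + z - y by ring] at m24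
  rw [show -c / 2 + z + σ + (-c / 2 - z + σ) = 4 * σ - (c + 2 * σ) by ring, hs,
    show -c / 2 + z + σ - (-c / 2 - z + σ) = 2 * z by ring] at m34
  rw [show 2 * (c / 2 + y) = c + 2 * y by ring] at q1
  rw [show 2 * (c / 2 - y) = c - 2 * y by ring] at q2
  rw [show 2 * (-c / 2 + z) = 2 * z - c by ring] at q3
  rw [show 2 * (-c / 2 - z) = -2 * z - c by ring] at q4
  generalize theta 2 (2 * (c / 2 + y + σ)) (2 * τ) = F1 at *
  generalize theta 2 (2 * (c / 2 - y + σ)) (2 * τ) = F2 at *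
  generalize theta 2 (2 * (-c / 2 + z + σ)) (2 * τ) = F3 at *
  generalize theta 2 (2 * (-c / 2 - z + σ)) (2 * τ) = F4 at *
  generalize theta 1 (2 * (c / 2 + y + σ)) (2 * τ) = G1 at *
  generalize theta 1 (2 * (c / 2 - y + σ)) (2 * τ) = G2 at *
  generalize theta 1 (2 * (-c / 2 + z + σ)) (2 * τ) = G3 at *
  generalize theta 1 (2 * (-c / 2 - z + σ)) (2 * τ) = G4 at *
  generalize theta 0 (c + 2 * σ) τ = s1 at *
  generalize theta 0 (y + z + 2 * σ) τ = s2 at *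
  generalize theta 0 (y - z + 2 * σ) τ = s3 at *
  generalize theta 0 (2 * y) τ = d12 at *
  generalize theta 0 (c - z + y) τ = d13 at *
  generalize theta 0 (c + z + y) τ = d14 at *
  generalize theta 0 (c - z - y) τ = d23 at *
  generalize theta 0 (c + z - y) τ = d24 at *
  generalize theta 0 (2 * z) τ = d34 at *
  generalize h (c + 2 * y) = H1 at *
  generalize h (c - 2 * y) = H2 at *
  generalize h (2 * z - c) = H3 at *
  generalize h (-2 * z - c) = H4 at *
  have hε0 : ε ≠ 0 := by rintro rfl; norm_num at hε
  have t1 : d34 * d24 * d23 * (ε ^ 2 * (ε * (s1 * s2 * s3)))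
      = (F3 * G4 - G3 * F4) * (F2 * G4 - G2 * F4) * (F2 * G3 - G2 * F3) := by
    rw [← m34, ← m24, ← m23]; ring
  have t2 : d34 * d14 * d13 * (ε * (s1 * s2 * s3))
      = (F3 * G4 - G3 * F4) * (F1 * G4 - G1 * F4) * (F1 * G3 - G1 * F3) := by
    rw [← m34, ← m14, ← m13]; ring
  have t3 : d12 * d14 * d24 * (ε * (s1 * s2 * s3))
      = (F1 * G2 - G1 * F2) * (F1 * G4 - G1 * F4) * (F2 * G4 - G2 * F4) := by
    rw [← m12, ← m14, ← m24]; ring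
  have t4 : d12 * d13 * d23 * (ε * (s1 * s2 * s3))
      = (F1 * G2 - G1 * F2) * (F1 * G3 - G1 * F3) * (F2 * G3 - G2 * F3) := by
    rw [← m12, ← m13, ← m23]; ring
  rw [hε, one_mul] at t1
  have hne : k * (ε * (s1 * s2 * s3)) ≠ 0 :=
    mul_ne_zero hk (mul_ne_zero hε0 (mul_ne_zero (mul_ne_zero h1 h2) h3))
  refine (mul_eq_zero.1 (?_ : k * (ε * (s1 * s2 * s3)) * _ = 0)).resolve_left hne
  have e : k * (ε * (s1 * s2 * s3)) * (d34 * (d24 * d23 * H1 - d14 * d13 * H2) +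
      d12 * (d14 * d24 * H3 - d13 * d23 * H4)) =
      (k * H1) * (d34 * d24 * d23 * (ε * (s1 * s2 * s3)))
      - (k * H2) * (d34 * d14 * d13 * (ε * (s1 * s2 * s3)))
      + (k * H3) * (d12 * d14 * d24 * (ε * (s1 * s2 * s3)))
      - (k * H4) * (d12 * d13 * d23 * (ε * (s1 * s2 * s3))) := by ring
  rw [e, t1, t2, t3, t4, q1, q2, q3, q4]
  ring

/-- For even theta functions σ = 0 works. The odd θ₁(2x) = −θ₂(2x + 1/2) is a quadratic form in the
vector at x + 1/4, whence σ = 1/4. -/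
lemma exchange_of_ne_zero (hτ : 0 < τ.im) (a : Fin 4) : ∃ σ : ℂ, ∀ c z y : ℂ,
    theta 0 (c + 2 * σ) τ ≠ 0 → theta 0 (y + z + 2 * σ) τ ≠ 0 → theta 0 (y - z + 2 * σ) τ ≠ 0 →
    theta 0 (2 * z) τ * (theta 0 (c + z - y) τ * theta 0 (c - z - y) τ * theta a (c + 2 * y) τ
        - theta 0 (c + z + y) τ * theta 0 (c - z + y) τ * theta a (c - 2 * y) τ)
      + theta 0 (2 * y) τ * (theta 0 (c + z + y) τ * theta 0 (c + z - y) τ * theta a (2 * z - c) τ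
        - theta 0 (c - z + y) τ * theta 0 (c - z - y) τ * theta a (-2 * z - c) τ) = 0 := by
  have h0 : ∀ w, theta 0 (4 * 0 - w) τ = (-1) * theta 0 w τ := fun w => by
    rw [mul_zero, zero_sub, theta_zero_neg]; ring
  have hx : ∀ x : ℂ, x + x = 2 * x := fun x => by ring
  have ha : a = 0 ∨ a = 1 ∨ a = 2 ∨ a = 3 := by fin_cases a <;> simp
  rcases ha with rfl | rfl | rfl | rfl
  · refine ⟨1 / 4, exchange_of_quadratic hτ (h := fun w => theta 0 w τ) (k := theta 1 0 τ) (A := 0)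
      (B := -2) (C := 0) (ε := 1)
      (theta_one_zero_ne_zero hτ) (fun x => ?_) (by norm_num) (fun w => ?_)⟩
    · have h := theta_one_mul hτ (x + 1 / 4) (x + 1 / 4)
      rw [sub_self, show x + 1 / 4 + (x + 1 / 4) = 2 * x + 1 / 2 by ring] at h
      change _ * theta 0 (2 * x) τ = _
      rw [theta_zero_eq]
      linear_combination -h
    · rw [show (4 * (1 / 4) - w : ℂ) = -w + 1 by ring, theta_zero_add_one, theta_zero_neg]
      ring
  · refine ⟨0, exchange_of_quadratic hτ (h := fun w => theta 1 w τ) (k := theta 1 0 τ) (A := 0)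
      (B := 2) (C := 0) (ε := -1)
      (theta_one_zero_ne_zero hτ) (fun x => ?_) (by norm_num) h0⟩
    have h := theta_one_mul hτ x x
    rw [sub_self, hx] at h
    rw [add_zero]
    change _ * theta 1 (2 * x) τ = _
    linear_combination h
  · refine ⟨0, exchange_of_quadratic hτ (h := fun w => theta 2 w τ) (k := theta 2 0 τ) (A := 1)
      (B := 0) (C := 1) (ε := -1)
      (theta_two_zero_ne_zero hτ) (fun x => ?_) (by norm_num) h0⟩
    have h := theta_two_mul hτ x x
    rw [sub_self, hx] at h
    rw [add_zero]
    change _ * theta 2 (2 * x) τ = _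
    linear_combination h
  · refine ⟨0, exchange_of_quadratic hτ (h := fun w => theta 3 w τ) (k := theta 3 0 τ) (A := 1)
      (B := 0) (C := -1) (ε := -1)
      (theta_three_zero_ne_zero hτ) (fun x => ?_) (by norm_num) h0⟩
    have h := theta_three_mul hτ x x
    rw [sub_self, hx] at h
    rw [add_zero]
    change _ * theta 3 (2 * x) τ = _
    linear_combination h

/-- The theta function identity behind the intertwining property of the elliptic Fourier
transformation. -/
lemma theta_exchange (hτ : 0 < τ.im) (a : Fin 4) (c z y : ℂ) :
    theta 0 (2 * z) τ * (theta 0 (c + z - y) τ * theta 0 (c - z - y) τ * theta a (c + 2 * y) τ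
        - theta 0 (c + z + y) τ * theta 0 (c - z + y) τ * theta a (c - 2 * y) τ)
      + theta 0 (2 * y) τ * (theta 0 (c + z + y) τ * theta 0 (c + z - y) τ * theta a (2 * z - c) τ
        - theta 0 (c - z + y) τ * theta 0 (c - z - y) τ * theta a (-2 * z - c) τ) = 0 := by
  obtain ⟨σ, h⟩ := exchange_of_ne_zero hτ a
  have hc : ∀ a, Continuous fun z => theta a z τ := fun a => (differentiable_theta hτ a).continuous
  set E : ℂ → ℂ → ℂ → ℂ := fun c z y =>
    theta 0 (2 * z) τ * (theta 0 (c + z - y) τ * theta 0 (c - z - y) τ * theta a (c + 2 * y) τ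
        - theta 0 (c + z + y) τ * theta 0 (c - z + y) τ * theta a (c - 2 * y) τ)
      + theta 0 (2 * y) τ * (theta 0 (c + z + y) τ * theta 0 (c + z - y) τ * theta a (2 * z - c) τ
        - theta 0 (c - z + y) τ * theta 0 (c - z - y) τ * theta a (-2 * z - c) τ) with hE
  -- Along the direction (1, 1, 3) each of c, y + z, y − z moves with nonzero speed (1, 4 and 2), so
  -- the three excluded theta values are nonzero for small s ≠ 0, and the identity extends to s = 0
  -- by continuity.
  have hcont : Continuous fun s : ℂ => E (c + s) (z + s) (y + 3 * s) := by
    have h' : ∀ (b : Fin 4) (f : ℂ → ℂ), Continuous f → Continuous fun s => theta b (f s) τ :=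
      fun b f hf => (hc b).comp hf
    simp only [hE]
    refine ((h' 0 _ (by fun_prop)).mul ((((h' 0 _ (by fun_prop)).mul (h' 0 _ (by fun_prop))).mul
      (h' a _ (by fun_prop))).sub (((h' 0 _ (by fun_prop)).mul (h' 0 _ (by fun_prop))).mul
      (h' a _ (by fun_prop))))).add ((h' 0 _ (by fun_prop)).mul ((((h' 0 _ (by fun_prop)).mul
      (h' 0 _ (by fun_prop))).mul (h' a _ (by fun_prop))).sub (((h' 0 _ (by fun_prop)).mul
      (h' 0 _ (by fun_prop))).mul (h' a _ (by fun_prop)))))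
  have hev : ∀ᶠ s in nhdsWithin (0 : ℂ) {0}ᶜ, E (c + s) (z + s) (y + 3 * s) = 0 := by
    filter_upwards [eventually_theta_zero_ne_zero hτ (c + 2 * σ) one_ne_zero,
      eventually_theta_zero_ne_zero hτ (y + z + 2 * σ) (k := 4) (by norm_num),
      eventually_theta_zero_ne_zero hτ (y - z + 2 * σ) (k := 2) (by norm_num)] with s h1 h2 h3
    refine h _ _ _ ?_ ?_ ?_
    · convert h1 using 2; ring
    · convert h2 using 2; ring
    · convert h3 using 2; ring
  have hlim := hcont.continuousAt.tendsto.mono_left (nhdsWithin_le_nhds (a := (0 : ℂ)) (s := {0}ᶜ))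
  have h0 := tendsto_nhds_unique (hlim.congr' hev) tendsto_const_nhds
  simpa [hE] using h0

end Exchange

/-! ### The L-operator as a two-term difference operator -/

/-- The coefficients of the L-operator: `∑_a (σ_a)_{ik} i^{δ_{a,2}} θ_{a+1}(u) θ_{a+1}(v)`. -/
noncomputable def lCoeff (τ : ℂ) (i k : Fin 2) (u v : ℂ) : ℂ :=
  ∑ a : Fin 4, pauli a i k * (if a = 2 then I else 1) * theta a u τ * theta a v τ

section LOperator

variable {η τ : ℂ}

/-- The factors θ_a(η) cancel, and −2ηℓ = b − a + η. The first argument of `lCoeff` is symmetric in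
a and b. -/
lemma lOp_apply (hη : 0 < η.im) (hθ : ∀ a, theta a η τ ≠ 0) (a b : ℂ) (i k : Fin 2) (f : ℂ → ℂ)
    (z : ℂ) : lOp η τ a b i k f z =
      (lCoeff τ i k (a + b + η) (2 * z + (b - a + η)) * f (z + η)
        - lCoeff τ i k (a + b + η) (-2 * z + (b - a + η)) * f (z - η)) / theta 0 (2 * z) τ := by
  have hη0 : η ≠ 0 := by rintro rfl; simp at hη
  have e : ∀ w : ℂ, w - 2 * η * ((a - b) / (2 * η) - 1 / 2) = w + (b - a + η) := fun w => by
    field_simp; ring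
  have h0 := hθ 0
  have h1 := hθ 1
  have h2 := hθ 2
  have h3 := hθ 3
  simp only [lOp, lOpSpin, Matrix.of_apply, lCoeff, Fin.sum_univ_four, LinearMap.add_apply,
    LinearMap.smul_apply, Pi.add_apply, Pi.smul_apply, smul_eq_mul, sklyaninGen,
    LinearMap.coe_mk, AddHom.coe_mk, weight, e]
  simp only [show (0 : Fin 4) ≠ 2 from by decide, show (1 : Fin 4) ≠ 2 from by decide,
    show (3 : Fin 4) ≠ 2 from by decide, if_true, if_false]
  field_simp
  ring

/-- The relation `theta_exchange` is linear in the values of θ_a, with coefficients independent of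
a, so it passes to linear combinations over a. -/
lemma lCoeff_exchange (hτ : 0 < τ.im) (i k : Fin 2) (u c z y : ℂ) :
    theta 0 (2 * z) τ * (theta 0 (c + z - y) τ * theta 0 (c - z - y) τ * lCoeff τ i k u (c + 2 * y)
        - theta 0 (c + z + y) τ * theta 0 (c - z + y) τ * lCoeff τ i k u (c - 2 * y))
      + theta 0 (2 * y) τ *
        (theta 0 (c + z + y) τ * theta 0 (c + z - y) τ * lCoeff τ i k u (2 * z - c)
        - theta 0 (c - z + y) τ * theta 0 (c - z - y) τ * lCoeff τ i k u (-2 * z - c)) = 0 := by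
  have h := fun a => theta_exchange hτ a c z y
  set m : Fin 4 → ℂ := fun a => pauli a i k * (if a = 2 then I else 1) * theta a u τ with hm
  have e : ∀ v, lCoeff τ i k u v = ∑ a, m a * theta a v τ := fun v => rfl
  simp only [e, Fin.sum_univ_four]
  linear_combination m 0 * h 0 + m 1 * h 1 + m 2 * h 2 + m 3 * h 3

lemma differentiable_lCoeff (hτ : 0 < τ.im) (i k : Fin 2) (u : ℂ) :
    Differentiable ℂ fun v => lCoeff τ i k u v := by
  unfold lCoeff
  exact Differentiable.fun_sum fun a _ => (differentiable_theta hτ a).const_mul _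

/-- θ₁ and θ₂ change sign under 1. Period 2 is enough, since the coefficients of L contain 2z. -/
lemma theta_add_two (a : Fin 4) (z τ : ℂ) : theta a (z + 2) τ = theta a z τ := by
  have ha : a = 0 ∨ a = 1 ∨ a = 2 ∨ a = 3 := by fin_cases a <;> simp
  have e : z + 2 = z + 1 + 1 := by ring
  rcases ha with rfl | rfl | rfl | rfl
  · rw [e, theta_zero_add_one, theta_zero_add_one, neg_neg]
  · rw [e, theta_one_add_one, theta_one_add_one, neg_neg]
  · rw [e, theta_two_eq, jacobiTheta₂_add_left, jacobiTheta₂_add_left, theta_two_eq]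
  · rw [e, theta_three_eq, theta_three_eq, theta_two_eq, theta_two_eq, add_right_comm,
      jacobiTheta₂_add_left, add_right_comm, jacobiTheta₂_add_left]

lemma lCoeff_add_two (i k : Fin 2) (u v : ℂ) : lCoeff τ i k u (v + 2) = lCoeff τ i k u v := by
  simp only [lCoeff, theta_add_two]

end LOperator

/-! ### The kernel of the elliptic Fourier transformation -/

/-- `Γ(e(c ± z ± x))`, the product of four elliptic gamma functions. -/
noncomputable def gammaFour (η τ c z x : ℂ) : ℂ :=
  expGamma η τ (c + z + x) * expGamma η τ (c + z - x) *
    (expGamma η τ (c - z + x) * expGamma η τ (c - z - x))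

/-- The kernel of the elliptic Fourier transformation without its normalization, divided by
`θ(e(2x); p)`. -/
noncomputable def reducedKernel (η τ c z x : ℂ) : ℂ :=
  gammaFour η τ c z x * modTheta (-(2 * x)) (2 * η)

/-- The kernel of the elliptic Fourier transformation without its normalization. -/
noncomputable def fourierKernel (η τ c z x : ℂ) : ℂ :=
  reducedKernel η τ c z x * modTheta (2 * x) τ

/-- The normalization of the elliptic Fourier transformation. -/
noncomputable def fourierConst (η τ c : ℂ) : ℂ :=
  qPoch (ex τ) (ex τ) * qPoch (ex (2 * η)) (ex (2 * η)) / (4 * Real.pi * I) *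
    (2 * Real.pi * I) / ellGamma (ex τ) (ex (2 * η)) (ex c ^ 2)

section Kernel

variable {η τ : ℂ}

lemma gammaPM_eq_gammaFour (c z x : ℂ) :
    gammaPM (ex τ) (ex (2 * η)) (ex c) (ex z) (ex x) = gammaFour η τ c z x := by
  simp only [gammaPM, gammaFour, expGamma, ex_add, ex_sub]

lemma fourierOp_eq (hτ : 0 < τ.im) (hη : 0 < η.im) (c : ℂ) (f : ℂ → ℂ) (z : ℂ) :
    fourierOp η τ c f z = Complex.exp (-(Real.pi * I * z ^ 2 / η)) * (fourierConst η τ c *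
      ∫ x in (0 : ℝ)..1, fourierKernel η τ c z x *
        (Complex.exp (Real.pi * I * (x : ℂ) ^ 2 / η) * f x)) := by
  rw [fourierOp, mOp, ← intervalIntegral.integral_const_mul (fourierConst η τ c),
    ← intervalIntegral.integral_const_mul (_ / _)]
  refine congrArg (_ * ·) (intervalIntegral.integral_congr fun x _ => ?_)
  have h := inv_ellGamma_mul (ζ := 2 * (x : ℂ)) hτ hη (by simp)
  rw [ex_two_mul (x : ℂ)] at h
  simp only [mKernel, fourierKernel, reducedKernel, fourierConst, gammaPM_eq_gammaFour]
  rw [mul_assoc (gammaFour η τ c z x), mul_comm (modTheta _ (2 * η)), ← h]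
  ring

/-- The difference equation writes every shifted kernel as the common product of Γ(e(c − η ± z ± y))
times two theta functions. After removing the common factors, this is `lCoeff_exchange` with c − η
in the place of c. The positivity conditions keep the common gamma functions away from their poles.
-/
lemma kernel_exchange (hτ : 0 < τ.im) (hη : 0 < η.im) (i k : Fin 2) (u : ℂ) {c z y : ℂ}
    (hz : theta 0 (2 * z) τ ≠ 0) (h1 : 0 < (c - η + z + y).im) (h2 : 0 < (c - η + z - y).im)
    (h3 : 0 < (c - η - z + y).im) (h4 : 0 < (c - η - z - y).im) :
    thetaConst τ * (reducedKernel η τ c z (y - η) * lCoeff τ i k u (2 * y + (c - η))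
        - reducedKernel η τ c z (y + η) * ex (2 * y + 2 * η) * lCoeff τ i k u (-2 * y + (c - η)))
      = (ex (-z) * fourierKernel η τ c (z + η) y * lCoeff τ i k u (2 * z + (-c + η))
        - ex z * fourierKernel η τ c (z - η) y * lCoeff τ i k u (-2 * z + (-c + η)))
          / theta 0 (2 * z) τ := by
  have hη2 : 0 < (2 * η).im := by simpa using hη
  have g1 := expGamma_add hτ hη (notPole_ex hτ hη h1)
  have g2 := expGamma_add hτ hη (notPole_ex hτ hη h2)
  have g3 := expGamma_add hτ hη (notPole_ex hτ hη h3)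
  have g4 := expGamma_add hτ hη (notPole_ex hτ hη h4)
  have q1 : modTheta (-(2 * (y - η))) (2 * η) = -ex (2 * y) * modTheta (-(2 * y)) (2 * η) := by
    rw [show -(2 * (y - η)) = -(2 * y) + 2 * η by ring, modTheta_add_tau hη2, neg_neg]
  have q2 : ex (2 * y + 2 * η) * modTheta (-(2 * (y + η))) (2 * η)
      = -modTheta (-(2 * y)) (2 * η) := by
    have h := modTheta_add_tau hη2 (-(2 * (y + η)))
    rw [show -(2 * (y + η)) + 2 * η = -(2 * y) by ring, neg_neg,
      show 2 * (y + η) = 2 * y + 2 * η by ring] at h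
    rw [h, show -(2 * (y + η)) = -(2 * y + 2 * η) by ring]
    ring
  -- The exponentials e(ζ/2) that relate θ(e(ζ); p) to θ₁(ζ) combine to the same e(c − η + y) in all
  -- four terms.
  have ex1 : ex ((c - η + z - y) / 2) * ex ((c - η - z - y) / 2) * ex (2 * y) = ex (c - η + y) := by
    rw [← ex_add, ← ex_add]; congr 1; ring
  have ex2 : ex ((c - η + z + y) / 2) * ex ((c - η - z + y) / 2) = ex (c - η + y) := by
    rw [← ex_add]; congr 1; ring
  have ex3 : ex (-z) * (ex ((c - η + z + y) / 2) * ex ((c - η + z - y) / 2) * ex (2 * y / 2))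
      = ex (c - η + y) := by
    rw [← ex_add, ← ex_add, ← ex_add]; congr 1; ring
  have ex4 : ex z * (ex ((c - η - z + y) / 2) * ex ((c - η - z - y) / 2) * ex (2 * y / 2))
      = ex (c - η + y) := by
    rw [← ex_add, ← ex_add, ← ex_add]; congr 1; ring
  have key := lCoeff_exchange hτ i k u (c - η) z y
  have t1 := modTheta_eq hτ (c - η + z + y)
  have t2 := modTheta_eq hτ (c - η + z - y)
  have t3 := modTheta_eq hτ (c - η - z + y)
  have t4 := modTheta_eq hτ (c - η - z - y)
  have t5 := modTheta_eq hτ (2 * y)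
  simp only [fourierKernel, reducedKernel, gammaFour]
  rw [show c + z + (y - η) = c - η + z + y by ring,
    show c + z - (y - η) = c - η + z - y + 2 * η by ring,
    show c - z + (y - η) = c - η - z + y by ring,
    show c - z - (y - η) = c - η - z - y + 2 * η by ring,
    show c + z + (y + η) = c - η + z + y + 2 * η by ring,
    show c + z - (y + η) = c - η + z - y by ring,
    show c - z + (y + η) = c - η - z + y + 2 * η by ring,
    show c - z - (y + η) = c - η - z - y by ring,
    show c + (z + η) + y = c - η + z + y + 2 * η by ring,
    show c + (z + η) - y = c - η + z - y + 2 * η by ring,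
    show c - (z + η) + y = c - η - z + y by ring,
    show c - (z + η) - y = c - η - z - y by ring,
    show c + (z - η) + y = c - η + z + y by ring,
    show c + (z - η) - y = c - η + z - y by ring,
    show c - (z - η) + y = c - η - z + y + 2 * η by ring,
    show c - (z - η) - y = c - η - z - y + 2 * η by ring, g1, g2, g3, g4, q1,
    show 2 * y + (c - η) = c - η + 2 * y by ring, show -2 * y + (c - η) = c - η - 2 * y by ring,
    show 2 * z + (-c + η) = 2 * z - (c - η) by ring,
    show -2 * z + (-c + η) = -2 * z - (c - η) by ring]
  rw [eq_div_iff hz]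
  rw [t1, t2, t3, t4, t5]
  set K := thetaConst τ
  set X := ex (c - η + y)
  generalize expGamma η τ (c - η + z + y) = G1 at *
  generalize expGamma η τ (c - η + z - y) = G2 at *
  generalize expGamma η τ (c - η - z + y) = G3 at *
  generalize expGamma η τ (c - η - z - y) = G4 at *
  generalize modTheta (-(2 * y)) (2 * η) = Q at *
  generalize modTheta (-(2 * (y + η))) (2 * η) = Q' at *
  generalize theta 0 (c - η + z + y) τ = T1 at *
  generalize theta 0 (c - η + z - y) τ = T2 at *
  generalize theta 0 (c - η - z + y) τ = T3 at *
  generalize theta 0 (c - η - z - y) τ = T4 at *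
  generalize theta 0 (2 * y) τ = T5 at *
  generalize theta 0 (2 * z) τ = T6 at *
  generalize lCoeff τ i k u (c - η + 2 * y) = H1 at *
  generalize lCoeff τ i k u (c - η - 2 * y) = H2 at *
  generalize lCoeff τ i k u (2 * z - (c - η)) = H3 at *
  generalize lCoeff τ i k u (-2 * z - (c - η)) = H4 at *
  generalize ex ((c - η + z + y) / 2) = x1 at *
  generalize ex ((c - η + z - y) / 2) = x2 at *
  generalize ex ((c - η - z + y) / 2) = x3 at *
  generalize ex ((c - η - z - y) / 2) = x4 at *
  generalize ex (2 * y / 2) = x5 at *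
  generalize ex (2 * y) = x6 at *
  generalize ex (2 * y + 2 * η) = x7 at *
  generalize ex (-z) = x8 at *
  generalize ex z = x9 at *
  linear_combination -(K ^ 3 * (G1 * G2 * G3 * G4) * Q * X) * key
    - (K ^ 3 * (G1 * G2 * G3 * G4) * Q * T2 * T4 * H1 * T6) * ex1
    - (K ^ 3 * (G1 * G2 * G3 * G4) * x1 * x3 * T1 * T3 * H2 * T6) * q2
    + (K ^ 3 * (G1 * G2 * G3 * G4) * Q * T1 * T3 * H2 * T6) * ex2
    - (K ^ 3 * (G1 * G2 * G3 * G4) * Q * T1 * T2 * T5 * H3) * ex3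
    + (K ^ 3 * (G1 * G2 * G3 * G4) * Q * T3 * T4 * T5 * H4) * ex4

end Kernel

/-! ### The elliptic Fourier transformation intertwines the L-operators -/

section FourierIntertwining

variable {η τ : ℂ}

lemma reducedKernel_add_one (c z x : ℂ) :
    reducedKernel η τ c z (x + 1) = reducedKernel η τ c z x := by
  have e1 : ∀ w : ℂ, expGamma η τ (w + (x + 1)) = expGamma η τ (w + x) := fun w => by
    rw [← add_assoc, expGamma_add_one]
  have e2 : ∀ w : ℂ, expGamma η τ (w - (x + 1)) = expGamma η τ (w - x) := fun w => by
    rw [← expGamma_add_one (w - (x + 1))]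
    congr 1
    ring
  rw [reducedKernel, reducedKernel, gammaFour, gammaFour, e1, e1, e2, e2,
    ← modTheta_add_one (-(2 * (x + 1))), ← modTheta_add_one (-(2 * (x + 1)) + 1)]
  congr 2
  ring

/-- The bounds put the arguments c ± z ± x of all four gamma functions into the upper half-plane,
where Γ(e(ζ)) has no poles. -/
lemma differentiableAt_reducedKernel (hτ : 0 < τ.im) (hη : 0 < η.im) {c z x : ℂ}
    (h1 : |x.im| < (c + z).im) (h2 : |x.im| < (c - z).im) :
    DifferentiableAt ℂ (reducedKernel η τ c z) x := by
  obtain ⟨h1a, h1b⟩ := abs_lt.1 h1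
  obtain ⟨h2a, h2b⟩ := abs_lt.1 h2
  have g : ∀ (w : ℂ), 0 < w.im → DifferentiableAt ℂ (expGamma η τ) w := fun w hw =>
    differentiableAt_expGamma hτ hη hw
  have e1 := (g (c + z + x) (by rw [add_im]; linarith)).comp x
    (f := fun x => c + z + x) (by fun_prop)
  have e2 := (g (c + z - x) (by rw [sub_im]; linarith)).comp x
    (f := fun x => c + z - x) (by fun_prop)
  have e3 := (g (c - z + x) (by rw [add_im]; linarith)).comp x
    (f := fun x => c - z + x) (by fun_prop)
  have e4 := (g (c - z - x) (by rw [sub_im]; linarith)).comp x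
    (f := fun x => c - z - x) (by fun_prop)
  have e5 := (differentiable_modTheta (τ := 2 * η) (by simpa using hη) _).comp x
    (f := fun x => -(2 * x)) (by fun_prop)
  exact ((e1.mul e2).mul (e3.mul e4)).mul e5

lemma differentiableAt_fourierKernel (hτ : 0 < τ.im) (hη : 0 < η.im) {c z x : ℂ}
    (h1 : |x.im| < (c + z).im) (h2 : |x.im| < (c - z).im) :
    DifferentiableAt ℂ (fourierKernel η τ c z) x :=
  (differentiableAt_reducedKernel hτ hη h1 h2).mul
    ((differentiable_modTheta hτ _).comp x (f := fun x => 2 * x) (by fun_prop))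

lemma theta_zero_ne_zero_of_real (hτ : 0 < τ.im) {x : ℝ} (hx : x ∉ Set.range fun n : ℤ => (n : ℝ) / 2) :
    theta 0 (2 * x) τ ≠ 0 := by
  intro h
  have hp := norm_ex_lt_one_iff.2 hτ
  have h0 := modTheta_eq hτ (2 * x)
  rw [h, mul_zero] at h0
  have hnorm : ‖ex (2 * (x : ℂ))‖ = 1 := by simp [norm_ex]
  refine mul_ne_zero ((qPoch_ne_zero_iff hp).2 fun j hj => ?_)
    (qPoch_ne_zero hp (norm_ex_lt_one_iff.2 (by simpa using hτ))) h0
  rcases Nat.eq_zero_or_pos j with rfl | hj0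
  · rw [pow_zero, mul_one, ex, Complex.exp_eq_one_iff] at hj
    obtain ⟨n, hn⟩ := hj
    refine hx ⟨n, ?_⟩
    have : (2 * (x : ℂ)) = n :=
      mul_left_cancel₀ Complex.two_pi_I_ne_zero (by rw [hn]; ring)
    have h2 : 2 * x = n := by exact_mod_cast this
    simp only
    linarith
  · have := congrArg norm hj
    rw [norm_mul, hnorm, one_mul, norm_pow, norm_one] at this
    exact (pow_lt_one₀ (norm_nonneg _) hp hj0.ne').ne this

/-- The zeros on the real line are half-integers, a null set. Hence the integrands may be rewritten
as if the denominators of L never vanished on the contour. -/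
lemma ae_theta_zero_ne_zero (hτ : 0 < τ.im) : ∀ᵐ x : ℝ, theta 0 (2 * x) τ ≠ 0 := by
  have h : (Set.range fun n : ℤ => (n : ℝ) / 2).Countable := Set.countable_range _
  filter_upwards [h.ae_notMem MeasureTheory.volume] with x hx
  exact theta_zero_ne_zero_of_real hτ hx

/-- The exponentials produced here and in `gaussian_sub` are multiplied by the e(x) that relates
θ₁(2x) to θ(e(2x); p). The results are a constant and a multiple of e(2x), which are 1-periodic, as
a contour shift requires. -/
lemma gaussian_add (hη : 0 < η.im) (x : ℂ) : Complex.exp (Real.pi * I * x ^ 2 / η)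
    = ex (-x - η / 2) * Complex.exp (Real.pi * I * (x + η) ^ 2 / η) := by
  have hη0 : η ≠ 0 := by rintro rfl; simp at hη
  rw [ex, ← Complex.exp_add]
  congr 1
  field_simp
  ring

lemma gaussian_sub (hη : 0 < η.im) (x : ℂ) : Complex.exp (Real.pi * I * x ^ 2 / η)
    = ex (x - η / 2) * Complex.exp (Real.pi * I * (x - η) ^ 2 / η) := by
  have hη0 : η ≠ 0 := by rintro rfl; simp at hη
  rw [ex, ← Complex.exp_add]
  congr 1
  field_simp
  ring

lemma fourierKernel_mul_div (hτ : 0 < τ.im) (c z : ℂ) {x : ℂ} (hx : theta 0 (2 * x) τ ≠ 0) :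
    fourierKernel η τ c z x / theta 0 (2 * x) τ
      = thetaConst τ * ex x * reducedKernel η τ c z x := by
  rw [fourierKernel, modTheta_eq hτ, mul_div_cancel_left₀ x two_ne_zero]
  field_simp

lemma lOp_fourierConst (hη : 0 < η.im) (hθ : ∀ a, theta a η τ ≠ 0) (a b C : ℂ) (i k : Fin 2)
    (J : ℂ → ℂ) (z : ℂ) :
    lOp η τ a b i k (fun z => Complex.exp (-(Real.pi * I * z ^ 2 / η)) * (C * J z)) z
      = Complex.exp (-(Real.pi * I * z ^ 2 / η)) * (C * (ex (-η / 2) *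
        ((ex (-z) * J (z + η) * lCoeff τ i k (a + b + η) (2 * z + (b - a + η))
          - ex z * J (z - η) * lCoeff τ i k (a + b + η) (-2 * z + (b - a + η)))
            / theta 0 (2 * z) τ))) := by
  have e1 : Complex.exp (-(Real.pi * I * (z + η) ^ 2 / η))
      = Complex.exp (-(Real.pi * I * z ^ 2 / η)) * (ex (-z) * ex (-η / 2)) := by
    rw [Complex.exp_neg, Complex.exp_neg, gaussian_add hη z, mul_inv, ← ex_neg, ← ex_add]
    have e : ex (-(-z - η / 2)) * ex (-z + -η / 2) = 1 := by
      rw [← ex_add]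
      exact (congrArg ex (by ring)).trans ex_zero
    linear_combination -(Complex.exp (Real.pi * I * (z + η) ^ 2 / η))⁻¹ * e
  have e2 : Complex.exp (-(Real.pi * I * (z - η) ^ 2 / η))
      = Complex.exp (-(Real.pi * I * z ^ 2 / η)) * (ex z * ex (-η / 2)) := by
    rw [Complex.exp_neg, Complex.exp_neg, gaussian_sub hη z, mul_inv, ← ex_neg, ← ex_add]
    have e : ex (-(z - η / 2)) * ex (z + -η / 2) = 1 := by
      rw [← ex_add]
      exact (congrArg ex (by ring)).trans ex_zero
    linear_combination -(Complex.exp (Real.pi * I * (z - η) ^ 2 / η))⁻¹ * e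
  rw [lOp_apply hη hθ, e1, e2]
  ring

lemma fourierKernel_mul_lOp (hτ : 0 < τ.im) (hη : 0 < η.im) (hθ : ∀ a, theta a η τ ≠ 0)
    (c a b z : ℂ) (i k : Fin 2) (f : ℂ → ℂ) {x : ℂ} (hx : theta 0 (2 * x) τ ≠ 0) :
    fourierKernel η τ c z x * (Complex.exp (Real.pi * I * x ^ 2 / η) * lOp η τ a b i k f x)
      = thetaConst τ * ex (-η / 2) * (reducedKernel η τ c z x *
          lCoeff τ i k (a + b + η) (2 * x + (b - a + η)) *
            (Complex.exp (Real.pi * I * (x + η) ^ 2 / η) * f (x + η))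
        - reducedKernel η τ c z x * ex (2 * x) *
          lCoeff τ i k (a + b + η) (-2 * x + (b - a + η)) *
            (Complex.exp (Real.pi * I * (x - η) ^ 2 / η) * f (x - η))) := by
  have h := fourierKernel_mul_div (η := η) hτ c z hx
  have e1 : ex x * ex (-x - η / 2) = ex (-η / 2) := by rw [← ex_add]; congr 1; ring
  have e2 : ex x * ex (x - η / 2) = ex (-η / 2) * ex (2 * x) := by
    rw [← ex_add, ← ex_add]; congr 1; ring
  have g1 := gaussian_add hη x
  have g2 := gaussian_sub hη x
  rw [lOp_apply hη hθ]
  set E := Complex.exp (Real.pi * I * x ^ 2 / η)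
  set L1 := lCoeff τ i k (a + b + η) (2 * x + (b - a + η))
  set L2 := lCoeff τ i k (a + b + η) (-2 * x + (b - a + η))
  calc _ = fourierKernel η τ c z x / theta 0 (2 * x) τ *
        (L1 * (E * f (x + η)) - L2 * (E * f (x - η))) := by ring
    _ = _ := by
      rw [h]
      nth_rw 1 [g1]
      nth_rw 1 [g2]
      linear_combination
        (thetaConst τ * reducedKernel η τ c z x * L1 *
          (Complex.exp (Real.pi * I * (x + η) ^ 2 / η) * f (x + η))) * e1
        - (thetaConst τ * reducedKernel η τ c z x * L2 *
          (Complex.exp (Real.pi * I * (x - η) ^ 2 / η) * f (x - η))) * e2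

lemma continuous_comp_ofReal_of_differentiableAt {F : ℂ → ℂ} {d : ℂ}
    (h : ∀ x : ℝ, DifferentiableAt ℂ F (x + d)) : Continuous fun x : ℝ => F (x + d) := by
  refine continuous_iff_continuousAt.2 fun x => ?_
  exact ContinuousAt.comp (g := F) (f := fun x : ℝ => (x : ℂ) + d) (h x).continuousAt
    (by fun_prop)

/-- Up to a constant the integrand is P(x + η) − M(x − η). As P is holomorphic for 0 ≤ Im y ≤ Im η
and M for −Im η ≤ Im y ≤ 0, the contours can be moved to give P(x) − M(x), where the function g is
no longer shifted. By `kernel_exchange` this is the action of L(b, a) on the kernel in z. The bounds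
on Im(b − a ± z) say that the integral formula applies at both z + η and z − η. -/
theorem fourierOp_lOp (hτ : 0 < τ.im) (hη : 0 < η.im) (hθ : ∀ a, theta a η τ ≠ 0) {a b z : ℂ}
    (i k : Fin 2) {f : ℂ → ℂ} (hf : Admissible η f) (hz : theta 0 (2 * z) τ ≠ 0)
    (h1 : η.im < (b - a + z).im) (h2 : η.im < (b - a - z).im) :
    fourierOp η τ (b - a) (lOp η τ a b i k f) z = lOp η τ b a i k (fourierOp η τ (b - a) f) z := by
  set c := b - a with hc
  set g : ℂ → ℂ := fun x => Complex.exp (Real.pi * I * x ^ 2 / η) * f x with hg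
  have hgd : ∀ x : ℂ, |x.im| ≤ η.im → DifferentiableAt ℂ g x := fun x hx =>
    (hf.2 x hx).differentiableAt
  have hgp : ∀ x : ℂ, g (x + 1) = g x := hf.1
  have hl : ∀ v, DifferentiableAt ℂ (fun v => lCoeff τ i k (a + b + η) v) v := fun v =>
    differentiable_lCoeff hτ i k _ v
  set P : ℂ → ℂ := fun y => reducedKernel η τ c z (y - η) *
    lCoeff τ i k (a + b + η) (2 * y + (c - η)) * g y with hP
  set M : ℂ → ℂ := fun y => reducedKernel η τ c z (y + η) * ex (2 * y + 2 * η) *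
    lCoeff τ i k (a + b + η) (-2 * y + (c - η)) * g y with hM
  have hPd : ∀ y : ℂ, 0 ≤ y.im → y.im ≤ η.im → DifferentiableAt ℂ P y := by
    intro y hy0 hy1
    have habs : |(y - η).im| ≤ η.im := by rw [sub_im, abs_le]; constructor <;> linarith
    have d1 := (differentiableAt_reducedKernel hτ hη (habs.trans_lt h1) (habs.trans_lt h2)).comp y
      (f := fun y => y - η) (by fun_prop)
    have d2 := (hl (2 * y + (c - η))).comp y (f := fun y => 2 * y + (c - η)) (by fun_prop)
    exact (d1.mul d2).mul (hgd y (by rwa [abs_of_nonneg hy0]))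
  have hMd : ∀ y : ℂ, -η.im ≤ y.im → y.im ≤ 0 → DifferentiableAt ℂ M y := by
    intro y hy0 hy1
    have habs : |(y + η).im| ≤ η.im := by rw [add_im, abs_le]; constructor <;> linarith
    have d1 := (differentiableAt_reducedKernel hτ hη (habs.trans_lt h1) (habs.trans_lt h2)).comp y
      (f := fun y => y + η) (by fun_prop)
    have d2 := (hl (-2 * y + (c - η))).comp y (f := fun y => -2 * y + (c - η)) (by fun_prop)
    have d3 := (differentiable_ex (2 * y + 2 * η)).comp y (f := fun y => 2 * y + 2 * η)
      (by fun_prop)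
    exact ((d1.mul d3).mul d2).mul (hgd y (by rw [abs_of_nonpos hy1]; linarith))
  have hPp : ∀ y, P (y + 1) = P y := by
    intro y
    simp only [hP]
    rw [hgp, add_sub_right_comm, reducedKernel_add_one,
      show 2 * (y + 1) + (c - η) = 2 * y + (c - η) + 2 by ring, lCoeff_add_two]
  have hMp : ∀ y, M (y + 1) = M y := by
    intro y
    simp only [hM]
    rw [hgp, add_right_comm, reducedKernel_add_one,
      show 2 * (y + 1) + 2 * η = 2 * y + 2 * η + 1 + 1 by ring, ex_add_one, ex_add_one,
      ← lCoeff_add_two i k _ (-2 * (y + 1) + (c - η)),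
      show -2 * (y + 1) + (c - η) + 2 = -2 * y + (c - η) by ring]
  have sP := integral_add_of_periodic (F := P) η hPp fun y hy0 hy1 =>
    hPd y (nonneg_of_mul_nonneg_left hy1 hη) ((le_abs_self _).trans (by rwa [abs_of_pos hη] at hy0))
  have sM := integral_add_of_periodic (F := M) (-η) hMp fun y hy0 hy1 => by
    rw [neg_im] at hy0 hy1
    rw [abs_neg, abs_of_pos hη] at hy0
    refine hMd y (neg_le_of_abs_le hy0) ?_
    by_contra! h
    nlinarith
  have iP : ∀ d : ℂ, 0 ≤ d.im → d.im ≤ η.im →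
      IntervalIntegrable (fun x : ℝ => P (x + d)) MeasureTheory.volume 0 1 := fun d hd0 hd1 =>
    (continuous_comp_ofReal_of_differentiableAt fun x => hPd _ (by simpa using hd0)
      (by simpa using hd1)).intervalIntegrable _ _
  have iM : ∀ d : ℂ, -η.im ≤ d.im → d.im ≤ 0 →
      IntervalIntegrable (fun x : ℝ => M (x + d)) MeasureTheory.volume 0 1 := fun d hd0 hd1 =>
    (continuous_comp_ofReal_of_differentiableAt fun x => hMd _ (by simpa using hd0)
      (by simpa using hd1)).intervalIntegrable _ _
  have hW : ∀ w : ℂ, 0 < (c + w).im → 0 < (c - w).im →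
      IntervalIntegrable (fun x : ℝ => fourierKernel η τ c w x * g x) MeasureTheory.volume 0 1 := by
    intro w hw1 hw2
    have := continuous_comp_ofReal_of_differentiableAt (d := 0)
      (F := fun x => fourierKernel η τ c w x * g x) fun x =>
        (differentiableAt_fourierKernel hτ hη (by simpa using hw1) (by simpa using hw2)).mul
          (hgd _ (by simpa using hη.le))
    simp only [add_zero] at this
    exact this.intervalIntegrable _ _
  have hL : (∫ x in (0 : ℝ)..1, fourierKernel η τ c z x *
      (Complex.exp (Real.pi * I * (x : ℂ) ^ 2 / η) * lOp η τ a b i k f x))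
      = ex (-η / 2) * ∫ x in (0 : ℝ)..1, thetaConst τ * (P x - M x) := by
    have e1 : (∫ x in (0 : ℝ)..1, fourierKernel η τ c z x *
      (Complex.exp (Real.pi * I * (x : ℂ) ^ 2 / η) * lOp η τ a b i k f x))
        = ∫ x in (0 : ℝ)..1, thetaConst τ * ex (-η / 2) * (P (x + η) - M (x + -η)) := by
      -- At the zeros of θ₁(2x) the left-hand side takes the value of a division by zero, so the
      -- equality holds only almost everywhere.
      refine intervalIntegral.integral_congr_ae ?_
      filter_upwards [ae_theta_zero_ne_zero hτ] with x hx _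
      rw [fourierKernel_mul_lOp hτ hη hθ c a b z i k f hx]
      simp only [hP, hM, hg]
      rw [add_sub_cancel_right, neg_add_cancel_right, ← sub_eq_add_neg,
        show 2 * (x + η) + (c - η) = 2 * x + (b - a + η) by rw [hc]; ring,
        show -2 * (x - η) + (c - η) = -2 * x + (b - a + η) by rw [hc]; ring,
        show 2 * (x - η) + 2 * η = 2 * x by ring]
    have i0 := iP 0 (by simp) (by simpa using hη.le)
    have i1 := iM 0 (by simpa using hη.le) (by simp)
    simp only [add_zero] at i0 i1
    rw [e1, intervalIntegral.integral_const_mul, intervalIntegral.integral_const_mul,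
      intervalIntegral.integral_sub (iP η hη.le le_rfl) (iM (-η) (by simp) (by simpa using hη.le)),
      sP, sM, intervalIntegral.integral_sub i0 i1]
    ring
  have hR : (∫ x in (0 : ℝ)..1, thetaConst τ * (P x - M x))
      = (ex (-z) * (∫ x in (0 : ℝ)..1, fourierKernel η τ c (z + η) x * g x) *
          lCoeff τ i k (b + a + η) (2 * z + (a - b + η))
        - ex z * (∫ x in (0 : ℝ)..1, fourierKernel η τ c (z - η) x * g x) *
          lCoeff τ i k (b + a + η) (-2 * z + (a - b + η))) / theta 0 (2 * z) τ := by
    have w1 := hW (z + η)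
      (by simp only [add_im] at h1 ⊢; linarith) (by simp only [sub_im, add_im] at h2 ⊢; linarith)
    have w2 := hW (z - η)
      (by simp only [add_im, sub_im] at h1 ⊢; linarith) (by simp only [sub_im] at h2 ⊢; linarith)
    have e2 : (∫ x in (0 : ℝ)..1, thetaConst τ * (P x - M x))
        = ∫ x in (0 : ℝ)..1,
          (ex (-z) * lCoeff τ i k (b + a + η) (2 * z + (a - b + η)) / theta 0 (2 * z) τ *
              (fourierKernel η τ c (z + η) x * g x)
            - ex z * lCoeff τ i k (b + a + η) (-2 * z + (a - b + η)) / theta 0 (2 * z) τ *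
              (fourierKernel η τ c (z - η) x * g x)) := by
      refine intervalIntegral.integral_congr fun x _ => ?_
      have hk := kernel_exchange (η := η) (c := c) (z := z) (y := x) hτ hη i k (a + b + η) hz
        (by simp only [add_im, sub_im, ofReal_im] at h1 ⊢; linarith)
        (by simp only [add_im, sub_im, ofReal_im] at h1 ⊢; linarith)
        (by simp only [add_im, sub_im, ofReal_im] at h2 ⊢; linarith)
        (by simp only [sub_im, ofReal_im] at h2 ⊢; linarith)
      simp only [hP, hM]
      rw [show a - b + η = -c + η by rw [hc]; ring, add_comm b a]
      linear_combination g x * hk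
    rw [e2, intervalIntegral.integral_sub (w1.const_mul _) (w2.const_mul _),
      intervalIntegral.integral_const_mul, intervalIntegral.integral_const_mul]
    ring
  have hF : fourierOp η τ c f = fun z => Complex.exp (-(Real.pi * I * z ^ 2 / η)) *
      (fourierConst η τ c * ∫ x in (0 : ℝ)..1, fourierKernel η τ c z x * g x) :=
    funext fun z => fourierOp_eq hτ hη c f z
  rw [hF, lOp_fourierConst hη hθ b a (fourierConst η τ c) i k
    (fun z => ∫ x in (0 : ℝ)..1, fourierKernel η τ c z x * g x), fourierOp_eq hτ hη, hL, hR]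

end FourierIntertwining

/-! ### Factorization of the L-operator -/

/-- The left factor of the coefficients of the L-operator. -/
noncomputable def leftFactor (τ : ℂ) (i : Fin 2) (y : ℂ) : ℂ :=
  ![theta 2 y (τ / 2), -theta 3 y (τ / 2)] i

/-- The right factor of the coefficients of the L-operator. -/
noncomputable def rightFactor (τ : ℂ) (k : Fin 2) (x : ℂ) : ℂ :=
  ![theta 3 x (τ / 2), theta 2 x (τ / 2)] k

section Factorization

variable {η τ : ℂ}

lemma theta_two_mul_half (hτ : 0 < τ.im) (x y : ℂ) :
    theta 2 x (τ / 2) * theta 2 y (τ / 2)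
      = theta 2 (x + y) τ * theta 2 (x - y) τ + theta 1 (x + y) τ * theta 1 (x - y) τ := by
  have h := jacobiTheta₂_mul (τ := τ / 2) (by simpa using hτ) x y
  rwa [mul_div_cancel₀ τ two_ne_zero] at h

lemma theta_two_sub_half (z τ : ℂ) : theta 2 (z - 1 / 2) τ = theta 3 z τ := by
  rw [theta_three_eq, theta_two_eq, theta_two_eq, ← jacobiTheta₂_add_left]
  congr 1
  ring

lemma theta_one_sub_half (z τ : ℂ) : theta 1 (z - 1 / 2) τ = theta 0 z τ := by
  rw [theta_zero_eq, ← theta_one_add_one, ← neg_neg (theta 1 (z - 1 / 2) τ), ← theta_one_add_one,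
    theta_one_add_one (z + 1 / 2), show z - 1 / 2 + 1 = z + 1 / 2 by ring]

lemma theta_three_mul_theta_two (hτ : 0 < τ.im) (x y : ℂ) :
    theta 3 x (τ / 2) * theta 2 y (τ / 2)
      = theta 3 (x + y) τ * theta 3 (x - y) τ + theta 0 (x + y) τ * theta 0 (x - y) τ := by
  rw [theta_three_eq x, theta_two_mul_half hτ, theta_three_eq, theta_three_eq, theta_zero_eq,
    theta_zero_eq, add_right_comm, show x + 1 / 2 - y = x - y + 1 / 2 by ring]
  ring

lemma theta_two_mul_theta_three (hτ : 0 < τ.im) (x y : ℂ) :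
    theta 2 x (τ / 2) * theta 3 y (τ / 2)
      = theta 3 (x + y) τ * theta 3 (x - y) τ - theta 0 (x + y) τ * theta 0 (x - y) τ := by
  rw [theta_three_eq y, theta_two_mul_half hτ, ← add_assoc, ← sub_sub, theta_two_sub_half,
    theta_one_sub_half, ← theta_three_eq, theta_zero_eq (x + y)]
  ring

lemma theta_three_mul_theta_three (hτ : 0 < τ.im) (x y : ℂ) :
    theta 3 x (τ / 2) * theta 3 y (τ / 2)
      = theta 2 (x + y) τ * theta 2 (x - y) τ - theta 1 (x + y) τ * theta 1 (x - y) τ := by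
  rw [theta_three_eq x, theta_three_eq y, theta_two_mul_half hτ,
    show x + 1 / 2 + (y + 1 / 2) = x + y + 1 by ring, add_sub_add_right_eq_sub,
    theta_one_add_one, theta_two_eq (x + y + 1), jacobiTheta₂_add_left, ← theta_two_eq]
  ring

/-- Each matrix entry is a combination of two products of theta functions of modulus τ, and the
bilinear relations collapse it to one product of modulus τ/2. -/
lemma lCoeff_eq_mul (hτ : 0 < τ.im) (i k : Fin 2) (x y : ℂ) :
    lCoeff τ i k (x - y) (x + y) = leftFactor τ i y * rightFactor τ k x := by
  have h1 := theta_two_mul_half hτ x y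
  have h2 := theta_three_mul_theta_two hτ x y
  have h3 := theta_two_mul_theta_three hτ x y
  have h4 := theta_three_mul_theta_three hτ x y
  have hi : i = 0 ∨ i = 1 := by fin_cases i <;> simp
  have hk : k = 0 ∨ k = 1 := by fin_cases k <;> simp
  rcases hi with rfl | rfl <;> rcases hk with rfl | rfl <;>
    simp [lCoeff, Fin.sum_univ_four, pauli, leftFactor, rightFactor]
  · linear_combination -h2
  · linear_combination -h1
  · linear_combination h4
  · linear_combination h3

/-- The sign in σ₃ cancels the sign in `leftFactor`. The sum is θ₄θ₃ + θ₃θ₄ of modulus τ/2, in which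
the products of θ₁ drop out; this is why σ₃ stands between the L-operators. -/
lemma sum_rightFactor_mul_leftFactor (hτ : 0 < τ.im) (x y : ℂ) :
    ∑ m : Fin 2, pauli 3 m m * (rightFactor τ m x * leftFactor τ m y)
      = 2 * theta 3 (x + y) τ * theta 3 (x - y) τ := by
  have h2 := theta_three_mul_theta_two hτ x y
  have h3 := theta_two_mul_theta_three hτ x y
  simp [pauli, leftFactor, rightFactor]
  linear_combination h2 + h3

/-- Each of the parameters a and b occurs in one factor only, so the exchange of the inner
parameters of two L-operators does not touch the outer factors. -/
lemma lCoeff_eq_leftFactor_mul (hτ : 0 < τ.im) (i k : Fin 2) (a b w : ℂ) :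
    lCoeff τ i k (a + b + η) (2 * w + (b - a + η))
      = leftFactor τ i (w - a) * rightFactor τ k (w + b + η) := by
  rw [← lCoeff_eq_mul hτ]
  congr 1 <;> ring

end Factorization

/-! ### The product of two L-operators -/

/-- The coefficients of `L₁(a, b) σ₃ L₂(c, d)`. -/
noncomputable def rllCoeff (η τ a b c d : ℂ) (i k : Fin 2) (w : ℂ × ℂ) : ℂ :=
  leftFactor τ i (w.1 - a) * rightFactor τ k (w.2 + d + η) *
    (2 * theta 3 (w.1 + w.2 + η + (b - c)) τ * theta 3 (w.1 - w.2 + η + (b + c)) τ)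

section Product

variable {η τ : ℂ}

/-- Exchanging b and c only reverses b − c in the first of the two values of θ₄. -/
lemma sum_lCoeff_mul_lCoeff (hτ : 0 < τ.im) (a b c d : ℂ) (i k : Fin 2) (w₁ w₂ : ℂ) :
    ∑ m : Fin 2, pauli 3 m m * (lCoeff τ i m (a + b + η) (2 * w₁ + (b - a + η)) *
      lCoeff τ m k (c + d + η) (2 * w₂ + (d - c + η))) = rllCoeff η τ a b c d i k (w₁, w₂) := by
  have h := sum_rightFactor_mul_leftFactor hτ (w₁ + b + η) (w₂ - c)
  simp only [lCoeff_eq_leftFactor_mul hτ, rllCoeff]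
  rw [show w₁ + w₂ + η + (b - c) = w₁ + b + η + (w₂ - c) by ring,
    show w₁ - w₂ + η + (b + c) = w₁ + b + η - (w₂ - c) by ring, ← h, Finset.mul_sum]
  exact Finset.sum_congr rfl fun m _ => by ring

lemma mul_sigma₃_mul_apply (A B : OpMatrix) (i k : Fin 2) (Φ : ℂ × ℂ → ℂ) (z : ℂ × ℂ) :
    (A * sigma₃ * B) i k Φ z = ∑ m : Fin 2, pauli 3 m m * A i m (B m k Φ) z := by
  simp [Matrix.mul_apply, sigma₃, pauli, Algebra.algebraMap_eq_smul_one]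

lemma lFst_apply (a b : ℂ) (i k : Fin 2) (Φ : ℂ × ℂ → ℂ) (z : ℂ × ℂ) :
    lFst η τ a b i k Φ z = lOp η τ a b i k (fun x => Φ (x, z.2)) z.1 := rfl

lemma lSnd_apply (a b : ℂ) (i k : Fin 2) (Φ : ℂ × ℂ → ℂ) (z : ℂ × ℂ) :
    lSnd η τ a b i k Φ z = lOp η τ a b i k (fun y => Φ (z.1, y)) z.2 := rfl

lemma sum_intUnits (f : ℤˣ → ℂ) : ∑ ε, f ε = f 1 + f (-1) := by
  rw [show (Finset.univ : Finset ℤˣ) = {1, -1} from rfl, Finset.sum_pair (by decide)]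

lemma lOp_apply' (hη : 0 < η.im) (hθ : ∀ a, theta a η τ ≠ 0) (a b : ℂ) (i k : Fin 2) (f : ℂ → ℂ)
    (z : ℂ) : lOp η τ a b i k f z = ∑ ε : ℤˣ, (ε : ℤ) *
      lCoeff τ i k (a + b + η) (2 * ((ε : ℤ) * z) + (b - a + η)) * f (z + (ε : ℤ) * η)
        / theta 0 (2 * z) τ := by
  rw [lOp_apply hη hθ, sum_intUnits]
  simp only [Units.val_one, Int.cast_one, one_mul, Units.val_neg, Int.cast_neg, neg_mul,
    ← sub_eq_add_neg, mul_neg]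
  ring

lemma rll_apply (hτ : 0 < τ.im) (hη : 0 < η.im) (hθ : ∀ a, theta a η τ ≠ 0) (a b c d : ℂ)
    (i k : Fin 2) (Φ : ℂ × ℂ → ℂ) (z : ℂ × ℂ) :
    (lFst η τ a b * sigma₃ * lSnd η τ c d) i k Φ z = ∑ ε : ℤˣ, ∑ δ : ℤˣ,
      (ε : ℤ) * (δ : ℤ) * rllCoeff η τ a b c d i k ((ε : ℤ) * z.1, (δ : ℤ) * z.2) *
        Φ (z.1 + (ε : ℤ) * η, z.2 + (δ : ℤ) * η) / (theta 0 (2 * z.1) τ * theta 0 (2 * z.2) τ) := by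
  rw [mul_sigma₃_mul_apply]
  simp only [lFst_apply, lSnd_apply, lOp_apply' hη hθ, ← sum_lCoeff_mul_lCoeff hτ,
    Finset.mul_sum, Finset.sum_mul, Finset.sum_div]
  rw [Finset.sum_comm]
  refine Finset.sum_congr rfl fun ε _ => ?_
  rw [Finset.sum_comm]
  refine Finset.sum_congr rfl fun δ _ => Finset.sum_congr rfl fun m _ => ?_
  ring

end Product

/-! ### Multiplication by a product of elliptic gamma functions -/

section Multiplication

variable {η τ : ℂ}

lemma dFun_eq (a b z₁ z₂ : ℂ) :
    dFun η τ (ex (b - a)) (ex z₁) (ex z₂) = gammaFour η τ (τ / 2 + η + (a - b)) z₁ z₂ := by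
  rw [dFun, ← gammaPM_eq_gammaFour, ← ex_neg, ← ex_add, neg_sub]

lemma gammaFour_mul_sign (ε δ : ℤˣ) (c z₁ z₂ : ℂ) :
    gammaFour η τ c ((ε : ℤ) * z₁) ((δ : ℤ) * z₂) = gammaFour η τ c z₁ z₂ := by
  rcases Int.units_eq_one_or ε with rfl | rfl <;> rcases Int.units_eq_one_or δ with rfl | rfl <;>
    simp only [gammaFour, Units.val_one, Units.val_neg, Int.cast_one, Int.cast_neg, one_mul,
      neg_mul, sub_neg_eq_add, ← sub_eq_add_neg] <;> ring

/-- Moving w₁ and w₂ together by η preserves w₁ − w₂, hence two of the four gamma functions. The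
arguments of the other two move by ±2η, and each contributes one θ₄. -/
lemma gammaFour_mul_theta (hτ : 0 < τ.im) (hη : 0 < η.im) {r w₁ w₂ : ℂ}
    (h1 : NotPole (ex τ) (ex (2 * η)) (ex (τ / 2 + η + r + w₁ + w₂)))
    (h2 : NotPole (ex τ) (ex (2 * η)) (ex (τ / 2 + η + r - (w₁ + η) - (w₂ + η)))) :
    gammaFour η τ (τ / 2 + η + r) w₁ w₂ * theta 3 (w₁ + w₂ + η + r) τ
      = gammaFour η τ (τ / 2 + η + r) (w₁ + η) (w₂ + η) * theta 3 (w₁ + w₂ + η - r) τ := by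
  have g1 := expGamma_add hτ hη h1
  have g2 := expGamma_add hτ hη h2
  have t1 := modTheta_add_half_tau hτ (w₁ + w₂ + η + r)
  have t2 := modTheta_add_half_tau hτ (-(w₁ + w₂ + η - r))
  rw [theta_three_neg] at t2
  rw [show τ / 2 + η + r + w₁ + w₂ = w₁ + w₂ + η + r + τ / 2 by ring, t1] at g1
  rw [show τ / 2 + η + r - (w₁ + η) - (w₂ + η) = -(w₁ + w₂ + η - r) + τ / 2 by ring, t2] at g2
  simp only [gammaFour]
  rw [show τ / 2 + η + r + w₁ + w₂ = w₁ + w₂ + η + r + τ / 2 by ring,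
    show τ / 2 + η + r - w₁ - w₂ = -(w₁ + w₂ + η - r) + τ / 2 + 2 * η by ring, g2,
    show τ / 2 + η + r + (w₁ + η) + (w₂ + η) = w₁ + w₂ + η + r + τ / 2 + 2 * η by ring, g1,
    show τ / 2 + η + r - (w₁ + η) - (w₂ + η) = -(w₁ + w₂ + η - r) + τ / 2 by ring,
    show τ / 2 + η + r + (w₁ + η) - (w₂ + η) = τ / 2 + η + r + w₁ - w₂ by ring,
    show τ / 2 + η + r - (w₁ + η) + (w₂ + η) = τ / 2 + η + r - w₁ + w₂ by ring]
  ring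

lemma gammaFour_mul_rllCoeff (hτ : 0 < τ.im) (hη : 0 < η.im) {u₁ u₂ v₁ v₂ : ℂ} (i k : Fin 2)
    {w₁ w₂ : ℂ} (h1 : NotPole (ex τ) (ex (2 * η)) (ex (τ / 2 + η + (u₂ - v₁) + w₁ + w₂)))
    (h2 : NotPole (ex τ) (ex (2 * η)) (ex (τ / 2 + η + (u₂ - v₁) - (w₁ + η) - (w₂ + η)))) :
    gammaFour η τ (τ / 2 + η + (u₂ - v₁)) w₁ w₂ * rllCoeff η τ u₁ u₂ v₁ v₂ i k (w₁, w₂)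
      = rllCoeff η τ u₁ v₁ u₂ v₂ i k (w₁, w₂) *
        gammaFour η τ (τ / 2 + η + (u₂ - v₁)) (w₁ + η) (w₂ + η) := by
  have h := gammaFour_mul_theta hτ hη h1 h2
  simp only [rllCoeff]
  rw [show w₁ + w₂ + η + (v₁ - u₂) = w₁ + w₂ + η - (u₂ - v₁) by ring, add_comm v₁ u₂]
  linear_combination leftFactor τ i (w₁ - u₁) * rightFactor τ k (w₂ + v₂ + η) *
    (2 * theta 3 (w₁ - w₂ + η + (u₂ + v₁)) τ) * h

lemma mem_stepsBoth (ε δ : ℤˣ) : (((ε : ℤ) * η, (δ : ℤ) * η) : ℂ × ℂ) ∈ stepsBoth η := by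
  rcases Int.units_eq_one_or ε with rfl | rfl <;> rcases Int.units_eq_one_or δ with rfl | rfl <;>
    simp [stepsBoth]

lemma sign_mul_sign_mul (ε : ℤˣ) (x : ℂ) : ((ε : ℤ) : ℂ) * ((ε : ℤ) * x) = x := by
  rcases Int.units_eq_one_or ε with rfl | rfl <;> simp

/-- D is even in both variables, so the term with signs ε, δ is the case of the shift (η, η) at
(εz₁, δz₂). The denominators θ₁(2zⱼ) are common to both sides and need not be nonzero. -/
theorem opS₂_rll (hτ : 0 < τ.im) (hη : 0 < η.im) (hθ : ∀ a, theta a η τ ≠ 0) (u : Params)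
    (z : ℂ × ℂ) (h0 : (u, z) ∈ domS₂ η τ) (h1 : ∀ d ∈ stepsBoth η, (u, z + d) ∈ domS₂ η τ)
    (i k : Fin 2) (Φ : ℂ × ℂ → ℂ) :
    opS₂ η τ u ((lFst η τ (u 0) (u 1) * sigma₃ * lSnd η τ (u 2) (u 3)) i k Φ) z
      = (lFst η τ (u 0) (u 2) * sigma₃ * lSnd η τ (u 1) (u 3)) i k (opS₂ η τ u Φ) z := by
  rw [opS₂, rll_apply hτ hη hθ, rll_apply hτ hη hθ]
  simp only [opS₂, dFun_eq, Finset.mul_sum]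
  refine Finset.sum_congr rfl fun ε _ => Finset.sum_congr rfl fun δ _ => ?_
  have e0 := h0 ε δ
  -- At the shifted point the gamma function that matters is the one with both signs opposite to the
  -- shift.
  have e1 := h1 _ (mem_stepsBoth ε δ) (-ε) (-δ)
  have hg := gammaFour_mul_rllCoeff (u₁ := u 0) (u₂ := u 1) (v₁ := u 2) (v₂ := u 3) hτ hη i k
    (w₁ := (ε : ℤ) * z.1) (w₂ := (δ : ℤ) * z.2)
    (by convert e0 using 2; simp only; ring)
    (by
      convert e1 using 2
      simp only [Prod.fst_add, Prod.snd_add, Units.val_neg, Int.cast_neg, neg_mul, mul_add,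
        sign_mul_sign_mul]
      ring)
  have es : ∀ (ε : ℤˣ) (x : ℂ), (ε : ℤ) * x + η = (ε : ℤ) * (x + (ε : ℤ) * η) := fun ε x => by
    rw [mul_add, sign_mul_sign_mul]
  rw [gammaFour_mul_sign, es, es, gammaFour_mul_sign] at hg
  linear_combination ((ε : ℤ) * (δ : ℤ) * Φ (z.1 + (ε : ℤ) * η, z.2 + (δ : ℤ) * η) /
    (theta 0 (2 * z.1) τ * theta 0 (2 * z.2) τ)) * hg

end Multiplication

/-! ### Double integrals of periodic functions -/

/-- The integral over the unit square. -/
noncomputable def squareIntegral (F : ℝ → ℝ → ℂ) : ℂ :=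
  ∫ x in (0 : ℝ)..1, ∫ y in (0 : ℝ)..1, F x y

section SquareIntegral

lemma squareIntegral_const_mul (c : ℂ) (F : ℝ → ℝ → ℂ) :
    squareIntegral (fun x y => c * F x y) = c * squareIntegral F := by
  simp only [squareIntegral, intervalIntegral.integral_const_mul]

lemma squareIntegral_sum {ι : Type*} (s : Finset ι) {F : ι → ℝ → ℝ → ℂ}
    (hF : ∀ i ∈ s, Continuous (Function.uncurry (F i))) :
    squareIntegral (fun x y => ∑ i ∈ s, F i x y) = ∑ i ∈ s, squareIntegral (F i) := by
  have h1 : ∀ x, (∫ y in (0 : ℝ)..1, ∑ i ∈ s, F i x y) = ∑ i ∈ s, ∫ y in (0 : ℝ)..1, F i x y :=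
    fun x => intervalIntegral.integral_finsetSum fun i hi =>
      ((hF i hi).comp (by fun_prop : Continuous fun y : ℝ => (x, y))).intervalIntegrable _ _
  simp only [squareIntegral, h1]
  exact intervalIntegral.integral_finsetSum fun i hi =>
    (intervalIntegral.continuous_parametric_intervalIntegral_of_continuous' (hF i hi)
      0 1).intervalIntegrable _ _

lemma squareIntegral_congr_ae {P : ℝ → Prop} (hP : ∀ᵐ x, P x) {F G : ℝ → ℝ → ℂ}
    (h : ∀ x y, P x → P y → F x y = G x y) : squareIntegral F = squareIntegral G := by
  refine intervalIntegral.integral_congr_ae ?_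
  filter_upwards [hP] with x hx _
  refine intervalIntegral.integral_congr_ae ?_
  filter_upwards [hP] with y hy _
  exact h x y hx hy

lemma squareIntegral_swap {F : ℝ → ℝ → ℂ} (hF : Continuous (Function.uncurry F)) :
    squareIntegral F = squareIntegral fun x y => F y x := by
  refine MeasureTheory.intervalIntegral_intervalIntegral_swap ?_
  exact (hF.integrableOn_Icc (a := ((0 : ℝ), (0 : ℝ))) (b := (1, 1))).mono_set (by
    rw [Set.uIoc_of_le zero_le_one, ← Set.Icc_prod_Icc]
    exact Set.prod_mono Set.Ioc_subset_Icc_self Set.Ioc_subset_Icc_self)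

lemma integral_add_real_of_periodic {f : ℝ → ℂ} (hf : ∀ x, f (x + 1) = f x) (a : ℝ) :
    ∫ x in (0 : ℝ)..1, f (x + a) = ∫ x in (0 : ℝ)..1, f x := by
  have h := Function.Periodic.intervalIntegral_add_eq (f := f) (T := 1) hf 0 a
  rw [zero_add] at h
  rw [intervalIntegral.integral_comp_add_right, h, zero_add, add_comm]

/-- Replacing y by y + s x, a real translation of a periodic function, turns the simultaneous shift
into a shift of z ↦ F(z, y + s z) in one variable. So F need only be holomorphic near the path of
the simultaneous shift, not when one variable moves alone. -/
lemma squareIntegral_add_of_periodic {F : ℂ × ℂ → ℂ} {c : ℂ} (s : ℤˣ) (hc : c.im ≠ 0)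
    (hp₁ : ∀ z w, F (z + 1, w) = F (z, w)) (hp₂ : ∀ z w, F (z, w + 1) = F (z, w))
    (hF : ∀ z w : ℂ, ∀ t : ℝ, 0 ≤ t → t ≤ 1 → z.im = t * c.im → w.im = (s : ℤ) * (t * c.im) →
      DifferentiableAt ℂ F (z, w)) :
    squareIntegral (fun x y => F (x + c, y + (s : ℤ) * c)) = squareIntegral fun x y => F (x, y) := by
  have hcast : ∀ x : ℝ, (((s : ℤ) * x : ℝ) : ℂ) = (s : ℤ) * x := fun x => by push_cast; rfl
  have hcont : ∀ t : ℝ, 0 ≤ t → t ≤ 1 → Continuous fun x : ℝ × ℝ =>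
      F (x.1 + t * c, x.2 + (s : ℤ) * (t * c)) := by
    intro t h0 h1
    refine continuous_iff_continuousAt.2 fun x => ?_
    refine ContinuousAt.comp (g := F)
      (f := fun x : ℝ × ℝ => ((x.1 : ℂ) + t * c, (x.2 : ℂ) + (s : ℤ) * (t * c)))
      (hF _ _ t h0 h1 (by simp) ?_).continuousAt (by fun_prop)
    rcases Int.units_eq_one_or s with rfl | rfl <;> simp
  have hline : ∀ t : ℝ, 0 ≤ t → t ≤ 1 →
      squareIntegral (fun x y => F (x + t * c, y + (s : ℤ) * (t * c)))
        = squareIntegral fun y x => F (x + t * c, y + (s : ℤ) * (x + t * c)) := by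
    intro t h0 h1
    have e : squareIntegral (fun x y => F (x + t * c, y + (s : ℤ) * (t * c)))
        = squareIntegral fun x y => F (x + t * c, y + (s : ℤ) * (x + t * c)) := by
      refine intervalIntegral.integral_congr fun x _ => ?_
      have h := integral_add_real_of_periodic
        (f := fun y : ℝ => F (x + t * c, y + (s : ℤ) * (t * c)))
        (fun y => by simp only [ofReal_add, ofReal_one]; rw [add_right_comm, hp₂]) ((s : ℤ) * x)
      refine Eq.trans h.symm ?_
      refine intervalIntegral.integral_congr fun y _ => ?_
      simp only
      congr 2
      push_cast
      ring
    rw [e, squareIntegral_swap]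
    have := (hcont t h0 h1).comp (by fun_prop :
      Continuous fun x : ℝ × ℝ => (x.1, x.2 + (s : ℤ) * x.1))
    refine this.congr fun x => ?_
    simp only [Function.comp_def, Function.uncurry]
    congr 2
    push_cast
    ring
  have e0 := hline 0 le_rfl zero_le_one
  have e1 := hline 1 zero_le_one le_rfl
  simp only [ofReal_zero, zero_mul, add_zero, mul_zero, ofReal_one, one_mul] at e0 e1
  rw [e0, e1]
  refine intervalIntegral.integral_congr fun y _ => ?_
  refine integral_add_of_periodic (F := fun z => F (z, y + (s : ℤ) * z)) c (fun z => ?_) ?_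
  · rcases Int.units_eq_one_or s with rfl | rfl
    · simp only [Units.val_one, Int.cast_one, one_mul]
      rw [hp₁, ← add_assoc, hp₂]
    · simp only [Units.val_neg, Units.val_one, Int.cast_neg, Int.cast_one, neg_mul, one_mul]
      rw [hp₁, ← hp₂]
      congr 2
      ring
  · intro z h1 h2
    have h3 : z.im = z.im / c.im * c.im := by field_simp
    have h4 : 0 ≤ z.im / c.im := by
      rw [← mul_div_mul_right _ _ hc]
      exact div_nonneg h2 (mul_self_nonneg _)
    have h5 : z.im / c.im ≤ 1 := by
      rw [← abs_of_nonneg h4, abs_div]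
      exact div_le_one_of_le₀ h1 (abs_nonneg _)
    refine DifferentiableAt.comp (g := F) z (hF z _ (z.im / c.im) h4 h5 h3 ?_) (by fun_prop)
    rw [← h3]
    rcases Int.units_eq_one_or s with rfl | rfl <;> simp

end SquareIntegral

/-! ### Sums over signs -/

/-- The coefficient of `J(z ± η)` in the L-operator applied to
`e^{-πi z²/η} J(z)`. -/
noncomputable def rightWeight (η τ a b : ℂ) (i k : Fin 2) (ε : ℤˣ) (z : ℂ) : ℂ :=
  (ε : ℤ) * ex (-((ε : ℤ) * z)) * lCoeff τ i k (a + b + η) (2 * ((ε : ℤ) * z) + (b - a + η))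
    / theta 0 (2 * z) τ

/-- The reduced kernel with its argument shifted, times the coefficient of the L-operator. -/
noncomputable def leftWeight (η τ a b : ℂ) (i k : Fin 2) (ε : ℤˣ) (z y : ℂ) : ℂ :=
  (ε : ℤ) * (reducedKernel η τ (b - a) z (y - (ε : ℤ) * η) * ex ((1 - (ε : ℤ)) * (y - (ε : ℤ) * η)))
    * lCoeff τ i k (a + b + η) (2 * ((ε : ℤ) * y - η) + (b - a + η))

section Signs

variable {η τ : ℂ}

lemma lOp_gaussian_mul (hη : 0 < η.im) (hθ : ∀ a, theta a η τ ≠ 0) (a b C : ℂ) (i k : Fin 2)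
    (J : ℂ → ℂ) (z : ℂ) :
    lOp η τ a b i k (fun z => Complex.exp (-(Real.pi * I * z ^ 2 / η)) * (C * J z)) z
      = Complex.exp (-(Real.pi * I * z ^ 2 / η)) * (C * (ex (-η / 2) *
        ∑ ε : ℤˣ, rightWeight η τ a b i k ε z * J (z + (ε : ℤ) * η))) := by
  rw [lOp_fourierConst hη hθ, sum_intUnits]
  simp only [rightWeight, Units.val_one, Int.cast_one, one_mul, Units.val_neg, Int.cast_neg,
    neg_mul, neg_neg, mul_neg, ← sub_eq_add_neg]
  ring

/-- This is `kernel_exchange` at real y, written as a sum over signs. -/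
lemma sum_leftWeight (hτ : 0 < τ.im) (hη : 0 < η.im) (a b : ℂ) (i k : Fin 2) {z : ℂ} (y : ℝ)
    (hz : theta 0 (2 * z) τ ≠ 0) (h1 : η.im < (b - a + z).im) (h2 : η.im < (b - a - z).im) :
    thetaConst τ * ∑ ε, leftWeight η τ a b i k ε z y
      = ∑ ε : ℤˣ, rightWeight η τ b a i k ε z
        * fourierKernel η τ (b - a) (z + (ε : ℤ) * η) y := by
  have hk := kernel_exchange (η := η) (c := b - a) (z := z) (y := y) hτ hη i k (a + b + η) hz
    (by simp only [add_im, sub_im, ofReal_im] at h1 ⊢; linarith)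
    (by simp only [add_im, sub_im, ofReal_im] at h1 ⊢; linarith)
    (by simp only [add_im, sub_im, ofReal_im] at h2 ⊢; linarith)
    (by simp only [sub_im, ofReal_im] at h2 ⊢; linarith)
  simp only [sum_intUnits, leftWeight, rightWeight, Units.val_one, Int.cast_one, one_mul,
    Units.val_neg, Int.cast_neg, neg_mul, neg_neg, mul_neg, ← sub_eq_add_neg, sub_neg_eq_add,
    sub_self, zero_mul, ex_zero, mul_one]
  rw [show (1 + 1) * ((y : ℂ) + η) = 2 * y + 2 * η by ring,
    show 2 * ((y : ℂ) - η) + (b - a + η) = 2 * y + (b - a - η) by ring,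
    show 2 * (-(y : ℂ) - η) + (b - a + η) = -(2 * y) + (b - a - η) by ring,
    add_comm b a, show a - b + η = -(b - a) + η by ring]
  rw [neg_mul] at hk
  rw [neg_mul] at hk
  linear_combination hk

lemma fourierKernel_div_mul_gaussian (hτ : 0 < τ.im) (hη : 0 < η.im) (c z : ℂ) (ε : ℤˣ) {x : ℂ}
    (hx : theta 0 (2 * x) τ ≠ 0) :
    fourierKernel η τ c z x / theta 0 (2 * x) τ * Complex.exp (Real.pi * I * x ^ 2 / η)
      = thetaConst τ * ex (-η / 2) * (reducedKernel η τ c z x * ex ((1 - (ε : ℤ)) * x)) *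
        Complex.exp (Real.pi * I * (x + (ε : ℤ) * η) ^ 2 / η) := by
  rw [fourierKernel_mul_div hτ c z hx]
  rcases Int.units_eq_one_or ε with rfl | rfl
  · have e1 : ex x * ex (-x - η / 2) = ex (-η / 2) := by rw [← ex_add]; congr 1; ring
    simp only [Units.val_one, Int.cast_one, one_mul, sub_self, zero_mul, ex_zero]
    rw [gaussian_add hη x]
    linear_combination (thetaConst τ * reducedKernel η τ c z x *
      Complex.exp (Real.pi * I * (x + η) ^ 2 / η)) * e1
  · have e2 : ex x * ex (x - η / 2) = ex (-η / 2) * ex ((1 - -1) * x) := by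
      rw [← ex_add, ← ex_add]; congr 1; ring
    simp only [Units.val_neg, Units.val_one, Int.cast_neg, Int.cast_one, neg_mul, one_mul,
      ← sub_eq_add_neg x]
    rw [gaussian_sub hη x]
    linear_combination (thetaConst τ * reducedKernel η τ c z x *
      Complex.exp (Real.pi * I * (x - η) ^ 2 / η)) * e2

end Signs

/-! ### The product of gamma functions near the torus -/

/-- The four gamma functions `Γ(e(c ± w₁ ± w₂))` times `θ(e(c + w₁ + w₂); p)`. -/
noncomputable def gammaJoint (η τ c : ℂ) (w : ℂ × ℂ) : ℂ :=
  expGamma η τ (c + w.1 + w.2 + 2 * η) * expGamma η τ (c + w.1 - w.2) *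
    (expGamma η τ (c - w.1 + w.2) * expGamma η τ (c - w.1 - w.2))

/-- The coefficients of `L₁(a, b) σ₃ L₂(c, d)`, multiplied by the four gamma functions of `S₂`. -/
noncomputable def jointCoeff (η τ a b c d : ℂ) (i k : Fin 2) (w : ℂ × ℂ) : ℂ :=
  (tripleConst τ)⁻¹ * gammaJoint η τ (τ / 2 + η + (b - c)) w *
    (leftFactor τ i (w.1 - a) * rightFactor τ k (w.2 + d + η) *
      (2 * theta 3 (w.1 - w.2 + η + (b + c)) τ))

section Joint

variable {η τ a b c d : ℂ} {i k : Fin 2}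

/-- The first θ₄ in `rllCoeff` is absorbed by Γ(e(r + w₁ + w₂)), r = τ/2 + η + b − c, which moves
its argument by 2η, away from the poles. -/
lemma gammaFour_mul_rllCoeff_eq_jointCoeff (hτ : 0 < τ.im) (hη : 0 < η.im) {w : ℂ × ℂ}
    (h : 0 < (τ / 2 + η + (b - c) + w.1 + w.2).im) :
    gammaFour η τ (τ / 2 + η + (b - c)) w.1 w.2 * rllCoeff η τ a b c d i k w
      = jointCoeff η τ a b c d i k w := by
  have hC := tripleConst_ne_zero hτ
  have g := expGamma_add hτ hη (notPole_ex hτ hη h)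
  rw [show τ / 2 + η + (b - c) + w.1 + w.2 = w.1 + w.2 + η + (b - c) + τ / 2 by ring,
    modTheta_add_half_tau hτ] at g
  rw [gammaFour, rllCoeff, jointCoeff, gammaJoint,
    show τ / 2 + η + (b - c) + w.1 + w.2 = w.1 + w.2 + η + (b - c) + τ / 2 by ring, g]
  field_simp

/-- Seen from (w₁ + η, w₂ + η), the moved gamma function belongs to D, and Γ(e(r − w₁ − w₂)), r =
τ/2 + η + b − c, splits off a θ₄, now with c − b. Thus one holomorphic function carries both
coefficients. -/
lemma jointCoeff_eq (hτ : 0 < τ.im) (hη : 0 < η.im) {w : ℂ × ℂ}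
    (h : 0 < (τ / 2 + η + (b - c) - (w.1 + η) - (w.2 + η)).im) :
    jointCoeff η τ a b c d i k w
      = gammaFour η τ (τ / 2 + η + (b - c)) (w.1 + η) (w.2 + η)
        * rllCoeff η τ a c b d i k w := by
  have hC := tripleConst_ne_zero hτ
  have g := expGamma_add hτ hη (notPole_ex hτ hη h)
  rw [show τ / 2 + η + (b - c) - (w.1 + η) - (w.2 + η) = -(w.1 + w.2 + η + (c - b)) + τ / 2 by ring,
    modTheta_add_half_tau hτ, theta_three_neg] at g
  rw [gammaFour, rllCoeff, jointCoeff, gammaJoint,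
    show τ / 2 + η + (b - c) + (w.1 + η) + (w.2 + η) = τ / 2 + η + (b - c) + w.1 + w.2 + 2 * η by
      ring,
    show τ / 2 + η + (b - c) + (w.1 + η) - (w.2 + η) = τ / 2 + η + (b - c) + w.1 - w.2 by ring,
    show τ / 2 + η + (b - c) - (w.1 + η) + (w.2 + η) = τ / 2 + η + (b - c) - w.1 + w.2 by ring,
    show τ / 2 + η + (b - c) - (w.1 + η) - (w.2 + η) = -(w.1 + w.2 + η + (c - b)) + τ / 2 by ring,
    show τ / 2 + η + (b - c) - w.1 - w.2 = -(w.1 + w.2 + η + (c - b)) + τ / 2 + 2 * η by ring, g,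
    add_comm c b]
  field_simp

lemma differentiable_leftFactor (hτ : 0 < τ.im) (i : Fin 2) :
    Differentiable ℂ (leftFactor τ i) := by
  have h2 : 0 < (τ / 2).im := by simpa using hτ
  have hi : i = 0 ∨ i = 1 := by fin_cases i <;> simp
  rcases hi with rfl | rfl
  · exact differentiable_theta h2 2
  · exact (differentiable_theta h2 3).neg

lemma differentiable_rightFactor (hτ : 0 < τ.im) (k : Fin 2) :
    Differentiable ℂ (rightFactor τ k) := by
  have h2 : 0 < (τ / 2).im := by simpa using hτ
  have hk : k = 0 ∨ k = 1 := by fin_cases k <;> simp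
  rcases hk with rfl | rfl
  · exact differentiable_theta h2 3
  · exact differentiable_theta h2 2

lemma theta_three_add_one (z τ : ℂ) : theta 3 (z + 1) τ = theta 3 z τ := by
  rw [theta_three_eq, theta_three_eq, theta_two_eq, add_right_comm, jacobiTheta₂_add_left,
    theta_two_eq]

lemma leftFactor_add_one (i : Fin 2) (z : ℂ) : leftFactor τ i (z + 1) = leftFactor τ i z := by
  simp only [leftFactor, theta_three_add_one, theta_two_eq, jacobiTheta₂_add_left]

lemma rightFactor_add_one (k : Fin 2) (z : ℂ) : rightFactor τ k (z + 1) = rightFactor τ k z := by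
  simp only [rightFactor, theta_three_add_one, theta_two_eq, jacobiTheta₂_add_left]

lemma expGamma_sub_one (ζ : ℂ) : expGamma η τ (ζ - 1) = expGamma η τ ζ := by
  rw [← expGamma_add_one (ζ - 1), sub_add_cancel]

lemma jointCoeff_add_one_fst (w₁ w₂ : ℂ) :
    jointCoeff η τ a b c d i k (w₁ + 1, w₂) = jointCoeff η τ a b c d i k (w₁, w₂) := by
  simp only [jointCoeff, gammaJoint]
  generalize τ / 2 + η + (b - c) = r
  rw [show r + (w₁ + 1) + w₂ + 2 * η = r + w₁ + w₂ + 2 * η + 1 by ring,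
    show r + (w₁ + 1) - w₂ = r + w₁ - w₂ + 1 by ring,
    show r - (w₁ + 1) + w₂ = r - w₁ + w₂ - 1 by ring,
    show r - (w₁ + 1) - w₂ = r - w₁ - w₂ - 1 by ring, show w₁ + 1 - a = w₁ - a + 1 by ring,
    show w₁ + 1 - w₂ + η + (b + c) = w₁ - w₂ + η + (b + c) + 1 by ring]
  simp only [expGamma_add_one, expGamma_sub_one, leftFactor_add_one, theta_three_add_one]

lemma jointCoeff_add_one_snd (w₁ w₂ : ℂ) :
    jointCoeff η τ a b c d i k (w₁, w₂ + 1) = jointCoeff η τ a b c d i k (w₁, w₂) := by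
  simp only [jointCoeff, gammaJoint]
  generalize τ / 2 + η + (b - c) = r
  rw [← theta_three_add_one (w₁ - (w₂ + 1) + η + (b + c)),
    show r + w₁ + (w₂ + 1) + 2 * η = r + w₁ + w₂ + 2 * η + 1 by ring,
    show r + w₁ - (w₂ + 1) = r + w₁ - w₂ - 1 by ring,
    show r - w₁ + (w₂ + 1) = r - w₁ + w₂ + 1 by ring,
    show r - w₁ - (w₂ + 1) = r - w₁ - w₂ - 1 by ring,
    show w₂ + 1 + d + η = w₂ + d + η + 1 by ring,
    show w₁ - (w₂ + 1) + η + (b + c) + 1 = w₁ - w₂ + η + (b + c) by ring]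
  simp only [expGamma_add_one, expGamma_sub_one, rightFactor_add_one]

lemma jointCoeff_sign_add_one (ε δ : ℤˣ) (z w : ℂ) :
    jointCoeff η τ a b c d i k ((ε : ℤ) * (z + 1), (δ : ℤ) * w)
        = jointCoeff η τ a b c d i k ((ε : ℤ) * z, (δ : ℤ) * w) ∧
      jointCoeff η τ a b c d i k ((ε : ℤ) * z, (δ : ℤ) * (w + 1))
        = jointCoeff η τ a b c d i k ((ε : ℤ) * z, (δ : ℤ) * w) := by
  constructor
  · rcases Int.units_eq_one_or ε with rfl | rfl
    · simp only [Units.val_one, Int.cast_one, one_mul, jointCoeff_add_one_fst]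
    · rw [← jointCoeff_add_one_fst]
      congr 2
      simp only [Units.val_neg, Units.val_one, Int.cast_neg, Int.cast_one]
      ring
  · rcases Int.units_eq_one_or δ with rfl | rfl
    · simp only [Units.val_one, Int.cast_one, one_mul, jointCoeff_add_one_snd]
    · rw [← jointCoeff_add_one_snd]
      congr 2
      simp only [Units.val_neg, Units.val_one, Int.cast_neg, Int.cast_one]
      ring

lemma differentiableAt_expGamma_comp (hτ : 0 < τ.im) (hη : 0 < η.im) {f : ℂ × ℂ → ℂ} {w : ℂ × ℂ}
    (hf : DifferentiableAt ℂ f w) (h : 0 < (f w).im) :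
    DifferentiableAt ℂ (fun w => expGamma η τ (f w)) w :=
  (differentiableAt_expGamma hτ hη h).comp w hf

/-- Because of the summand 2η in the first condition, if Im(τ/2 + η + b − c) > 0, all points with Im
w₁ = Im w₂ = −s, 0 ≤ s ≤ Im η, are admitted. -/
lemma differentiableAt_jointCoeff (hτ : 0 < τ.im) (hη : 0 < η.im) {w : ℂ × ℂ}
    (h1 : 0 < (τ / 2 + η + (b - c) + w.1 + w.2 + 2 * η).im)
    (h2 : 0 < (τ / 2 + η + (b - c) + w.1 - w.2).im)
    (h3 : 0 < (τ / 2 + η + (b - c) - w.1 + w.2).im)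
    (h4 : 0 < (τ / 2 + η + (b - c) - w.1 - w.2).im) :
    DifferentiableAt ℂ (jointCoeff η τ a b c d i k) w := by
  have d1 := differentiableAt_expGamma_comp hτ hη
    (f := fun w => τ / 2 + η + (b - c) + w.1 + w.2 + 2 * η) (by fun_prop) h1
  have d2 := differentiableAt_expGamma_comp hτ hη
    (f := fun w => τ / 2 + η + (b - c) + w.1 - w.2) (by fun_prop) h2
  have d3 := differentiableAt_expGamma_comp hτ hη
    (f := fun w => τ / 2 + η + (b - c) - w.1 + w.2) (by fun_prop) h3
  have d4 := differentiableAt_expGamma_comp hτ hη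
    (f := fun w => τ / 2 + η + (b - c) - w.1 - w.2) (by fun_prop) h4
  have d5 := ((differentiable_leftFactor hτ i) (w.1 - a)).comp w
    (f := fun w : ℂ × ℂ => w.1 - a) (by fun_prop)
  have d6 := ((differentiable_rightFactor hτ k) (w.2 + d + η)).comp w
    (f := fun w : ℂ × ℂ => w.2 + d + η) (by fun_prop)
  have d7 := ((differentiable_theta hτ 3) (w.1 - w.2 + η + (b + c))).comp w
    (f := fun w : ℂ × ℂ => w.1 - w.2 + η + (b + c)) (by fun_prop)
  exact (((d1.mul d2).mul (d3.mul d4)).const_mul _).mul ((d5.mul d6).mul (d7.const_mul 2))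

end Joint

/-! ### The double elliptic Fourier transformation -/

/-- The summands of the integrand of the double elliptic Fourier transformation applied to
`S₂ L₁ σ₃ L₂ Φ`, as functions that are holomorphic along the simultaneous shift of both
variables. -/
noncomputable def jointTerm (η τ a b c d : ℂ) (i k : Fin 2) (z : ℂ × ℂ) (Φ : ℂ × ℂ → ℂ) (ε δ : ℤˣ)
    (w : ℂ × ℂ) : ℂ :=
  jointCoeff η τ a b c d i k ((ε : ℤ) * w.1, (δ : ℤ) * w.2) *
    ((reducedKernel η τ (c - a) z.1 w.1 * ex ((1 - (ε : ℤ)) * w.1)) *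
      (reducedKernel η τ (d - b) z.2 w.2 * ex ((1 - (δ : ℤ)) * w.2))) *
    (Complex.exp (Real.pi * I * ((w.1 + (ε : ℤ) * η) ^ 2 + (w.2 + (δ : ℤ) * η) ^ 2) / η) *
      Φ (w.1 + (ε : ℤ) * η, w.2 + (δ : ℤ) * η))

section DoubleFourier

variable {η τ : ℂ}

lemma fourierOp_fourierOp (hτ : 0 < τ.im) (hη : 0 < η.im) (c₁ c₂ : ℂ) (X : ℂ × ℂ → ℂ)
    (z : ℂ × ℂ) :
    onFst (fourierOp η τ c₁) (onSnd (fourierOp η τ c₂) X) z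
      = Complex.exp (-(Real.pi * I * z.1 ^ 2 / η)) * (fourierConst η τ c₁ *
        (Complex.exp (-(Real.pi * I * z.2 ^ 2 / η)) * (fourierConst η τ c₂ *
          squareIntegral fun x y => fourierKernel η τ c₁ z.1 x * fourierKernel η τ c₂ z.2 y *
            (Complex.exp (Real.pi * I * ((x : ℂ) ^ 2 + (y : ℂ) ^ 2) / η) * X (x, y))))) := by
  simp only [onFst, onSnd]
  rw [fourierOp_eq hτ hη, ← squareIntegral_const_mul, ← squareIntegral_const_mul]
  refine congrArg (_ * ·) (congrArg (_ * ·) (intervalIntegral.integral_congr fun x _ => ?_))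
  rw [fourierOp_eq hτ hη, ← intervalIntegral.integral_const_mul,
    ← intervalIntegral.integral_const_mul, ← intervalIntegral.integral_const_mul,
    ← intervalIntegral.integral_const_mul]
  refine intervalIntegral.integral_congr fun y _ => ?_
  simp only
  rw [mul_add, add_div, Complex.exp_add]
  ring

lemma kernel_mul_gamma_mul_rll (hτ : 0 < τ.im) (hη : 0 < η.im) (hθ : ∀ a, theta a η τ ≠ 0)
    {a b c d : ℂ} (i k : Fin 2) (Φ : ℂ × ℂ → ℂ) (z : ℂ × ℂ) {x y : ℝ}
    (hc : 0 < (τ / 2 + η + (b - c)).im) (hx : theta 0 (2 * x) τ ≠ 0)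
    (hy : theta 0 (2 * y) τ ≠ 0) :
    fourierKernel η τ (c - a) z.1 x * fourierKernel η τ (d - b) z.2 y *
      (Complex.exp (Real.pi * I * ((x : ℂ) ^ 2 + (y : ℂ) ^ 2) / η) *
        (gammaFour η τ (τ / 2 + η + (b - c)) x y *
          (lFst η τ a b * sigma₃ * lSnd η τ c d) i k Φ (x, y)))
      = (thetaConst τ * ex (-η / 2)) ^ 2 * ∑ p : ℤˣ × ℤˣ, (p.1 : ℤ) * (p.2 : ℤ) *
        jointTerm η τ a b c d i k z Φ p.1 p.2 (x, y) := by
  rw [rll_apply hτ hη hθ, Fintype.sum_prod_type]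
  simp only [Finset.mul_sum]
  refine Finset.sum_congr rfl fun ε _ => Finset.sum_congr rfl fun δ _ => ?_
  have hj := gammaFour_mul_rllCoeff_eq_jointCoeff (a := a) (b := b) (c := c) (d := d) (i := i)
    (k := k) hτ hη (w := ((ε : ℤ) * x, (δ : ℤ) * y)) (by
      rcases Int.units_eq_one_or ε with rfl | rfl <;>
        rcases Int.units_eq_one_or δ with rfl | rfl <;> simpa using hc)
  rw [gammaFour_mul_sign] at hj
  have h1 := fourierKernel_div_mul_gaussian hτ hη (c - a) z.1 ε hx
  have h2 := fourierKernel_div_mul_gaussian hτ hη (d - b) z.2 δ hy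
  rw [jointTerm, ← hj, mul_add, add_div, Complex.exp_add, mul_add _ ((_ : ℂ) ^ 2), add_div,
    Complex.exp_add]
  set E1 := Complex.exp (Real.pi * I * (x : ℂ) ^ 2 / η)
  set E2 := Complex.exp (Real.pi * I * (y : ℂ) ^ 2 / η)
  set E3 := Complex.exp (Real.pi * I * ((x : ℂ) + (ε : ℤ) * η) ^ 2 / η)
  set E4 := Complex.exp (Real.pi * I * ((y : ℂ) + (δ : ℤ) * η) ^ 2 / η)
  set G := gammaFour η τ (τ / 2 + η + (b - c)) x y
  set R := rllCoeff η τ a b c d i k ((ε : ℤ) * x, (δ : ℤ) * y)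
  set f := Φ ((x : ℂ) + (ε : ℤ) * η, (y : ℂ) + (δ : ℤ) * η)
  calc _ = (ε : ℤ) * (δ : ℤ) * G * R * f *
        ((fourierKernel η τ (c - a) z.1 x / theta 0 (2 * x) τ * E1) *
          (fourierKernel η τ (d - b) z.2 y / theta 0 (2 * y) τ * E2)) := by ring
    _ = _ := by rw [h1, h2]; ring

lemma jointTerm_periodic {a b c d : ℂ} (i k : Fin 2) (z : ℂ × ℂ) {Φ : ℂ × ℂ → ℂ}
    (hΦ : Admissible₂ η Φ) (ε δ : ℤˣ) (w₁ w₂ : ℂ) :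
    jointTerm η τ a b c d i k z Φ ε δ (w₁ + 1, w₂) = jointTerm η τ a b c d i k z Φ ε δ (w₁, w₂) ∧
    jointTerm η τ a b c d i k z Φ ε δ (w₁, w₂ + 1)
      = jointTerm η τ a b c d i k z Φ ε δ (w₁, w₂) := by
  obtain ⟨hp1, hp2, -⟩ := hΦ
  have hex : ∀ (ε : ℤˣ) (w : ℂ), ex ((1 - (ε : ℤ)) * (w + 1)) = ex ((1 - (ε : ℤ)) * w) := by
    intro ε w
    rcases Int.units_eq_one_or ε with rfl | rfl
    · simp
    · rw [← ex_add_one, ← ex_add_one ((1 - ((-1 : ℤˣ) : ℤ)) * w),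
        ← ex_add_one ((1 - ((-1 : ℤˣ) : ℤ)) * w + 1), ← ex_add_one (_ + 1 + 1)]
      congr 1
      simp only [Units.val_neg, Units.val_one, Int.cast_neg, Int.cast_one]
      ring
  have h1 := hp1 (w₁ + (ε : ℤ) * η) (w₂ + (δ : ℤ) * η)
  have h2 := hp2 (w₁ + (ε : ℤ) * η) (w₂ + (δ : ℤ) * η)
  simp only at h1 h2
  simp only [jointTerm]
  obtain ⟨j1, j2⟩ := jointCoeff_sign_add_one (η := η) (τ := τ) (a := a) (b := b) (c := c) (d := d)
    (i := i) (k := k) ε δ w₁ w₂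
  rw [j1, j2, hex, hex, reducedKernel_add_one, reducedKernel_add_one, add_right_comm w₁, h1,
    add_right_comm w₂, h2]
  exact ⟨rfl, rfl⟩

/-- On the path εw₁ and δw₂ have the same imaginary part −s, so their difference stays real. If one
variable moved alone, an argument of Γ could leave the upper half-plane, as `hc` gives only
positivity. -/
lemma differentiableAt_jointTerm (hτ : 0 < τ.im) (hη : 0 < η.im) {a b c d : ℂ} (i k : Fin 2)
    {z : ℂ × ℂ} {Φ : ℂ × ℂ → ℂ} (hΦ : Admissible₂ η Φ) (hc : 0 < (τ / 2 + η + (b - c)).im)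
    (h1 : η.im < (c - a + z.1).im) (h2 : η.im < (c - a - z.1).im)
    (h3 : η.im < (d - b + z.2).im) (h4 : η.im < (d - b - z.2).im) (ε δ : ℤˣ) {w : ℂ × ℂ} {s : ℝ}
    (hs0 : 0 ≤ s) (hs1 : s ≤ η.im) (hw1 : w.1.im = -((ε : ℤ) * s)) (hw2 : w.2.im = -((δ : ℤ) * s)) :
    DifferentiableAt ℂ (jointTerm η τ a b c d i k z Φ ε δ) w := by
  have habs : ∀ (ε : ℤˣ) (x : ℝ), |((ε : ℤ) : ℝ) * x| = |x| := fun ε x => by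
    rcases Int.units_eq_one_or ε with rfl | rfl <;> simp
  have hsq : ∀ (ε : ℤˣ) (x : ℝ), ((ε : ℤ) : ℝ) * (((ε : ℤ) : ℝ) * x) = x := fun ε x => by
    rcases Int.units_eq_one_or ε with rfl | rfl <;> simp
  have him : ∀ (ε : ℤˣ) (x : ℂ), (((ε : ℤ) : ℂ) * x).im = (ε : ℤ) * x.im := fun ε x => by
    rcases Int.units_eq_one_or ε with rfl | rfl <;> simp
  have b1 : |w.1.im| ≤ η.im := by rw [hw1, abs_neg, habs, abs_of_nonneg hs0]; exact hs1
  have b2 : |w.2.im| ≤ η.im := by rw [hw2, abs_neg, habs, abs_of_nonneg hs0]; exact hs1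
  have g1 : |(w.1 + (ε : ℤ) * η).im| ≤ η.im := by
    rw [add_im, hw1, him, neg_add_eq_sub, ← mul_sub, habs, abs_of_nonneg (by linarith)]
    linarith
  have g2 : |(w.2 + (δ : ℤ) * η).im| ≤ η.im := by
    rw [add_im, hw2, him, neg_add_eq_sub, ← mul_sub, habs, abs_of_nonneg (by linarith)]
    linarith
  have i1 : (((ε : ℤ) : ℂ) * w.1).im = -s := by rw [him, hw1, mul_neg, hsq]
  have i2 : (((δ : ℤ) : ℂ) * w.2).im = -s := by rw [him, hw2, mul_neg, hsq]
  have d1 : DifferentiableAt ℂ (fun w : ℂ × ℂ =>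
      jointCoeff η τ a b c d i k ((ε : ℤ) * w.1, (δ : ℤ) * w.2)) w := by
    have h2η : (2 * η).im = 2 * η.im := by simp
    refine (differentiableAt_jointCoeff hτ hη ?_ ?_ ?_ ?_).comp w
      (f := fun w : ℂ × ℂ => (((ε : ℤ) : ℂ) * w.1, ((δ : ℤ) : ℂ) * w.2)) (by fun_prop)
    · simp only [add_im, i1, i2, h2η] at hc ⊢; linarith
    · rw [sub_im, add_im, i1, i2]; linarith
    · rw [add_im, sub_im, i1, i2]; linarith
    · rw [sub_im, sub_im, i1, i2]; linarith
  have d2 := (differentiableAt_reducedKernel hτ hη (b1.trans_lt h1) (b1.trans_lt h2)).comp w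
    (f := fun w : ℂ × ℂ => w.1) (by fun_prop)
  have d3 := (differentiableAt_reducedKernel hτ hη (b2.trans_lt h3) (b2.trans_lt h4)).comp w
    (f := fun w : ℂ × ℂ => w.2) (by fun_prop)
  have d4 := (differentiable_ex ((1 - (ε : ℤ)) * w.1)).comp w
    (f := fun w : ℂ × ℂ => (1 - (ε : ℤ)) * w.1) (by fun_prop)
  have d5 := (differentiable_ex ((1 - (δ : ℤ)) * w.2)).comp w
    (f := fun w : ℂ × ℂ => (1 - (δ : ℤ)) * w.2) (by fun_prop)
  have d6 := (hΦ.2.2 (w.1 + (ε : ℤ) * η, w.2 + (δ : ℤ) * η) ⟨g1, g2⟩).differentiableAt.comp w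
    (f := fun w : ℂ × ℂ => (w.1 + (ε : ℤ) * η, w.2 + (δ : ℤ) * η)) (by fun_prop)
  exact (d1.mul ((d2.mul d4).mul (d3.mul d5))).mul d6

lemma squareIntegral_jointTerm (hτ : 0 < τ.im) (hη : 0 < η.im) {a b c d : ℂ} (i k : Fin 2)
    {z : ℂ × ℂ} {Φ : ℂ × ℂ → ℂ} (hΦ : Admissible₂ η Φ) (hc : 0 < (τ / 2 + η + (b - c)).im)
    (h1 : η.im < (c - a + z.1).im) (h2 : η.im < (c - a - z.1).im)
    (h3 : η.im < (d - b + z.2).im) (h4 : η.im < (d - b - z.2).im) (ε δ : ℤˣ) :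
    squareIntegral (fun x y =>
        jointTerm η τ a b c d i k z Φ ε δ (x - (ε : ℤ) * η, y - (δ : ℤ) * η))
      = squareIntegral fun x y => jointTerm η τ a b c d i k z Φ ε δ (x, y) := by
  have hcim : (-((ε : ℤ) * η)).im = -((ε : ℤ) * η.im) := by
    rcases Int.units_eq_one_or ε with rfl | rfl <;> simp
  -- The second variable has to move by −δη, which is εδ times the shift −εη of the first.
  have h := squareIntegral_add_of_periodic (F := jointTerm η τ a b c d i k z Φ ε δ)
    (c := -((ε : ℤ) * η)) (ε * δ)
    (by rw [hcim]; rcases Int.units_eq_one_or ε with rfl | rfl <;> simp [hη.ne'])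
    (fun z w => (jointTerm_periodic i k _ hΦ ε δ z w).1)
    (fun z w => (jointTerm_periodic i k _ hΦ ε δ z w).2)
    (fun z w t h0 ht hz hw => by
      rw [hcim] at hz hw
      refine differentiableAt_jointTerm hτ hη i k hΦ hc h1 h2 h3 h4 ε δ (s := t * η.im)
        (by positivity) (by nlinarith) ?_ ?_
      · simp only [hz]; ring
      · simp only [hw]
        rcases Int.units_eq_one_or ε with rfl | rfl <;>
          rcases Int.units_eq_one_or δ with rfl | rfl <;> simp)
  rw [← h]
  congr 1
  funext x y
  have e : ((((ε * δ : ℤˣ) : ℤ) : ℂ)) * -((ε : ℤ) * η) = -((δ : ℤ) * η) := by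
    rcases Int.units_eq_one_or ε with rfl | rfl <;>
      rcases Int.units_eq_one_or δ with rfl | rfl <;> simp
  rw [e, ← sub_eq_add_neg, ← sub_eq_add_neg]

end DoubleFourier

/-! ### The relation for the double Fourier transformation -/

section RLLRelation

variable {η τ : ℂ}

/-- At the shifted points `jointCoeff_eq` produces the coefficients of L₁(a, c) σ₃ L₂(b, d). For
each matrix index m the sum over signs factors into a function of x and a function of y, ready for
`sum_leftWeight` in each variable. -/
lemma sum_jointTerm (hτ : 0 < τ.im) (hη : 0 < η.im) {a b c d : ℂ} (i k : Fin 2) (z : ℂ × ℂ)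
    (Φ : ℂ × ℂ → ℂ) (hc : 0 < (τ / 2 + η + (b - c)).im) (x y : ℝ) :
    ∑ p : ℤˣ × ℤˣ, ((p.1 : ℤ) : ℂ) * (p.2 : ℤ) *
        jointTerm η τ a b c d i k z Φ p.1 p.2 (x - (p.1 : ℤ) * η, y - (p.2 : ℤ) * η)
      = gammaFour η τ (τ / 2 + η + (b - c)) x y *
        (Complex.exp (Real.pi * I * ((x : ℂ) ^ 2 + (y : ℂ) ^ 2) / η) * Φ (x, y)) *
        ∑ m : Fin 2, pauli 3 m m *
          ((∑ ε, leftWeight η τ a c i m ε z.1 x) * ∑ δ, leftWeight η τ b d m k δ z.2 y) := by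
  have hs : ∀ (A : ℂ) (P : Fin 2 → ℂ) (f g : Fin 2 → ℤˣ → ℂ),
      A * ∑ m, P m * ((∑ ε, f m ε) * ∑ δ, g m δ) = ∑ ε, ∑ δ, ∑ m, A * (P m * (f m ε * g m δ)) := by
    intro A P f g
    simp only [Fin.sum_univ_two, sum_intUnits]
    ring
  rw [Fintype.sum_prod_type, hs]
  refine Finset.sum_congr rfl fun ε _ => Finset.sum_congr rfl fun δ _ => ?_
  have e : ∀ (ε : ℤˣ) (w : ℂ), (ε : ℤ) * (w - (ε : ℤ) * η) = (ε : ℤ) * w - η := fun ε w => by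
    rw [mul_sub, sign_mul_sign_mul]
  have hj := jointCoeff_eq (a := a) (b := b) (c := c) (d := d) (i := i) (k := k) hτ hη
    (w := ((ε : ℤ) * x - η, (δ : ℤ) * y - η)) (by
      rcases Int.units_eq_one_or ε with rfl | rfl <;>
        rcases Int.units_eq_one_or δ with rfl | rfl <;> simpa using hc)
  simp only [sub_add_cancel, gammaFour_mul_sign] at hj
  simp only [jointTerm, e, sub_add_cancel, hj, ← sum_lCoeff_mul_lCoeff hτ, leftWeight,
    Finset.mul_sum, Finset.sum_mul]
  refine Finset.sum_congr rfl fun m _ => ?_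
  ring

lemma rll_gaussian_mul (hη : 0 < η.im) (hθ : ∀ a, theta a η τ ≠ 0) (a b c d C₁ C₂ : ℂ)
    (i k : Fin 2) (J : ℂ → ℂ → ℂ) (z : ℂ × ℂ) :
    (lFst η τ a b * sigma₃ * lSnd η τ c d) i k
        (fun z => Complex.exp (-(Real.pi * I * z.1 ^ 2 / η)) * (C₁ *
          (Complex.exp (-(Real.pi * I * z.2 ^ 2 / η)) * (C₂ * J z.1 z.2)))) z
      = Complex.exp (-(Real.pi * I * z.1 ^ 2 / η)) * (C₁ *
          (Complex.exp (-(Real.pi * I * z.2 ^ 2 / η)) * (C₂ * (ex (-η / 2) ^ 2 *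
            ∑ m : Fin 2, ∑ ε : ℤˣ, ∑ δ : ℤˣ, pauli 3 m m *
              (rightWeight η τ a b i m ε z.1 * rightWeight η τ c d m k δ z.2) *
                J (z.1 + (ε : ℤ) * η) (z.2 + (δ : ℤ) * η))))) := by
  rw [mul_sigma₃_mul_apply]
  simp only [lFst_apply, lSnd_apply]
  have h1 : ∀ m x, lOp η τ c d m k (fun y => Complex.exp (-(Real.pi * I * x ^ 2 / η)) * (C₁ *
      (Complex.exp (-(Real.pi * I * y ^ 2 / η)) * (C₂ * J x y)))) z.2
      = Complex.exp (-(Real.pi * I * x ^ 2 / η)) * (C₁ *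
        (Complex.exp (-(Real.pi * I * z.2 ^ 2 / η)) * (C₂ * (ex (-η / 2) *
          ∑ δ : ℤˣ, rightWeight η τ c d m k δ z.2 * J x (z.2 + (δ : ℤ) * η))))) := by
    intro m x
    have h := lOp_gaussian_mul hη hθ c d (Complex.exp (-(Real.pi * I * x ^ 2 / η)) * C₁ * C₂) m k
      (J x) z.2
    have e : (fun y => Complex.exp (-(Real.pi * I * x ^ 2 / η)) * (C₁ *
        (Complex.exp (-(Real.pi * I * y ^ 2 / η)) * (C₂ * J x y))))
        = fun y => Complex.exp (-(Real.pi * I * y ^ 2 / η)) *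
          (Complex.exp (-(Real.pi * I * x ^ 2 / η)) * C₁ * C₂ * J x y) := by
      funext y; ring
    rw [e, h]
    ring
  simp only [h1, lOp_gaussian_mul hη hθ a b C₁ i]
  simp only [Finset.mul_sum]
  refine Finset.sum_congr rfl fun m _ => Finset.sum_congr rfl fun ε _ =>
    Finset.sum_congr rfl fun δ _ => ?_
  ring

lemma continuous_fourierKernel_ofReal (hτ : 0 < τ.im) (hη : 0 < η.im) {c z : ℂ}
    (h1 : 0 < (c + z).im) (h2 : 0 < (c - z).im) :
    Continuous fun x : ℝ => fourierKernel η τ c z x := by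
  have := continuous_comp_ofReal_of_differentiableAt (d := 0) (F := fourierKernel η τ c z)
    fun x => differentiableAt_fourierKernel hτ hη (by simpa using h1) (by simpa using h2)
  simpa using this

lemma continuous_gammaFour_ofReal (hτ : 0 < τ.im) (hη : 0 < η.im) {c : ℂ} (hc : 0 < c.im) :
    Continuous fun x : ℝ × ℝ => gammaFour η τ c x.1 x.2 := by
  have h : ∀ f : ℝ × ℝ → ℂ, Continuous f → (∀ x, 0 < (f x).im) →
      Continuous fun x => expGamma η τ (f x) := fun f hf h =>
    continuous_iff_continuousAt.2 fun x =>
      (differentiableAt_expGamma hτ hη (h x)).continuousAt.comp hf.continuousAt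
  unfold gammaFour
  exact ((h _ (by fun_prop) fun x => by simpa using hc).mul
    (h _ (by fun_prop) fun x => by simpa using hc)).mul
      ((h _ (by fun_prop) fun x => by simpa using hc).mul
        (h _ (by fun_prop) fun x => by simpa using hc))

/-- The moved terms sum to D times products of left weights (`sum_jointTerm`), and the one-variable
exchange turns these into the coefficients of L₁(c, a) σ₃ L₂(d, b) acting on the kernels in z₁ and
z₂. Only Im(τ/2 + η + b − c) > 0 is required of D, so that it has no poles on the torus. -/
theorem fourier_rll (hτ : 0 < τ.im) (hη : 0 < η.im) (hθ : ∀ a, theta a η τ ≠ 0)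
    {a b c d : ℂ} (i k : Fin 2) {Φ : ℂ × ℂ → ℂ} (hΦ : Admissible₂ η Φ) {z : ℂ × ℂ}
    (hz1 : theta 0 (2 * z.1) τ ≠ 0) (hz2 : theta 0 (2 * z.2) τ ≠ 0)
    (hc : 0 < (τ / 2 + η + (b - c)).im)
    (h1 : η.im < (c - a + z.1).im) (h2 : η.im < (c - a - z.1).im)
    (h3 : η.im < (d - b + z.2).im) (h4 : η.im < (d - b - z.2).im) :
    onFst (fourierOp η τ (c - a)) (onSnd (fourierOp η τ (d - b)) fun w =>
        gammaFour η τ (τ / 2 + η + (b - c)) w.1 w.2 *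
          (lFst η τ a b * sigma₃ * lSnd η τ c d) i k Φ w) z
      = (lFst η τ c a * sigma₃ * lSnd η τ d b) i k
        (onFst (fourierOp η τ (c - a)) (onSnd (fourierOp η τ (d - b)) fun w =>
          gammaFour η τ (τ / 2 + η + (b - c)) w.1 w.2 * Φ w)) z := by
  set D : ℝ → ℝ → ℂ := fun x y => gammaFour η τ (τ / 2 + η + (b - c)) x y *
    (Complex.exp (Real.pi * I * ((x : ℂ) ^ 2 + (y : ℂ) ^ 2) / η) * Φ (x, y)) with hD
  have hDc : Continuous (Function.uncurry D) := by
    refine (continuous_gammaFour_ofReal hτ hη hc).mul (continuous_iff_continuousAt.2 fun x => ?_)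
    exact ((hΦ.2.2 ((x.1 : ℂ), (x.2 : ℂ)) (by simpa using hη.le)).continuousAt).comp
      (f := fun x : ℝ × ℝ => ((x.1 : ℂ), (x.2 : ℂ))) (by fun_prop)
  have hterm : ∀ ε δ, Continuous fun x : ℝ × ℝ =>
      jointTerm η τ a b c d i k z Φ ε δ (x.1, x.2) := fun ε δ =>
    continuous_iff_continuousAt.2 fun x =>
      (differentiableAt_jointTerm hτ hη i k hΦ hc h1 h2 h3 h4 ε δ (w := (x.1, x.2)) le_rfl hη.le
        (by simp) (by simp)).continuousAt.comp
          (f := fun x : ℝ × ℝ => ((x.1 : ℂ), (x.2 : ℂ))) (by fun_prop)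
  have hterm' : ∀ ε δ : ℤˣ, Continuous fun x : ℝ × ℝ =>
      jointTerm η τ a b c d i k z Φ ε δ (x.1 - (ε : ℤ) * η, x.2 - (δ : ℤ) * η) := fun ε δ =>
    continuous_iff_continuousAt.2 fun x =>
      (differentiableAt_jointTerm hτ hη i k hΦ hc h1 h2 h3 h4 ε δ
        (w := (x.1 - (ε : ℤ) * η, x.2 - (δ : ℤ) * η)) hη.le le_rfl
        (by rcases Int.units_eq_one_or ε with rfl | rfl <;> simp)
        (by rcases Int.units_eq_one_or δ with rfl | rfl <;> simp)).continuousAt.comp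
          (f := fun x : ℝ × ℝ => ((x.1 : ℂ) - (ε : ℤ) * η, (x.2 : ℂ) - (δ : ℤ) * η)) (by fun_prop)
  have hL : squareIntegral (fun x y => fourierKernel η τ (c - a) z.1 x *
      fourierKernel η τ (d - b) z.2 y * (Complex.exp (Real.pi * I * ((x : ℂ) ^ 2 + (y : ℂ) ^ 2) / η) *
        (gammaFour η τ (τ / 2 + η + (b - c)) x y *
          (lFst η τ a b * sigma₃ * lSnd η τ c d) i k Φ (x, y))))
      = ex (-η / 2) ^ 2 * squareIntegral fun x y => thetaConst τ ^ 2 *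
        ∑ p : ℤˣ × ℤˣ, ((p.1 : ℤ) : ℂ) * (p.2 : ℤ) *
          jointTerm η τ a b c d i k z Φ p.1 p.2 (x - (p.1 : ℤ) * η, y - (p.2 : ℤ) * η) := by
    rw [squareIntegral_congr_ae (ae_theta_zero_ne_zero hτ) fun x y hx hy =>
      kernel_mul_gamma_mul_rll hτ hη hθ i k Φ z hc hx hy, squareIntegral_const_mul,
      squareIntegral_const_mul,
      squareIntegral_sum (F := fun (p : ℤˣ × ℤˣ) x y => ((p.1 : ℤ) : ℂ) * (p.2 : ℤ) *
        jointTerm η τ a b c d i k z Φ p.1 p.2 (x, y)) _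
        fun p _ => continuous_const.mul (hterm p.1 p.2),
      squareIntegral_sum (F := fun (p : ℤˣ × ℤˣ) x y => ((p.1 : ℤ) : ℂ) * (p.2 : ℤ) *
        jointTerm η τ a b c d i k z Φ p.1 p.2 (x - (p.1 : ℤ) * η, y - (p.2 : ℤ) * η)) _
        fun p _ => continuous_const.mul (hterm' p.1 p.2)]
    simp only [squareIntegral_const_mul, squareIntegral_jointTerm hτ hη i k hΦ hc h1 h2 h3 h4]
    ring
  have hW : ∀ ε δ : ℤˣ, Continuous fun x : ℝ × ℝ =>
      fourierKernel η τ (c - a) (z.1 + (ε : ℤ) * η) x.1 *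
        fourierKernel η τ (d - b) (z.2 + (δ : ℤ) * η) x.2 * D x.1 x.2 := by
    have him : ∀ (ε : ℤˣ) (x : ℂ), (((ε : ℤ) : ℂ) * x).im = (ε : ℤ) * x.im := fun ε x => by
      rcases Int.units_eq_one_or ε with rfl | rfl <;> simp
    have hpos : ∀ (ε : ℤˣ) {c z : ℂ}, η.im < (c + z).im → η.im < (c - z).im →
        0 < (c + (z + (ε : ℤ) * η)).im ∧ 0 < (c - (z + (ε : ℤ) * η)).im := by
      intro ε c z h1 h2
      rw [← add_assoc, ← sub_sub, add_im, sub_im (c - z), him]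
      rcases Int.units_eq_one_or ε with rfl | rfl <;>
        simp only [Units.val_one, Units.val_neg, Int.cast_one, Int.cast_neg] <;>
        constructor <;> linarith
    intro ε δ
    obtain ⟨k1, k2⟩ := hpos ε h1 h2
    obtain ⟨k3, k4⟩ := hpos δ h3 h4
    exact (((continuous_fourierKernel_ofReal hτ hη k1 k2).comp continuous_fst).mul
      ((continuous_fourierKernel_ofReal hτ hη k3 k4).comp continuous_snd)).mul hDc
  have hR : (squareIntegral fun x y => thetaConst τ ^ 2 *
        ∑ p : ℤˣ × ℤˣ, ((p.1 : ℤ) : ℂ) * (p.2 : ℤ) *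
          jointTerm η τ a b c d i k z Φ p.1 p.2 (x - (p.1 : ℤ) * η, y - (p.2 : ℤ) * η))
      = ∑ m : Fin 2, ∑ ε : ℤˣ, ∑ δ : ℤˣ, pauli 3 m m *
          (rightWeight η τ c a i m ε z.1 * rightWeight η τ d b m k δ z.2) *
            squareIntegral fun x y => fourierKernel η τ (c - a) (z.1 + (ε : ℤ) * η) x *
              fourierKernel η τ (d - b) (z.2 + (δ : ℤ) * η) y * D x y := by
    have e : (fun x y : ℝ => thetaConst τ ^ 2 * ∑ p : ℤˣ × ℤˣ, ((p.1 : ℤ) : ℂ) * (p.2 : ℤ) *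
          jointTerm η τ a b c d i k z Φ p.1 p.2 (x - (p.1 : ℤ) * η, y - (p.2 : ℤ) * η))
        = fun x y : ℝ => ∑ q : Fin 2 × ℤˣ × ℤˣ, pauli 3 q.1 q.1 *
          (rightWeight η τ c a i q.1 q.2.1 z.1 * rightWeight η τ d b q.1 k q.2.2 z.2) *
            (fourierKernel η τ (c - a) (z.1 + (q.2.1 : ℤ) * η) x *
              fourierKernel η τ (d - b) (z.2 + (q.2.2 : ℤ) * η) y * D x y) := by
      funext x y
      rw [sum_jointTerm hτ hη i k z Φ hc, Fintype.sum_prod_type, Finset.mul_sum, Finset.mul_sum]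
      refine Finset.sum_congr rfl fun m _ => ?_
      rw [Fintype.sum_prod_type]
      have e1 := sum_leftWeight hτ hη a c i m x hz1 h1 h2
      have e2 := sum_leftWeight hτ hη b d m k y hz2 h3 h4
      calc _ = D x y * pauli 3 m m * ((thetaConst τ * ∑ ε, leftWeight η τ a c i m ε z.1 x) *
            (thetaConst τ * ∑ δ, leftWeight η τ b d m k δ z.2 y)) := by simp only [hD]; ring
        _ = _ := by
          rw [e1, e2, Finset.sum_mul_sum, Finset.mul_sum]
          refine Finset.sum_congr rfl fun ε _ => ?_
          rw [Finset.mul_sum]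
          exact Finset.sum_congr rfl fun δ _ => by ring
    rw [e, squareIntegral_sum (F := fun (q : Fin 2 × ℤˣ × ℤˣ) (x y : ℝ) => pauli 3 q.1 q.1 *
          (rightWeight η τ c a i q.1 q.2.1 z.1 * rightWeight η τ d b q.1 k q.2.2 z.2) *
            (fourierKernel η τ (c - a) (z.1 + (q.2.1 : ℤ) * η) x *
              fourierKernel η τ (d - b) (z.2 + (q.2.2 : ℤ) * η) y * D x y)) _
      fun q _ => continuous_const.mul (hW q.2.1 q.2.2)]
    simp only [squareIntegral_const_mul, Fintype.sum_prod_type]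
  have hJ : onFst (fourierOp η τ (c - a)) (onSnd (fourierOp η τ (d - b)) fun w =>
      gammaFour η τ (τ / 2 + η + (b - c)) w.1 w.2 * Φ w)
      = fun z => Complex.exp (-(Real.pi * I * z.1 ^ 2 / η)) * (fourierConst η τ (c - a) *
          (Complex.exp (-(Real.pi * I * z.2 ^ 2 / η)) * (fourierConst η τ (d - b) *
            squareIntegral fun x y => fourierKernel η τ (c - a) z.1 x *
              fourierKernel η τ (d - b) z.2 y * D x y))) := by
    funext z
    rw [fourierOp_fourierOp hτ hη]
    simp only [hD]
    simp only [mul_left_comm (Complex.exp _) (gammaFour _ _ _ _ _)]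
  rw [hJ, rll_gaussian_mul hη hθ c a d b _ _ i k (fun z₁ z₂ => squareIntegral fun x y =>
    fourierKernel η τ (c - a) z₁ x * fourierKernel η τ (d - b) z₂ y * D x y),
    fourierOp_fourierOp hτ hη, hL, hR]

end RLLRelation

/-! ### The intertwining relations for the explicit operators -/

section Relations

variable {η τ : ℂ}

lemma norm_ex_mul_lt_one_iff {c z : ℂ} :
    (‖ex c * ex z‖ < 1 ↔ 0 < (c + z).im) ∧ (‖ex c * (ex z)⁻¹‖ < 1 ↔ 0 < (c - z).im) := by
  rw [← ex_neg, ← ex_add, ← ex_add, ← sub_eq_add_neg]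
  exact ⟨norm_ex_lt_one_iff, norm_ex_lt_one_iff⟩

lemma im_pos_of_mem_domS₁ {u : Params} {z : ℂ × ℂ} (h : (u, z) ∈ domS₁ η τ) :
    0 < (u 1 - u 0 + z.1).im ∧ 0 < (u 1 - u 0 - z.1).im :=
  ⟨norm_ex_mul_lt_one_iff.1.1 h.1, norm_ex_mul_lt_one_iff.2.1 h.2.1⟩

lemma im_pos_of_mem_domS₃ {u : Params} {z : ℂ × ℂ} (h : (u, z) ∈ domS₃ η τ) :
    0 < (u 3 - u 2 + z.2).im ∧ 0 < (u 3 - u 2 - z.2).im :=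
  ⟨norm_ex_mul_lt_one_iff.1.1 h.1, norm_ex_mul_lt_one_iff.2.1 h.2.1⟩

/-- The integral formula at both w + η and w − η leaves a margin of Im η at w, which is what the
contour shifts use. -/
lemma im_lt_of_shifts {c w w₁ w₂ : ℂ} (h₁ : w₁ = w + η) (h₂ : w₂ = w + -η)
    (hp : 0 < (c + w₁).im ∧ 0 < (c - w₁).im) (hm : 0 < (c + w₂).im ∧ 0 < (c - w₂).im) :
    η.im < (c + w).im ∧ η.im < (c - w).im := by
  subst h₁ h₂
  simp only [add_im, sub_im, neg_im] at hp hm ⊢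
  constructor <;> linarith

lemma onFst_lFst (F : (ℂ → ℂ) → ℂ → ℂ) (a b : ℂ) (i k : Fin 2) (Φ : ℂ × ℂ → ℂ) (z : ℂ × ℂ) :
    onFst F (lFst η τ a b i k Φ) z = F (lOp η τ a b i k fun x => Φ (x, z.2)) z.1 := rfl

lemma lFst_onFst (F : (ℂ → ℂ) → ℂ → ℂ) (a b : ℂ) (i k : Fin 2) (Φ : ℂ × ℂ → ℂ) (z : ℂ × ℂ) :
    lFst η τ a b i k (onFst F Φ) z = lOp η τ a b i k (F fun x => Φ (x, z.2)) z.1 := rfl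

lemma onSnd_lSnd (F : (ℂ → ℂ) → ℂ → ℂ) (a b : ℂ) (i k : Fin 2) (Φ : ℂ × ℂ → ℂ) (z : ℂ × ℂ) :
    onSnd F (lSnd η τ a b i k Φ) z = F (lOp η τ a b i k fun y => Φ (z.1, y)) z.2 := rfl

lemma lSnd_onSnd (F : (ℂ → ℂ) → ℂ → ℂ) (a b : ℂ) (i k : Fin 2) (Φ : ℂ × ℂ → ℂ) (z : ℂ × ℂ) :
    lSnd η τ a b i k (onSnd F Φ) z = lOp η τ a b i k (F fun y => Φ (z.1, y)) z.2 := rfl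

lemma opS₁_lFst (hτ : 0 < τ.im) (hη : 0 < η.im) (hθ : ∀ a, theta a η τ ≠ 0) {Φ : ℂ × ℂ → ℂ}
    (hΦ : ∀ z₂, Admissible η fun x => Φ (x, z₂)) (u : Params) (z : ℂ × ℂ) (hz : z ∈ regFst τ)
    (h : ∀ d ∈ stepsFst η, (u, z + d) ∈ domS₁ η τ) (i k : Fin 2) :
    opS₁ η τ u (lFst η τ (u 0) (u 1) i k Φ) z
      = lFst η τ (u 1) (u 0) i k (opS₁ η τ u Φ) z := by
  obtain ⟨h1, h2⟩ := im_lt_of_shifts (η := η) (w := z.1) rfl rfl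
    (im_pos_of_mem_domS₁ (h (η, 0) (Or.inl rfl))) (im_pos_of_mem_domS₁ (h (-η, 0) (Or.inr rfl)))
  rw [opS₁, onFst_lFst, lFst_onFst]
  exact fourierOp_lOp hτ hη hθ i k (hΦ z.2) hz h1 h2

lemma opS₃_lSnd (hτ : 0 < τ.im) (hη : 0 < η.im) (hθ : ∀ a, theta a η τ ≠ 0) {Φ : ℂ × ℂ → ℂ}
    (hΦ : ∀ z₁, Admissible η fun y => Φ (z₁, y)) (u : Params) (z : ℂ × ℂ) (hz : z ∈ regSnd τ)
    (h : ∀ d ∈ stepsSnd η, (u, z + d) ∈ domS₃ η τ) (i k : Fin 2) :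
    opS₃ η τ u (lSnd η τ (u 2) (u 3) i k Φ) z
      = lSnd η τ (u 3) (u 2) i k (opS₃ η τ u Φ) z := by
  obtain ⟨h1, h2⟩ := im_lt_of_shifts (η := η) (w := z.2) rfl rfl
    (im_pos_of_mem_domS₃ (h (0, η) (Or.inl rfl))) (im_pos_of_mem_domS₃ (h (0, -η) (Or.inr rfl)))
  rw [opS₃, onSnd_lSnd, lSnd_onSnd]
  exact fourierOp_lOp hτ hη hθ i k (hΦ z.1) hz h1 h2

lemma opS₂_eq (u : Params) (Φ : ℂ × ℂ → ℂ) : opS₂ η τ u Φ =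
    fun w => gammaFour η τ (τ / 2 + η + (u 1 - u 2)) w.1 w.2 * Φ w := by
  funext w
  rw [opS₂, dFun_eq]

lemma opS₂_congr {u : Params} {X Y : ℂ × ℂ → ℂ} {z : ℂ × ℂ} (h : X z = Y z) :
    opS₂ η τ u X z = opS₂ η τ u Y z := by
  simp only [opS₂, h]

lemma rOp_eq (u : Params) (Φ : ℂ × ℂ → ℂ) : rOp (opS₁ η τ) (opS₂ η τ) (opS₃ η τ) u Φ =
    opS₂ η τ (s₁ (s₃ (s₂ u))) (onFst (fourierOp η τ (u 2 - u 0)) (onSnd (fourierOp η τ (u 3 - u 1))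
      fun w => gammaFour η τ (τ / 2 + η + (u 1 - u 2)) w.1 w.2 * Φ w)) := by
  rw [rOp, opS₂_eq u]
  rfl

lemma opS₂_rll_permuted (hτ : 0 < τ.im) (hη : 0 < η.im) (hθ : ∀ a, theta a η τ ≠ 0) (u : Params)
    (z : ℂ × ℂ) (h0 : (s₁ (s₃ (s₂ u)), z) ∈ domS₂ η τ)
    (h : ∀ d ∈ stepsBoth η, (s₁ (s₃ (s₂ u)), z + d) ∈ domS₂ η τ) (i k : Fin 2)
    (Φ : ℂ × ℂ → ℂ) :
    opS₂ η τ (s₁ (s₃ (s₂ u))) ((lFst η τ (u 2) (u 0) * sigma₃ * lSnd η τ (u 3) (u 1)) i k Φ) z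
      = (lFst η τ (u 2) (u 3) * sigma₃ * lSnd η τ (u 0) (u 1)) i k
        (opS₂ η τ (s₁ (s₃ (s₂ u))) Φ) z := by
  have e := opS₂_rll hτ hη hθ _ z h0 h i k Φ
  rwa [show s₁ (s₃ (s₂ u)) 0 = u 2 from rfl, show s₁ (s₃ (s₂ u)) 1 = u 0 from rfl,
    show s₁ (s₃ (s₂ u)) 2 = u 3 from rfl, show s₁ (s₃ (s₂ u)) 3 = u 1 from rfl] at e

/-- The left `S₂` satisfies its relation on arbitrary functions and acts by multiplication, so
`fourier_rll` is needed at the single point z only. -/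
lemma rOp_rll (hτ : 0 < τ.im) (hη : 0 < η.im) (hθ : ∀ a, theta a η τ ≠ 0) {Φ : ℂ × ℂ → ℂ}
    (hΦ : Admissible₂ η Φ) (u : Params) (z : ℂ × ℂ) (hz : z ∈ regFst τ ∩ regSnd τ)
    (h0 : (u, z) ∈ domR η τ) (h : ∀ d ∈ stepsBoth η, (u, z + d) ∈ domR η τ) (i k : Fin 2) :
    rOp (opS₁ η τ) (opS₂ η τ) (opS₃ η τ) u
        ((lFst η τ (u 0) (u 1) * sigma₃ * lSnd η τ (u 2) (u 3)) i k Φ) z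
      = (lFst η τ (u 2) (u 3) * sigma₃ * lSnd η τ (u 0) (u 1)) i k
        (rOp (opS₁ η τ) (opS₂ η τ) (opS₃ η τ) u Φ) z := by
  have hc : 0 < (τ / 2 + η + (u 1 - u 2)).im := norm_ex_mul_lt_one_iff.1.1 h0.1
  have hp := h (η, η) (by simp [stepsBoth])
  have hm := h (-η, -η) (by simp [stepsBoth])
  obtain ⟨h1, h2⟩ := im_lt_of_shifts (η := η) (w := z.1) rfl rfl
    (im_pos_of_mem_domS₁ hp.2.2.1) (im_pos_of_mem_domS₁ hm.2.2.1)
  obtain ⟨h3, h4⟩ := im_lt_of_shifts (η := η) (w := z.2) rfl rfl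
    (im_pos_of_mem_domS₃ hp.2.1) (im_pos_of_mem_domS₃ hm.2.1)
  have hf := fourier_rll hτ hη hθ (a := u 0) (b := u 1) (c := u 2) (d := u 3) i k hΦ hz.1 hz.2 hc
    h1 h2 h3 h4
  rw [rOp_eq, rOp_eq, ← opS₂_rll_permuted hτ hη hθ u z h0.2.2.2 fun d hd => (h d hd).2.2.2]
  exact opS₂_congr hf

end Relations

/-! ### Analytic continuation -/

section Continuation

variable {η τ : ℂ}

/-- Both sides are analytic on the connected set Ω. As `dom` is open and there are finitely many
shifts, the formulas apply, with all shifts, near the given point; there the two sides agree, and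
the identity theorem does the rest. -/
lemma Intertwines.of_direct {S : Params → (ℂ × ℂ → ℂ) → ℂ × ℂ → ℂ} {A B : Params → OpMatrix}
    {dom : Set Point} {steps reg : Set (ℂ × ℂ)} {Φ : ℂ × ℂ → ℂ} (hdom : IsOpen dom)
    (hsteps : steps.Finite)
    (hS : ∀ (u : Params) (z : ℂ × ℂ), z ∈ reg → (u, z) ∈ dom →
      (∀ d ∈ steps, (u, z + d) ∈ dom) → ∀ i k, S u (A u i k Φ) z = B u i k (S u Φ) z)
    {ι : Type} [Fintype ι] (d : ι → ℂ × ℂ) (hd : ∀ j, d j ∈ steps)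
    (coeff : Fin 2 → Fin 2 → ι → Point → ℂ)
    (hcoeff : ∀ i k j (x : Point), x.2 ∈ reg → AnalyticAt ℂ (coeff i k j) x)
    (hB : ∀ u i k F z, B u i k F z = ∑ j, coeff i k j (u, z) * F (z + d j)) :
    Intertwines S A B dom steps reg Φ := by
  refine ⟨hS, fun Ω Ω' H G hH hG hΩ hx x hxΩ i k => ?_⟩
  obtain ⟨x₀, hx₀, h₀, h₁⟩ := hx
  have hcont : ∀ e : ℂ × ℂ, Continuous fun x : Point => (x.1, x.2 + e) := fun e => by fun_prop
  have hana : AnalyticOnNhd ℂ (fun x : Point => B x.1 i k (fun z => G (x.1, z)) x.2) Ω := by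
    intro y hy
    simp only [hB]
    refine Finset.analyticAt_fun_sum _ fun j _ => (hcoeff i k j y (hΩ y hy).1).mul ?_
    have hs : AnalyticAt ℂ (fun x : Point => (x.1, x.2 + d j)) y :=
      analyticAt_fst.prod (analyticAt_snd.add analyticAt_const)
    exact AnalyticAt.fun_comp (g := G) (hG.2.2.2.1 _ ((hΩ y hy).2 _ (hd j))) hs
  refine (hH i k).2.2.2.1.eqOn_of_preconnected_of_eventuallyEq hana (hH i k).2.1 hx₀ ?_ hxΩ
  have hnear : ∀ᶠ y in nhds x₀, ∀ e ∈ steps, ((y.1, y.2 + e) : Point) ∈ dom :=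
    (Filter.eventually_all_finite hsteps).2 fun e he =>
      (hcont e).continuousAt.eventually (hdom.mem_nhds (h₁ e he))
  filter_upwards [hnear, hdom.mem_nhds h₀, (hH i k).1.mem_nhds hx₀] with y hy hyd hyΩ
  refine ((hH i k).2.2.2.2 y ⟨hyΩ, hyd⟩).trans
    ((hS y.1 y.2 (hΩ y hyΩ).1 hyd hy i k).trans ?_)
  rw [hB, hB]
  refine Finset.sum_congr rfl fun j _ => ?_
  rw [hG.2.2.2.2 _ ⟨(hΩ y hyΩ).2 _ (hd j), hy _ (hd j)⟩]

lemma continuous_ex : Continuous ex := differentiable_ex.continuous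

/-- The infinitely many conditions amount to the nonvanishing of one entire function, the
denominator of Γ. -/
lemma isOpen_setOf_notPole (hτ : 0 < τ.im) (hη : 0 < η.im) {f : Point → ℂ} (hf : Continuous f) :
    IsOpen {x | NotPole (ex τ) (ex (2 * η)) (f x)} := by
  have hp := norm_ex_lt_one_iff.2 hτ
  have hq := norm_ex_two_mul_lt_one hη
  simp only [← qPoch₂_ne_zero_iff hp hq]
  exact isOpen_ne_fun ((differentiable_qPoch₂ hp hq).continuous.comp hf) continuous_const

lemma notZero_iff_notPole {p q x : ℂ} (hx : x ≠ 0) : NotZero p q x ↔ NotPole p q (p * q * x⁻¹) := by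
  refine forall_congr' fun j => forall_congr' fun k => not_congr ?_
  rw [show p * q * x⁻¹ * p ^ j * q ^ k = p ^ (j + 1) * q ^ (k + 1) / x by ring,
    div_eq_one_iff_eq hx, eq_comm]

lemma isOpen_setOf_notZero (hτ : 0 < τ.im) (hη : 0 < η.im) {f : Point → ℂ} (hf : Continuous f) :
    IsOpen {x | NotZero (ex τ) (ex (2 * η)) (ex (f x) ^ 2)} := by
  simp only [notZero_iff_notPole (pow_ne_zero 2 (ex_ne_zero _)), ← inv_pow, ← ex_neg]
  exact isOpen_setOf_notPole hτ hη
    (continuous_const.mul ((continuous_ex.comp hf.neg).pow 2))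

lemma isOpen_setOf_norm_lt {c f : Point → ℂ} (hc : Continuous c) (hf : Continuous f) :
    IsOpen {x | ‖ex (c x) * ex (f x)‖ < 1} ∧ IsOpen {x | ‖ex (c x) * (ex (f x))⁻¹‖ < 1} := by
  simp only [norm_ex_mul_lt_one_iff]
  exact ⟨isOpen_lt continuous_const (by fun_prop), isOpen_lt continuous_const (by fun_prop)⟩

lemma isOpen_domS₁ (hτ : 0 < τ.im) (hη : 0 < η.im) : IsOpen (domS₁ η τ) := by
  have hc : Continuous fun x : Point => x.1 1 - x.1 0 := by fun_prop
  have h := isOpen_setOf_norm_lt hc (f := fun x : Point => x.2.1) (by fun_prop)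
  exact h.1.inter (h.2.inter (isOpen_setOf_notZero hτ hη hc))

lemma isOpen_domS₃ (hτ : 0 < τ.im) (hη : 0 < η.im) : IsOpen (domS₃ η τ) := by
  have hc : Continuous fun x : Point => x.1 3 - x.1 2 := by fun_prop
  have h := isOpen_setOf_norm_lt hc (f := fun x : Point => x.2.2) (by fun_prop)
  exact h.1.inter (h.2.inter (isOpen_setOf_notZero hτ hη hc))

lemma isOpen_domS₂ (hτ : 0 < τ.im) (hη : 0 < η.im) : IsOpen (domS₂ η τ) := by
  simp only [domS₂, Set.ofPred_forall]
  exact isOpen_iInter_of_finite fun ε => isOpen_iInter_of_finite fun δ =>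
    isOpen_setOf_notPole hτ hη (continuous_ex.comp (by fun_prop))

lemma continuous_permutations : Continuous s₁ ∧ Continuous s₂ ∧ Continuous s₃ := by
  refine ⟨continuous_pi fun j => ?_, continuous_pi fun j => ?_, continuous_pi fun j => ?_⟩ <;>
    fin_cases j <;> exact continuous_apply _

lemma isOpen_domR (hτ : 0 < τ.im) (hη : 0 < η.im) : IsOpen (domR η τ) := by
  obtain ⟨c1, c2, c3⟩ := continuous_permutations
  have h1 : Continuous fun x : Point => (s₂ x.1, x.2) := by fun_prop
  have h2 : Continuous fun x : Point => (s₃ (s₂ x.1), x.2) := by fun_prop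
  have h3 : Continuous fun x : Point => (s₁ (s₃ (s₂ x.1)), x.2) := by fun_prop
  exact (isOpen_setOf_norm_lt (c := fun _ => τ / 2 + η) (f := fun x => x.1 1 - x.1 2)
    continuous_const (by fun_prop)).1.inter (((isOpen_domS₃ hτ hη).preimage h1).inter
      (((isOpen_domS₁ hτ hη).preimage h2).inter ((isOpen_domS₂ hτ hη).preimage h3)))

lemma analyticAt_param (j : Fin 4) (x : Point) : AnalyticAt ℂ (fun x : Point => x.1 j) x :=
  ((ContinuousLinearMap.proj (R := ℂ) (φ := fun _ : Fin 4 => ℂ) j).comp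
    (ContinuousLinearMap.fst ℂ Params (ℂ × ℂ))).analyticAt x

lemma analyticAt_var_fst (x : Point) : AnalyticAt ℂ (fun x : Point => x.2.1) x :=
  ((ContinuousLinearMap.fst ℂ ℂ ℂ).comp (ContinuousLinearMap.snd ℂ Params (ℂ × ℂ))).analyticAt x

lemma analyticAt_var_snd (x : Point) : AnalyticAt ℂ (fun x : Point => x.2.2) x :=
  ((ContinuousLinearMap.snd ℂ ℂ ℂ).comp (ContinuousLinearMap.snd ℂ Params (ℂ × ℂ))).analyticAt x

lemma analyticAt_comp_of_differentiable {g : ℂ → ℂ} (hg : Differentiable ℂ g) {f : Point → ℂ}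
    {x : Point} (hf : AnalyticAt ℂ f x) : AnalyticAt ℂ (fun x => g (f x)) x :=
  (hg.analyticAt (f x)).comp hf

lemma analyticAt_lCoeff (hτ : 0 < τ.im) (i k : Fin 2) {f g : Point → ℂ} {x : Point}
    (hf : AnalyticAt ℂ f x) (hg : AnalyticAt ℂ g x) :
    AnalyticAt ℂ (fun x => lCoeff τ i k (f x) (g x)) x := by
  unfold lCoeff
  exact Finset.analyticAt_fun_sum _ fun a _ =>
    (analyticAt_const.mul (analyticAt_comp_of_differentiable (differentiable_theta hτ a) hf)).mul
      (analyticAt_comp_of_differentiable (differentiable_theta hτ a) hg)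

lemma analyticAt_lOp_coeff (hτ : 0 < τ.im) (i k : Fin 2) (ε : ℤˣ) {a b z : Point → ℂ} {x : Point}
    (ha : AnalyticAt ℂ a x) (hb : AnalyticAt ℂ b x) (hz : AnalyticAt ℂ z x)
    (h : theta 0 (2 * z x) τ ≠ 0) :
    AnalyticAt ℂ (fun x => (ε : ℤ) * lCoeff τ i k (a x + b x + η)
      (2 * ((ε : ℤ) * z x) + (b x - a x + η)) / theta 0 (2 * z x) τ) x :=
  (analyticAt_const.mul (analyticAt_lCoeff hτ i k ((ha.add hb).add analyticAt_const)
    ((analyticAt_const.mul (analyticAt_const.mul hz)).add ((hb.sub ha).add analyticAt_const)))).div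
      (analyticAt_comp_of_differentiable (differentiable_theta hτ 0) (analyticAt_const.mul hz)) h

lemma analyticAt_rll_coeff (hτ : 0 < τ.im) (i k : Fin 2) (ε δ : ℤˣ) {a b c d : Point → ℂ}
    {x : Point} (ha : AnalyticAt ℂ a x) (hb : AnalyticAt ℂ b x) (hc : AnalyticAt ℂ c x)
    (hd : AnalyticAt ℂ d x) (hx : x.2 ∈ regFst τ ∩ regSnd τ) :
    AnalyticAt ℂ (fun x : Point => (ε : ℤ) * (δ : ℤ) *
      rllCoeff η τ (a x) (b x) (c x) (d x) i k ((ε : ℤ) * x.2.1, (δ : ℤ) * x.2.2) /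
        (theta 0 (2 * x.2.1) τ * theta 0 (2 * x.2.2) τ)) x := by
  have h1 := analyticAt_const (v := (((ε : ℤ) : ℂ))) |>.mul (analyticAt_var_fst x)
  have h2 := analyticAt_const (v := (((δ : ℤ) : ℂ))) |>.mul (analyticAt_var_snd x)
  have hη : AnalyticAt ℂ (fun _ : Point => η) x := analyticAt_const
  refine (analyticAt_const.mul ?_).div
    ((analyticAt_comp_of_differentiable (differentiable_theta hτ 0)
      (analyticAt_const.mul (analyticAt_var_fst x))).mul
      (analyticAt_comp_of_differentiable (differentiable_theta hτ 0)
        (analyticAt_const.mul (analyticAt_var_snd x)))) (mul_ne_zero hx.1 hx.2)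
  have t3 := differentiable_theta hτ 3
  exact ((analyticAt_comp_of_differentiable (differentiable_leftFactor hτ i) (h1.sub ha)).mul
    (analyticAt_comp_of_differentiable (differentiable_rightFactor hτ k)
      ((h2.add hd).add hη))).mul ((analyticAt_const.mul
        (analyticAt_comp_of_differentiable t3 (((h1.add h2).add hη).add (hb.sub hc)))).mul
          (analyticAt_comp_of_differentiable t3 (((h1.sub h2).add hη).add (hb.add hc))))

lemma intertwines_opS₁ (hτ : 0 < τ.im) (hη : 0 < η.im) (hθ : ∀ a, theta a η τ ≠ 0)
    {Φ : ℂ × ℂ → ℂ} (hΦ : ∀ z₂, Admissible η fun x => Φ (x, z₂)) :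
    Intertwines (opS₁ η τ) (fun u => lFst η τ (u 0) (u 1)) (fun u => lFst η τ (u 1) (u 0))
      (domS₁ η τ) (stepsFst η) (regFst τ) Φ := by
  refine Intertwines.of_direct (isOpen_domS₁ hτ hη) (Set.toFinite {(η, 0), (-η, 0)})
    (fun u z hz _ h i k => opS₁_lFst hτ hη hθ hΦ u z hz h i k)
    (fun ε : ℤˣ => ((ε : ℤ) * η, 0)) (fun ε => ?_)
    (fun i k ε x => (ε : ℤ) * lCoeff τ i k (x.1 1 + x.1 0 + η)
      (2 * ((ε : ℤ) * x.2.1) + (x.1 0 - x.1 1 + η)) / theta 0 (2 * x.2.1) τ)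
    (fun i k ε x hx => analyticAt_lOp_coeff hτ i k ε (analyticAt_param 1 x) (analyticAt_param 0 x)
      (analyticAt_var_fst x) hx) fun u i k F z => ?_
  · rcases Int.units_eq_one_or ε with rfl | rfl <;> simp [stepsFst]
  · rw [lFst_apply, lOp_apply' hη hθ]
    refine Finset.sum_congr rfl fun ε _ => ?_
    rw [show z + ((ε : ℤ) * η, 0) = (z.1 + (ε : ℤ) * η, z.2) from
      Prod.ext rfl (add_zero z.2)]
    ring

lemma intertwines_opS₃ (hτ : 0 < τ.im) (hη : 0 < η.im) (hθ : ∀ a, theta a η τ ≠ 0)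
    {Φ : ℂ × ℂ → ℂ} (hΦ : ∀ z₁, Admissible η fun y => Φ (z₁, y)) :
    Intertwines (opS₃ η τ) (fun u => lSnd η τ (u 2) (u 3)) (fun u => lSnd η τ (u 3) (u 2))
      (domS₃ η τ) (stepsSnd η) (regSnd τ) Φ := by
  refine Intertwines.of_direct (isOpen_domS₃ hτ hη) (Set.toFinite {(0, η), (0, -η)})
    (fun u z hz _ h i k => opS₃_lSnd hτ hη hθ hΦ u z hz h i k)
    (fun ε : ℤˣ => (0, (ε : ℤ) * η)) (fun ε => ?_)
    (fun i k ε x => (ε : ℤ) * lCoeff τ i k (x.1 3 + x.1 2 + η)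
      (2 * ((ε : ℤ) * x.2.2) + (x.1 2 - x.1 3 + η)) / theta 0 (2 * x.2.2) τ)
    (fun i k ε x hx => analyticAt_lOp_coeff hτ i k ε (analyticAt_param 3 x) (analyticAt_param 2 x)
      (analyticAt_var_snd x) hx) fun u i k F z => ?_
  · rcases Int.units_eq_one_or ε with rfl | rfl <;> simp [stepsSnd]
  · rw [lSnd_apply, lOp_apply' hη hθ]
    refine Finset.sum_congr rfl fun ε _ => ?_
    rw [show z + (0, (ε : ℤ) * η) = (z.1, z.2 + (ε : ℤ) * η) from
      Prod.ext (add_zero z.1) rfl]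
    ring

/-- The map `σ` records the order of the parameters on the right-hand side: `![0, 2, 1, 3]` for S₂
and `![2, 3, 0, 1]` for R₁₂. -/
lemma Intertwines.of_direct_rll (hτ : 0 < τ.im) (hη : 0 < η.im) (hθ : ∀ a, theta a η τ ≠ 0)
    {S : Params → (ℂ × ℂ → ℂ) → ℂ × ℂ → ℂ} {A : Params → OpMatrix} {dom : Set Point}
    {Φ : ℂ × ℂ → ℂ} (σ : Fin 4 → Fin 4) (hdom : IsOpen dom)
    (hS : ∀ (u : Params) (z : ℂ × ℂ), z ∈ regFst τ ∩ regSnd τ → (u, z) ∈ dom →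
      (∀ d ∈ stepsBoth η, (u, z + d) ∈ dom) → ∀ i k, S u (A u i k Φ) z =
        (lFst η τ (u (σ 0)) (u (σ 1)) * sigma₃ * lSnd η τ (u (σ 2)) (u (σ 3))) i k (S u Φ) z) :
    Intertwines S A
      (fun u => lFst η τ (u (σ 0)) (u (σ 1)) * sigma₃ * lSnd η τ (u (σ 2)) (u (σ 3)))
      dom (stepsBoth η) (regFst τ ∩ regSnd τ) Φ := by
  refine Intertwines.of_direct hdom (Set.toFinite {(η, η), (η, -η), (-η, η), (-η, -η)}) hS
    (fun p : ℤˣ × ℤˣ => ((p.1 : ℤ) * η, (p.2 : ℤ) * η)) (fun p => mem_stepsBoth p.1 p.2)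
    (fun i k p x => (p.1 : ℤ) * (p.2 : ℤ) *
      rllCoeff η τ (x.1 (σ 0)) (x.1 (σ 1)) (x.1 (σ 2)) (x.1 (σ 3)) i k
        ((p.1 : ℤ) * x.2.1, (p.2 : ℤ) * x.2.2) /
          (theta 0 (2 * x.2.1) τ * theta 0 (2 * x.2.2) τ))
    (fun i k p x hx => analyticAt_rll_coeff hτ i k p.1 p.2 (analyticAt_param _ x)
      (analyticAt_param _ x) (analyticAt_param _ x) (analyticAt_param _ x) hx)
    fun u i k F z => ?_
  rw [rll_apply hτ hη hθ, Fintype.sum_prod_type]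
  refine Finset.sum_congr rfl fun ε _ => Finset.sum_congr rfl fun δ _ => ?_
  rw [show z + ((ε : ℤ) * η, (δ : ℤ) * η) = (z.1 + (ε : ℤ) * η, z.2 + (δ : ℤ) * η) from rfl]
  ring

lemma intertwines_opS₂ (hτ : 0 < τ.im) (hη : 0 < η.im) (hθ : ∀ a, theta a η τ ≠ 0)
    (Φ : ℂ × ℂ → ℂ) :
    Intertwines (opS₂ η τ) (fun u => lFst η τ (u 0) (u 1) * sigma₃ * lSnd η τ (u 2) (u 3))
      (fun u => lFst η τ (u 0) (u 2) * sigma₃ * lSnd η τ (u 1) (u 3))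
      (domS₂ η τ) (stepsBoth η) (regFst τ ∩ regSnd τ) Φ :=
  Intertwines.of_direct_rll hτ hη hθ ![0, 2, 1, 3] (isOpen_domS₂ hτ hη)
    fun u z _ h0 h i k => opS₂_rll hτ hη hθ u z h0 h i k Φ

lemma intertwines_rOp (hτ : 0 < τ.im) (hη : 0 < η.im) (hθ : ∀ a, theta a η τ ≠ 0)
    {Φ : ℂ × ℂ → ℂ} (hΦ : Admissible₂ η Φ) :
    Intertwines (rOp (opS₁ η τ) (opS₂ η τ) (opS₃ η τ))
      (fun u => lFst η τ (u 0) (u 1) * sigma₃ * lSnd η τ (u 2) (u 3))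
      (fun u => lFst η τ (u 2) (u 3) * sigma₃ * lSnd η τ (u 0) (u 1))
      (domR η τ) (stepsBoth η) (regFst τ ∩ regSnd τ) Φ :=
  Intertwines.of_direct_rll hτ hη hθ ![2, 3, 0, 1] (isOpen_domR hτ hη)
    fun u z hz h0 h i k => rOp_rll hτ hη hθ hΦ u z hz h0 h i k

end Continuation

/-! ### The relation for `R₁₂` from the defining relations -/

section Algebra

variable {η τ : ℂ}

lemma mul_sigma₃_mul_eq_sum (A B : OpMatrix) (i k : Fin 2) (Φ : ℂ × ℂ → ℂ) :
    (A * sigma₃ * B) i k Φ = ∑ m : Fin 2, pauli 3 m m • A i m (B m k Φ) := by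
  funext z
  rw [mul_sigma₃_mul_apply, Finset.sum_apply]
  rfl

/-- As a function of z₂, L₁Φ is a finite linear combination of slices of Φ, with coefficients
depending on z₁ only. So any linear operator in z₂ commutes with L₁. -/
lemma onSndLin_lFst (hη : 0 < η.im) (hθ : ∀ a, theta a η τ ≠ 0) (A : Module.End ℂ (ℂ → ℂ))
    (a b : ℂ) (i k : Fin 2) (Φ : ℂ × ℂ → ℂ) :
    onSndLin A (lFst η τ a b i k Φ) = lFst η τ a b i k (onSndLin A Φ) := by
  funext z
  have e : (fun y => lFst η τ a b i k Φ (z.1, y)) = ∑ ε : ℤˣ, ((ε : ℤ) *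
      lCoeff τ i k (a + b + η) (2 * ((ε : ℤ) * z.1) + (b - a + η)) / theta 0 (2 * z.1) τ) •
        fun y => Φ (z.1 + (ε : ℤ) * η, y) := by
    funext y
    rw [lFst_apply, lOp_apply' hη hθ, Finset.sum_apply]
    refine Finset.sum_congr rfl fun ε _ => ?_
    rw [Pi.smul_apply, smul_eq_mul]
    ring
  change A (fun y => lFst η τ a b i k Φ (z.1, y)) z.2 = _
  rw [e, map_sum, lFst_apply, lOp_apply' hη hθ, Finset.sum_apply]
  refine Finset.sum_congr rfl fun ε _ => ?_
  rw [map_smul, Pi.smul_apply, smul_eq_mul, div_mul_eq_mul_div]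
  rfl

lemma onFstLin_lSnd (hη : 0 < η.im) (hθ : ∀ a, theta a η τ ≠ 0) (A : Module.End ℂ (ℂ → ℂ))
    (a b : ℂ) (i k : Fin 2) (Φ : ℂ × ℂ → ℂ) :
    onFstLin A (lSnd η τ a b i k Φ) = lSnd η τ a b i k (onFstLin A Φ) := by
  funext z
  have e : (fun x => lSnd η τ a b i k Φ (x, z.2)) = ∑ ε : ℤˣ, ((ε : ℤ) *
      lCoeff τ i k (a + b + η) (2 * ((ε : ℤ) * z.2) + (b - a + η)) / theta 0 (2 * z.2) τ) •
        fun x => Φ (x, z.2 + (ε : ℤ) * η) := by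
    funext x
    rw [lSnd_apply, lOp_apply' hη hθ, Finset.sum_apply]
    refine Finset.sum_congr rfl fun ε _ => ?_
    rw [Pi.smul_apply, smul_eq_mul]
    ring
  change A (fun x => lSnd η τ a b i k Φ (x, z.2)) z.1 = _
  rw [e, map_sum, lSnd_apply, lOp_apply' hη hθ, Finset.sum_apply]
  refine Finset.sum_congr rfl fun ε _ => ?_
  rw [map_smul, Pi.smul_apply, smul_eq_mul, div_mul_eq_mul_div]
  rfl

theorem rOp_rll_of_relations (hη : 0 < η.im) (hθ : ∀ a, theta a η τ ≠ 0)
    (W : Submodule ℂ (ℂ × ℂ → ℂ)) (A₁ A₃ : Params → Module.End ℂ (ℂ → ℂ))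
    (S₂ : Params → Module.End ℂ (ℂ × ℂ → ℂ))
    (hL : ∀ a b i k, ∀ Φ ∈ W, lFst η τ a b i k Φ ∈ W ∧ lSnd η τ a b i k Φ ∈ W)
    (hS : ∀ u, ∀ Φ ∈ W, onFst (A₁ u) Φ ∈ W ∧ S₂ u Φ ∈ W ∧ onSnd (A₃ u) Φ ∈ W)
    (h1 : ∀ u, ∀ Φ ∈ W, ∀ i k,
      onFst (A₁ u) (lFst η τ (u 0) (u 1) i k Φ) = lFst η τ (u 1) (u 0) i k (onFst (A₁ u) Φ))
    (h3 : ∀ u, ∀ Φ ∈ W, ∀ i k,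
      onSnd (A₃ u) (lSnd η τ (u 2) (u 3) i k Φ) = lSnd η τ (u 3) (u 2) i k (onSnd (A₃ u) Φ))
    (h2 : ∀ u, ∀ Φ ∈ W, ∀ i k,
      S₂ u ((lFst η τ (u 0) (u 1) * sigma₃ * lSnd η τ (u 2) (u 3)) i k Φ)
        = (lFst η τ (u 0) (u 2) * sigma₃ * lSnd η τ (u 1) (u 3)) i k (S₂ u Φ))
    (u : Params) {Φ : ℂ × ℂ → ℂ} (hΦ : Φ ∈ W) (i k : Fin 2) :
    rOp (fun u => onFst (A₁ u)) (fun u => S₂ u) (fun u => onSnd (A₃ u)) u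
        ((lFst η τ (u 0) (u 1) * sigma₃ * lSnd η τ (u 2) (u 3)) i k Φ)
      = (lFst η τ (u 2) (u 3) * sigma₃ * lSnd η τ (u 0) (u 1)) i k
        (rOp (fun u => onFst (A₁ u)) (fun u => S₂ u) (fun u => onSnd (A₃ u)) u Φ) := by
  have w1 := (hS u Φ hΦ).2.1
  have w2 := (hS (s₂ u) _ w1).2.2
  have w3 := (hS (s₃ (s₂ u)) _ w2).1
  have h3' := h3 (s₂ u)
  rw [show s₂ u 2 = u 1 from rfl, show s₂ u 3 = u 3 from rfl] at h3'
  have h1' := h1 (s₃ (s₂ u))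
  rw [show s₃ (s₂ u) 0 = u 0 from rfl, show s₃ (s₂ u) 1 = u 2 from rfl] at h1'
  have h2' := h2 (s₁ (s₃ (s₂ u)))
  rw [show s₁ (s₃ (s₂ u)) 0 = u 2 from rfl, show s₁ (s₃ (s₂ u)) 1 = u 0 from rfl,
    show s₁ (s₃ (s₂ u)) 2 = u 3 from rfl, show s₁ (s₃ (s₂ u)) 3 = u 1 from rfl] at h2'
  have k3 : ∀ Ψ ∈ W, onSnd (A₃ (s₂ u)) ((lFst η τ (u 0) (u 2) * sigma₃ *
      lSnd η τ (u 1) (u 3)) i k Ψ) = (lFst η τ (u 0) (u 2) * sigma₃ *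
        lSnd η τ (u 3) (u 1)) i k (onSnd (A₃ (s₂ u)) Ψ) := by
    intro Ψ hΨ
    change onSndLin (A₃ (s₂ u)) _ = _
    rw [mul_sigma₃_mul_eq_sum, mul_sigma₃_mul_eq_sum, map_sum]
    refine Finset.sum_congr rfl fun m _ => ?_
    rw [map_smul, onSndLin_lFst hη hθ]
    exact congrArg (fun X => pauli 3 m m • lFst η τ (u 0) (u 2) i m X) (h3' Ψ hΨ m k)
  have k1 : ∀ Ψ ∈ W, onFst (A₁ (s₃ (s₂ u))) ((lFst η τ (u 0) (u 2) * sigma₃ *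
      lSnd η τ (u 3) (u 1)) i k Ψ) = (lFst η τ (u 2) (u 0) * sigma₃ *
        lSnd η τ (u 3) (u 1)) i k (onFst (A₁ (s₃ (s₂ u))) Ψ) := by
    intro Ψ hΨ
    change onFstLin (A₁ (s₃ (s₂ u))) _ = _
    rw [mul_sigma₃_mul_eq_sum, mul_sigma₃_mul_eq_sum, map_sum]
    refine Finset.sum_congr rfl fun m _ => ?_
    rw [map_smul]
    -- S₁ meets L₁ applied to L₂Ψ, so its relation is used for L₂Ψ, which lies in W by invariance.
    refine (congrArg (fun X => pauli 3 m m • X)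
      (h1' _ (hL (u 3) (u 1) m k Ψ hΨ).2 i m)).trans ?_
    exact congrArg (fun X => pauli 3 m m • lFst η τ (u 2) (u 0) i m X)
      (onFstLin_lSnd hη hθ (A₁ (s₃ (s₂ u))) (u 3) (u 1) m k Ψ)
  simp only [rOp]
  rw [h2 u Φ hΦ, k3 _ w1, k1 _ w2]
  exact h2' _ w3 i k

end Algebra

end EllipticRLL

theorem theorem3 (τ η : ℂ) (hτ : 0 < τ.im) (hη : 0 < η.im) (hθ : ∀ a, theta a η τ ≠ 0) :
    -- any operators that satisfy the defining relations of `S₁, S₂, S₃` on a space `W`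
    (∀ (W : Submodule ℂ (ℂ × ℂ → ℂ)) (A₁ A₃ : Params → Module.End ℂ (ℂ → ℂ))
        (S₂ : Params → Module.End ℂ (ℂ × ℂ → ℂ)),
      (∀ a b i k, ∀ Φ ∈ W, lFst η τ a b i k Φ ∈ W ∧ lSnd η τ a b i k Φ ∈ W) →
      (∀ u, ∀ Φ ∈ W, onFst (A₁ u) Φ ∈ W ∧ S₂ u Φ ∈ W ∧ onSnd (A₃ u) Φ ∈ W) →
      (∀ u, ∀ Φ ∈ W, ∀ i k,
        onFst (A₁ u) (lFst η τ (u 0) (u 1) i k Φ) = lFst η τ (u 1) (u 0) i k (onFst (A₁ u) Φ)) →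
      (∀ u, ∀ Φ ∈ W, ∀ i k,
        onSnd (A₃ u) (lSnd η τ (u 2) (u 3) i k Φ) = lSnd η τ (u 3) (u 2) i k (onSnd (A₃ u) Φ)) →
      (∀ u, ∀ Φ ∈ W, ∀ i k,
        S₂ u ((lFst η τ (u 0) (u 1) * sigma₃ * lSnd η τ (u 2) (u 3)) i k Φ)
          = (lFst η τ (u 0) (u 2) * sigma₃ * lSnd η τ (u 1) (u 3)) i k (S₂ u Φ)) →
      ∀ u, ∀ Φ ∈ W, ∀ i k,
        rOp (fun u => onFst (A₁ u)) (fun u => S₂ u) (fun u => onSnd (A₃ u)) u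
            ((lFst η τ (u 0) (u 1) * sigma₃ * lSnd η τ (u 2) (u 3)) i k Φ)
          = (lFst η τ (u 2) (u 3) * sigma₃ * lSnd η τ (u 0) (u 1)) i k
            (rOp (fun u => onFst (A₁ u)) (fun u => S₂ u) (fun u => onSnd (A₃ u)) u Φ)) ∧
    -- the explicit operators satisfy the defining relations
    (∀ Φ : ℂ × ℂ → ℂ, (∀ z₂, Admissible η fun x => Φ (x, z₂)) →
      Intertwines (opS₁ η τ) (fun u => lFst η τ (u 0) (u 1)) (fun u => lFst η τ (u 1) (u 0))
        (domS₁ η τ) (stepsFst η) (regFst τ) Φ) ∧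
    (∀ Φ : ℂ × ℂ → ℂ, (∀ z₁, Admissible η fun y => Φ (z₁, y)) →
      Intertwines (opS₃ η τ) (fun u => lSnd η τ (u 2) (u 3)) (fun u => lSnd η τ (u 3) (u 2))
        (domS₃ η τ) (stepsSnd η) (regSnd τ) Φ) ∧
    (∀ Φ : ℂ × ℂ → ℂ,
      Intertwines (opS₂ η τ)
        (fun u => lFst η τ (u 0) (u 1) * sigma₃ * lSnd η τ (u 2) (u 3))
        (fun u => lFst η τ (u 0) (u 2) * sigma₃ * lSnd η τ (u 1) (u 3))
        (domS₂ η τ) (stepsBoth η) (regFst τ ∩ regSnd τ) Φ) ∧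
    -- the explicit operator `R₁₂` solves the relation `RLL = LLR`
    (∀ Φ : ℂ × ℂ → ℂ, Admissible₂ η Φ →
      Intertwines (rOp (opS₁ η τ) (opS₂ η τ) (opS₃ η τ))
        (fun u => lFst η τ (u 0) (u 1) * sigma₃ * lSnd η τ (u 2) (u 3))
        (fun u => lFst η τ (u 2) (u 3) * sigma₃ * lSnd η τ (u 0) (u 1))
        (domR η τ) (stepsBoth η) (regFst τ ∩ regSnd τ) Φ) := by
  refine ⟨?_, ?_, ?_, ?_, ?_⟩
  · intro W A₁ A₃ S₂ hL hS h1 h3 h2 u Φ hΦ i k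
    exact rOp_rll_of_relations hη hθ W A₁ A₃ S₂ hL hS h1 h3 h2 u hΦ i k
  · exact fun Φ hΦ => intertwines_opS₁ hτ hη hθ hΦ
  · exact fun Φ hΦ => intertwines_opS₃ hτ hη hθ hΦ
  · exact fun Φ => intertwines_opS₂ hτ hη hθ Φ
  · exact fun Φ hΦ => intertwines_rOp hτ hη hθ hΦ
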